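/- Let $d \ge 3$ and let $g \colon \mathbb{R}^d\setminus\{0\} \to \mathbb{R}$ be smooth and radial, such that for every $x \ne 0$ the function $\rho \in (0,\infty) \mapsto \rho^{d-1} g(\rho x)$ is non-increasing and convex. Let $0 < s < 1$ and $0 < r < R$, and suppose that $g$ is of one of the following three types: 1. (localized fractional kernel) $g(x) = 1/|x|^{d-1+s}$ for $0 < |x| \le r$ and $g(x) = 0$ for $|x| \ge R$; 2. (kernel with integrable tail) $g(x) = a/|x|^{d-1+s}$ for $0 < |x| \le r$ and $g(x) = b/|x|^{\alpha}$ for $|x| \ge R$, for some $\alpha > d$ and $a, b > 0$; 3. (two-scale fractional kernel) $g(x) = a/|x|^{d-1+s}$ for $0 < |x| \le r$ and $g(x) = b/|x|^{d-1+t}$ for $|x| \ge R$, for some $0 < t < 1$ and $a, b > 0$. Then $\int_{B_1} |x|\,|\nabla g(x)|\,dx + \int_{\mathbb{R}^d\setminus B_1} |\nabla g(x)|\,dx < \infty$, so that for every $u \in C_c^\infty(\mathbb{R}^d)$ the $\mathcal{G}$-fractional gradient $$\mathcal{G}u(x) = -\int_{\mathbb{R}^d} (u(x)-u(y))\, \nabla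 g(x-y)\, dy, \qquad x \in \mathbb{R}^d,$$ is well defined, and there exists a smooth vector field $V \colon \mathbb{R}^d\setminus\{0\} \to \mathbb{R}^d$ such that, for every $u \in C_c^\infty(\mathbb{R}^d)$, $$u(x) = (V * \mathcal{G}u)(x) = \int_{\mathbb{R}^d} V(y)\cdot \mathcal{G}u(x-y)\, dy \qquad \text{for every } x \in \mathbb{R}^d,$$ where the integral converges absolutely. Moreover, the same $V$ satisfies the following: for every multi-index $\nu$ there is a constant $C > 0$ such that $$|\partial^\nu V(x)| \le \frac{C}{|x|^{d-s+|\nu|}} \ \text{ if } 0 < |x| \le 1, \qquad |\partial^\nu V(x)| \le \frac{C}{|x|^{d-\tau+|\nu|}} \ \text{ if } |x| \ge 1,$$ where $\tau = 1$ for types 1 and 2, and $\tau = t$ for type 3. -/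

import Mathlib

open MeasureTheory Set
open scoped ContDiff

/-- The Euclidean space `ℝ^d`. -/
abbrev Rd (d : ℕ) : Type := EuclideanSpace ℝ (Fin d)

/-- Membership in `C_c^∞(ℝ^d)`. -/
def IsTestFunction {d : ℕ} (u : Rd d → ℝ) : Prop :=
  ContDiff ℝ ∞ u ∧ HasCompactSupport u

/-- The integrability condition
`∫_{B_1} |x| |∇g(x)| dx + ∫_{ℝ^d ∖ B_1} |∇g(x)| dx < ∞`,
under which the `𝒢`-fractional gradient is defined. -/
def GradientCondition {d : ℕ} (g : Rd d → ℝ) : Prop :=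
  IntegrableOn (fun x => ‖x‖ * ‖gradient g x‖) (Metric.ball 0 1) ∧
    IntegrableOn (fun x => ‖gradient g x‖) (Metric.ball 0 1)ᶜ

/-- The `𝒢`-fractional gradient `𝒢u(x) = -∫ (u(x) - u(y)) ∇g(x - y) dy`. -/
noncomputable def fractionalGradient {d : ℕ} (g : Rd d → ℝ) (u : Rd d → ℝ) (x : Rd d) : Rd d :=
  -∫ y, (u x - u y) • gradient g (x - y)

/-- The positivity assumption: `g` is smooth on `ℝ^d ∖ {0}` and radial, and
`ρ ∈ (0,∞) ↦ ρ^{d-1} g(ρ x)` is non-increasing and convex for every `x ≠ 0`. -/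
structure PositivityAssumption {d : ℕ} (g : Rd d → ℝ) : Prop where
  smooth : ContDiffOn ℝ ∞ g {0}ᶜ
  radial : ∀ x y : Rd d, ‖x‖ = ‖y‖ → g x = g y
  antitone : ∀ x : Rd d, x ≠ 0 → AntitoneOn (fun ρ : ℝ => ρ ^ ((d : ℝ) - 1) * g (ρ • x)) (Ioi 0)
  convex : ∀ x : Rd d, x ≠ 0 → ConvexOn ℝ (Ioi 0) (fun ρ : ℝ => ρ ^ ((d : ℝ) - 1) * g (ρ • x))

/-- Localized fractional kernel:
`g(x) = 1/|x|^{d-1+s}` for `0 < |x| ≤ r` and `g(x) = 0` for `|x| ≥ R`. -/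
def IsLocalizedKernel {d : ℕ} (s r R : ℝ) (g : Rd d → ℝ) : Prop :=
  (∀ x : Rd d, x ≠ 0 → ‖x‖ ≤ r → g x = 1 / ‖x‖ ^ ((d : ℝ) - 1 + s)) ∧
    (∀ x : Rd d, R ≤ ‖x‖ → g x = 0)

/-- Kernel with integrable tail (for `α > d` and `a, b > 0`):
`g(x) = a/|x|^{d-1+s}` for `0 < |x| ≤ r` and `g(x) = b/|x|^α` for `|x| ≥ R`. -/
def IsIntegrableTailKernel {d : ℕ} (s α a b r R : ℝ) (g : Rd d → ℝ) : Prop :=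
  (∀ x : Rd d, x ≠ 0 → ‖x‖ ≤ r → g x = a / ‖x‖ ^ ((d : ℝ) - 1 + s)) ∧
    (∀ x : Rd d, R ≤ ‖x‖ → g x = b / ‖x‖ ^ α)

/-- Two-scale fractional kernel (for `0 < s, t < 1` and `a, b > 0`):
`g(x) = a/|x|^{d-1+s}` for `0 < |x| ≤ r` and `g(x) = b/|x|^{d-1+t}` for `|x| ≥ R`. -/
def IsTwoScaleKernel {d : ℕ} (s t a b r R : ℝ) (g : Rd d → ℝ) : Prop :=
  (∀ x : Rd d, x ≠ 0 → ‖x‖ ≤ r → g x = a / ‖x‖ ^ ((d : ℝ) - 1 + s)) ∧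
    (∀ x : Rd d, R ≤ ‖x‖ → g x = b / ‖x‖ ^ ((d : ℝ) - 1 + t))

/-- The representation formula `u = V * 𝒢u` in `ℝ^d` for every `u ∈ C_c^∞(ℝ^d)`: at every point
the convolution integral `∫ V(y) · 𝒢u(x - y) dy` converges absolutely and equals `u(x)`. -/
def RepresentationFormula {d : ℕ} (g : Rd d → ℝ) (V : Rd d → Rd d) : Prop :=
  ∀ u : Rd d → ℝ, IsTestFunction u →
    ConvolutionExists V (fractionalGradient g u) (innerSL ℝ) volume ∧
      ∀ x : Rd d, u x = convolution V (fractionalGradient g u) (innerSL ℝ) volume x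

/-- The partial derivative of a vector field in the `i`-th coordinate direction. -/
noncomputable def partialDeriv {d : ℕ} (i : Fin d) (V : Rd d → Rd d) : Rd d → Rd d :=
  fun x => fderiv ℝ V x (EuclideanSpace.single i 1)

/-- The derivative `∂^ν V = ∂_1^{ν_1} ⋯ ∂_d^{ν_d} V` for a multi-index `ν`. -/
noncomputable def multiDeriv {d : ℕ} (ν : Fin d → ℕ) (V : Rd d → Rd d) : Rd d → Rd d :=
  (List.finRange d).foldr (fun i W => (partialDeriv i)^[ν i] W) V

/-- For every multi-index `ν` there is `C > 0` such that `|∂^ν V(x)| ≤ C/|x|^{d-σ+|ν|}` for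
`0 < |x| ≤ 1` and `|∂^ν V(x)| ≤ C/|x|^{d-τ+|ν|}` for `|x| ≥ 1`. -/
def DerivativeBounds {d : ℕ} (σ τ : ℝ) (V : Rd d → Rd d) : Prop :=
  ∀ ν : Fin d → ℕ, ∃ C : ℝ, 0 < C ∧
    (∀ x : Rd d, x ≠ 0 → ‖x‖ ≤ 1 →
      ‖multiDeriv ν V x‖ ≤ C / ‖x‖ ^ ((d : ℝ) - σ + ((∑ i, ν i : ℕ) : ℝ))) ∧
    (∀ x : Rd d, 1 ≤ ‖x‖ →
      ‖multiDeriv ν V x‖ ≤ C / ‖x‖ ^ ((d : ℝ) - τ + ((∑ i, ν i : ℕ) : ℝ)))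

/-! Integration by parts turns the fractional gradient into 𝒢u = g * ∇u, so on the Fourier side it
is multiplication by 2πiξ Γ(ξ), where Γ is the (generalized) Fourier transform of g. Hence V = -∇N,
with N the potential of symbol 1/(4π²|ξ|²Γ(ξ)), formally satisfies V * 𝒢u = u. What must be shown is
that Γ is positive, that its size and derivatives are known, and that N makes sense.

Positivity comes from convexity. Taylor's formula at infinity, k(ρ) = ∫_ρ^∞ (σ-ρ) k''(σ) dσ for k(ρ)
= ρ^{d-1} g(ρ), writes g as a superposition with nonnegative density of dilates of the cone kernel
|z|^{1-d}(1-|z|)_+ (`IsTwoScaleProfile.eq_integral`). In polar coordinates the Jacobian cancels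
|z|^{1-d}, so the transform of the cone is a spherical average of the nonnegative Fejér function
(`coneSymbol_eq_integral_sphere`). By Fubini, convolution with g has the multiplier Γ which
superposes these transforms (`integral_kernel_mul_eq_fourierInv`).

In logarithmic variables Γ is a correlation of the density with a fixed kernel κ. Differentiation
falls on the density, which is an exact exponential near both ends. So Γ is bounded above and below
by, and has all log-derivatives bounded by, |ξ|^{-(1-s)} at high and |ξ|^{-max(1-δ,0)} at low
frequency, when g decays like |x|^{-(d-1+δ)} (`exists_logCorr_le`, `exists_le_logCorr`). The
reciprocal obeys the inverse bounds (`exists_iteratedDeriv_inv_le`).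

Finally 1/(4π²|ξ|²Γ) is cut dyadically. After rescaling, the pieces are bounded uniformly in C_c^∞,
hence their transforms uniformly in the Schwartz space. The pieces N_j sum, with all derivatives,
off the origin (`isDyadicFamily_dyadicPotential`, `IsDyadicFamily.contDiffOn_tsum_nat`), which gives
the bounds on V. Each -∇N_j paired with 𝒢u yields the j-th dyadic piece of u
(`integral_fderiv_dyadicPotential`), and dominated convergence sums them
(`representationFormula_representingField`). -/

/-! ### Two-sided exponential weights -/

/-- The function equal to `e^{pu}` for `u ≤ 0` and to `e^{qu}` for `u > 0`. -/
noncomputable def twoExp (p q u : ℝ) : ℝ := if u ≤ 0 then Real.exp (p * u) else Real.exp (q * u)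

lemma twoExp_of_nonpos {p q u : ℝ} (hu : u ≤ 0) : twoExp p q u = Real.exp (p * u) := if_pos hu

lemma twoExp_of_nonneg {p q u : ℝ} (hu : 0 ≤ u) : twoExp p q u = Real.exp (q * u) := by
  rcases hu.eq_or_lt with rfl | hu
  · simp [twoExp]
  · exact if_neg hu.not_ge

lemma twoExp_pos (p q u : ℝ) : 0 < twoExp p q u := by
  unfold twoExp; split_ifs <;> positivity

lemma measurable_twoExp (p q : ℝ) : Measurable (twoExp p q) :=
  Measurable.ite measurableSet_Iic (by fun_prop) (by fun_prop)

lemma twoExp_le_add {p q q' : ℝ} (h : q ≤ q') (u : ℝ) :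
    twoExp p q u ≤ Real.exp (p * u) + Real.exp (q' * u) := by
  rcases le_total u 0 with hu | hu
  · rw [twoExp_of_nonpos hu]; linarith [Real.exp_pos (q' * u)]
  · rw [twoExp_of_nonneg hu]
    have : Real.exp (q * u) ≤ Real.exp (q' * u) := Real.exp_le_exp.2 (by nlinarith)
    linarith [Real.exp_pos (p * u)]

lemma twoExp_le_left {p q : ℝ} (h : q ≤ p) (u : ℝ) : twoExp p q u ≤ Real.exp (p * u) := by
  rcases le_total u 0 with hu | hu
  · rw [twoExp_of_nonpos hu]
  · rw [twoExp_of_nonneg hu]; exact Real.exp_le_exp.2 (by nlinarith)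

lemma twoExp_le_right {p q : ℝ} (h : q ≤ p) (u : ℝ) : twoExp p q u ≤ Real.exp (q * u) := by
  rcases le_total u 0 with hu | hu
  · rw [twoExp_of_nonpos hu]; exact Real.exp_le_exp.2 (by nlinarith)
  · rw [twoExp_of_nonneg hu]

lemma left_le_twoExp {p q : ℝ} (h : p ≤ q) (u : ℝ) : Real.exp (p * u) ≤ twoExp p q u := by
  rcases le_total u 0 with hu | hu
  · rw [twoExp_of_nonpos hu]
  · rw [twoExp_of_nonneg hu]; exact Real.exp_le_exp.2 (by nlinarith)

lemma right_le_twoExp {p q : ℝ} (h : p ≤ q) (u : ℝ) : Real.exp (q * u) ≤ twoExp p q u := by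
  rcases le_total u 0 with hu | hu
  · rw [twoExp_of_nonpos hu]; exact Real.exp_le_exp.2 (by nlinarith)
  · rw [twoExp_of_nonneg hu]

/-- The logarithm of the weight is piecewise linear with slopes p and q, hence c-Lipschitz. This
compares weights at neighbouring scales. -/
lemma twoExp_le_exp_mul {p q c u v : ℝ} (hp : |p| ≤ c) (hq : |q| ≤ c) :
    twoExp p q u ≤ Real.exp (c * |u - v|) * twoExp p q v := by
  have key : ∀ a x y : ℝ, |a| ≤ c → a * x ≤ c * |x - y| + a * y := by
    intro a x y ha
    have h1 : a * (x - y) ≤ |a| * |x - y| := by rw [← abs_mul]; exact le_abs_self _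
    nlinarith [abs_nonneg (x - y), mul_le_mul_of_nonneg_right ha (abs_nonneg (x - y))]
  rcases le_total u 0 with hu | hu <;> rcases le_total v 0 with hv | hv
  · rw [twoExp_of_nonpos hu, twoExp_of_nonpos hv, ← Real.exp_add]
    exact Real.exp_le_exp.2 (key _ _ _ hp)
  · rw [twoExp_of_nonpos hu, twoExp_of_nonneg hv, ← Real.exp_add]
    refine Real.exp_le_exp.2 ?_
    have h1 := key p u 0 hp
    have h2 := key q 0 v hq
    have e1 : |u - v| = v - u := by rw [abs_of_nonpos] <;> linarith
    have e2 : |u - 0| = - u := by rw [sub_zero, abs_of_nonpos hu]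
    have e3 : |0 - v| = v := by rw [zero_sub, abs_neg, abs_of_nonneg hv]
    rw [e1]; rw [e2] at h1; rw [e3] at h2; nlinarith
  · rw [twoExp_of_nonneg hu, twoExp_of_nonpos hv, ← Real.exp_add]
    refine Real.exp_le_exp.2 ?_
    have h1 := key q u 0 hq
    have h2 := key p 0 v hp
    have e1 : |u - v| = u - v := by rw [abs_of_nonneg]; linarith
    have e2 : |u - 0| = u := by rw [sub_zero, abs_of_nonneg hu]
    have e3 : |0 - v| = -v := by rw [zero_sub, abs_neg, abs_of_nonpos hv]
    rw [e1]; rw [e2] at h1; rw [e3] at h2; nlinarith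
  · rw [twoExp_of_nonneg hu, twoExp_of_nonneg hv, ← Real.exp_add]
    exact Real.exp_le_exp.2 (key _ _ _ hq)

lemma integrable_twoExp {p q : ℝ} (hp : 0 < p) (hq : q < 0) : Integrable (twoExp p q) := by
  have h1 : IntegrableOn (twoExp p q) (Iic 0) :=
    (integrableOn_exp_mul_Iic hp 0).congr_fun
      (fun u hu => (twoExp_of_nonpos hu).symm) measurableSet_Iic
  have h2 : IntegrableOn (twoExp p q) (Ioi 0) :=
    (integrableOn_exp_mul_Ioi hq 0).congr_fun
      (fun u hu => (twoExp_of_nonneg (le_of_lt hu)).symm) measurableSet_Ioi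
  rw [← integrableOn_univ, ← Iic_union_Ioi (a := (0 : ℝ))]
  exact h1.union h2

/-! ### Correlations of exponential symbols with a kernel -/

/-- A bounded nonnegative kernel with finite exponential moments of all orders in `(0,1)` which is
bounded below near `-∞`. -/
structure IsLogKernel (κ : ℝ → ℝ) : Prop where
  measurable : Measurable κ
  nonneg : ∀ u, 0 ≤ κ u
  bounded : ∃ M, ∀ u, κ u ≤ M
  integrable_exp : ∀ θ : ℝ, 0 < θ → θ < 1 → Integrable (fun u => Real.exp (θ * u) * κ u)
  lower : ∃ c > 0, ∃ y₀, ∀ u ≤ y₀, c ≤ κ u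

/-- The correlation `v ↦ ∫ φ(u - v) κ(u) du`. -/
noncomputable def logCorr (κ φ : ℝ → ℝ) (v : ℝ) : ℝ := ∫ u, φ (u - v) * κ u

/-- All derivatives of `φ` are controlled by `twoExp p q`. -/
def IsTwoExpSymbol (p q : ℝ) (φ : ℝ → ℝ) : Prop :=
  ContDiff ℝ ∞ φ ∧ ∀ n : ℕ, ∃ C, ∀ u, |iteratedDeriv n φ u| ≤ C * twoExp p q u

lemma IsTwoExpSymbol.deriv {p q : ℝ} {φ : ℝ → ℝ} (h : IsTwoExpSymbol p q φ) :
    IsTwoExpSymbol p q (deriv φ) := by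
  refine ⟨(contDiff_infty_iff_deriv.1 h.1).2, fun n => ?_⟩
  obtain ⟨C, hC⟩ := h.2 (n + 1)
  exact ⟨C, fun u => by rw [← iteratedDeriv_succ']; exact hC u⟩

lemma IsTwoExpSymbol.neg {p q : ℝ} {φ : ℝ → ℝ} (h : IsTwoExpSymbol p q φ) :
    IsTwoExpSymbol p q (-φ) := by
  refine ⟨h.1.neg, fun n => ?_⟩
  obtain ⟨C, hC⟩ := h.2 n
  exact ⟨C, fun u => by rw [iteratedDeriv_neg, abs_neg]; exact hC u⟩

lemma IsTwoExpSymbol.exists_bound {p q : ℝ} {φ : ℝ → ℝ} (h : IsTwoExpSymbol p q φ) :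
    ∃ C, 0 ≤ C ∧ ∀ u, |φ u| ≤ C * twoExp p q u := by
  obtain ⟨C, hC⟩ := h.2 0
  refine ⟨C, ?_, by simpa using hC⟩
  have := (abs_nonneg _).trans (hC 0)
  exact nonneg_of_mul_nonneg_left this (twoExp_pos _ _ _)

section LogCorr

variable {κ : ℝ → ℝ} (hκ : IsLogKernel κ) {p q : ℝ} (hp0 : 0 < p) (hp1 : p < 1) (hq0 : q ≠ 0)
  (hq1 : q < 1)

include hκ in
lemma IsLogKernel.integrable_exp_sub (v : ℝ) {θ : ℝ} (h0 : 0 < θ) (h1 : θ < 1) :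
    Integrable (fun u => Real.exp (θ * (u - v)) * κ u) := by
  refine ((hκ.integrable_exp θ h0 h1).const_mul (Real.exp (-(θ * v)))).congr
    (Filter.Eventually.of_forall fun u => ?_)
  simp only
  rw [← mul_assoc, ← Real.exp_add]; ring_nf

include hp0 hp1 hq0 hq1 in
-- When q < 0 the right branch decays and p can serve again as q'. Both exponents then lie in (0,1),
-- where the kernel has moments.
lemma exists_exp_dominating : ∃ q', 0 < q' ∧ q' < 1 ∧
    ∀ u, twoExp p q u ≤ Real.exp (p * u) + Real.exp (q' * u) := by
  rcases lt_or_gt_of_ne hq0 with h | h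
  · exact ⟨p, hp0, hp1, fun u => twoExp_le_add (by linarith) u⟩
  · exact ⟨q, h, hq1, fun u => twoExp_le_add le_rfl u⟩

include hκ hp0 hp1 hq0 hq1 in
lemma integrable_twoExp_sub_mul (v : ℝ) : Integrable (fun u => twoExp p q (u - v) * κ u) := by
  obtain ⟨q', h0, h1, hle⟩ := exists_exp_dominating hp0 hp1 hq0 hq1
  refine ((hκ.integrable_exp_sub v hp0 hp1).add (hκ.integrable_exp_sub v h0 h1)).mono'
    ((((measurable_twoExp p q).comp (by fun_prop)).mul hκ.measurable).aestronglyMeasurable)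
    (Filter.Eventually.of_forall fun u => ?_)
  rw [Real.norm_of_nonneg (mul_nonneg (twoExp_pos _ _ _).le (hκ.nonneg u))]
  simp only [Pi.add_apply]
  rw [← add_mul]
  exact mul_le_mul_of_nonneg_right (hle _) (hκ.nonneg u)

include hκ hp0 hp1 hq0 hq1 in
lemma integrable_logCorr {φ : ℝ → ℝ} (hφ : IsTwoExpSymbol p q φ) (v : ℝ) :
    Integrable (fun u => φ (u - v) * κ u) := by
  obtain ⟨C, hC0, hC⟩ := hφ.exists_bound
  refine ((integrable_twoExp_sub_mul hκ hp0 hp1 hq0 hq1 v).const_mul C).mono'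
    (((hφ.1.continuous.measurable.comp (by fun_prop)).mul hκ.measurable).aestronglyMeasurable)
    (Filter.Eventually.of_forall fun u => ?_)
  rw [norm_mul, Real.norm_of_nonneg (hκ.nonneg u), ← mul_assoc]
  exact mul_le_mul_of_nonneg_right (hC _) (hκ.nonneg u)

include hκ hp0 hp1 hq0 hq1 in
-- The variable v enters only through φ(u - v), so κ is never differentiated; the sign is that of
-- d(u - v)/dv. The Lipschitz property of the log-weight gives one majorant for all w within
-- distance 1 of v.
lemma hasDerivAt_logCorr {φ : ℝ → ℝ} (hφ : IsTwoExpSymbol p q φ) (v : ℝ) :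
    HasDerivAt (logCorr κ φ) (logCorr κ (-deriv φ) v) v := by
  obtain ⟨C, hC0, hC⟩ := hφ.deriv.exists_bound
  set c := max |p| |q|
  refine (hasDerivAt_integral_of_dominated_loc_of_deriv_le (μ := volume)
    (F := fun v u => φ (u - v) * κ u) (F' := fun v u => (-deriv φ) (u - v) * κ u)
    (bound := fun u => C * Real.exp c * (twoExp p q (u - v) * κ u))
    (Metric.ball_mem_nhds v one_pos)
    (Filter.Eventually.of_forall fun w =>
      ((hφ.1.continuous.measurable.comp (by fun_prop)).mul hκ.measurable).aestronglyMeasurable)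
    (integrable_logCorr hκ hp0 hp1 hq0 hq1 hφ v)
    (integrable_logCorr hκ hp0 hp1 hq0 hq1 hφ.deriv.neg v).aestronglyMeasurable
    (Filter.Eventually.of_forall fun u w hw => ?_)
    ((integrable_twoExp_sub_mul hκ hp0 hp1 hq0 hq1 v).const_mul _)
    (Filter.Eventually.of_forall fun u w hw => ?_)).2
  · rw [norm_mul, Real.norm_of_nonneg (hκ.nonneg u), ← mul_assoc]
    refine mul_le_mul_of_nonneg_right ?_ (hκ.nonneg u)
    rw [Pi.neg_apply, norm_neg, mul_assoc]
    refine (hC _).trans (mul_le_mul_of_nonneg_left ?_ hC0)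
    refine (twoExp_le_exp_mul (c := c) (v := u - v) (le_max_left _ _) (le_max_right _ _)).trans ?_
    refine mul_le_mul_of_nonneg_right (Real.exp_le_exp.2 ?_) (twoExp_pos _ _ _).le
    have : |u - w - (u - v)| ≤ 1 := by
      rw [show u - w - (u - v) = -(w - v) by ring, abs_neg]
      exact (Metric.mem_ball.1 hw).le
    have hc : 0 ≤ c := (abs_nonneg p).trans (le_max_left _ _)
    nlinarith
  · have h1 : HasDerivAt φ (deriv φ (u - w)) (u - w) :=
      ((hφ.1.differentiable (by simp)) _).hasDerivAt
    have h2 : HasDerivAt (fun w : ℝ => u - w) (-1) w := by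
      simpa using (hasDerivAt_id w).const_sub u
    have := (h1.comp w h2).mul_const (κ u)
    simpa using this

include hκ hp0 hp1 hq0 hq1 in
-- Since -φ' is a symbol of the same class, every derivative is again a correlation, and derivative
-- bounds reduce to size bounds.
lemma iteratedDeriv_logCorr (n : ℕ) : ∀ {φ : ℝ → ℝ}, IsTwoExpSymbol p q φ →
    ContDiff ℝ n (logCorr κ φ) ∧
    ∃ φ', IsTwoExpSymbol p q φ' ∧ iteratedDeriv n (logCorr κ φ) = logCorr κ φ' := by
  induction n with
  | zero =>
    intro φ hφ
    refine ⟨contDiff_zero.2 (continuous_iff_continuousAt.2 fun v =>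
      (hasDerivAt_logCorr hκ hp0 hp1 hq0 hq1 hφ v).continuousAt), φ, hφ, iteratedDeriv_zero⟩
  | succ n ih =>
    intro φ hφ
    have hd : deriv (logCorr κ φ) = logCorr κ (-deriv φ) :=
      funext fun v => (hasDerivAt_logCorr hκ hp0 hp1 hq0 hq1 hφ v).deriv
    have := ih hφ.deriv.neg
    constructor
    · rw [show ((n + 1 : ℕ) : ℕ∞ω) = (n : ℕ∞ω) + 1 by simp, contDiff_succ_iff_deriv]
      refine ⟨fun v => (hasDerivAt_logCorr hκ hp0 hp1 hq0 hq1 hφ v).differentiableAt, by simp, ?_⟩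
      rw [hd]; exact this.1
    · rw [iteratedDeriv_succ', hd]; exact this.2

include hκ hp0 hp1 hq0 hq1 in
lemma contDiff_logCorr {φ : ℝ → ℝ} (hφ : IsTwoExpSymbol p q φ) : ContDiff ℝ ∞ (logCorr κ φ) :=
  contDiff_infty.2 fun n => (iteratedDeriv_logCorr hκ hp0 hp1 hq0 hq1 n hφ).1

lemma integral_exp_sub_mul (θ v : ℝ) : ∫ u, Real.exp (θ * (u - v)) * κ u =
    Real.exp (θ * -v) * ∫ u, Real.exp (θ * u) * κ u := by
  rw [← integral_const_mul]
  congr 1 with u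
  rw [← mul_assoc, ← Real.exp_add]; ring_nf

include hκ hp0 hp1 hq0 hq1 in
-- If q < 0, growth as v → -∞ saturates because κ is bounded and the weight integrable: this is the
-- origin of max q 0, and q = 0 would cost a factor |v|. If q > 0, the weight is dominated by the
-- sum of both exponentials when p ≤ q, and by each of them when q ≤ p, so that the sign of v
-- decides which to use.
lemma exists_integral_twoExp_le :
    ∃ C, ∀ v, ∫ u, twoExp p q (u - v) * κ u ≤ C * twoExp p (max q 0) (-v) := by
  have hint := integrable_twoExp_sub_mul hκ hp0 hp1 hq0 hq1
  have hI0 : ∀ θ : ℝ, 0 ≤ ∫ u, Real.exp (θ * u) * κ u := fun θ =>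
    integral_nonneg fun u => mul_nonneg (Real.exp_pos _).le (hκ.nonneg u)
  have single : ∀ θ, 0 < θ → θ < 1 → (∀ u, twoExp p q u ≤ Real.exp (θ * u)) → ∀ v,
      ∫ u, twoExp p q (u - v) * κ u ≤ (∫ u, Real.exp (θ * u) * κ u) * Real.exp (θ * -v) := by
    intro θ h0 h1 h v
    rw [mul_comm, ← integral_exp_sub_mul]
    exact integral_mono (hint v) (hκ.integrable_exp_sub v h0 h1) fun u =>
      mul_le_mul_of_nonneg_right (h _) (hκ.nonneg u)
  rcases lt_or_gt_of_ne hq0 with hq | hq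
  · rw [max_eq_right hq.le]
    obtain ⟨M, hM⟩ := hκ.bounded
    have hM0 : 0 ≤ M := (hκ.nonneg 0).trans (hM 0)
    have hT := integrable_twoExp hp0 hq
    have hT0 : 0 ≤ ∫ u, twoExp p q u := integral_nonneg fun u => (twoExp_pos _ _ _).le
    refine ⟨(∫ u, Real.exp (p * u) * κ u) + M * ∫ u, twoExp p q u, fun v => ?_⟩
    rcases le_total (-v) 0 with hv | hv
    · rw [twoExp_of_nonpos hv]
      refine (single p hp0 hp1 (fun u => twoExp_le_left (by linarith) u) v).trans ?_
      refine mul_le_mul_of_nonneg_right ?_ (Real.exp_pos _).le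
      have := mul_nonneg hM0 hT0
      linarith
    · rw [twoExp_of_nonneg hv, zero_mul, Real.exp_zero, mul_one]
      have : ∫ u, twoExp p q (u - v) * κ u ≤ ∫ u, M * twoExp p q (u - v) :=
        integral_mono (hint v) ((hT.comp_sub_right v).const_mul M) fun u => by
          simp only
          rw [mul_comm]; exact mul_le_mul_of_nonneg_right (hM u) (twoExp_pos _ _ _).le
      rw [integral_const_mul, integral_sub_right_eq_self (twoExp p q)] at this
      linarith [hI0 p]
  · rw [max_eq_left hq.le]
    rcases le_total p q with hpq | hpq
    · refine ⟨(∫ u, Real.exp (p * u) * κ u) + ∫ u, Real.exp (q * u) * κ u, fun v => ?_⟩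
      have : ∫ u, twoExp p q (u - v) * κ u ≤
          ∫ u, (Real.exp (p * (u - v)) * κ u + Real.exp (q * (u - v)) * κ u) :=
        integral_mono (hint v) ((hκ.integrable_exp_sub v hp0 hp1).add
          (hκ.integrable_exp_sub v hq hq1)) fun u => by
            simp only
            rw [← add_mul]
            exact mul_le_mul_of_nonneg_right (twoExp_le_add le_rfl _) (hκ.nonneg u)
      rw [integral_add (hκ.integrable_exp_sub v hp0 hp1) (hκ.integrable_exp_sub v hq hq1),
        integral_exp_sub_mul, integral_exp_sub_mul] at this
      refine this.trans ?_
      rw [add_mul, mul_comm, mul_comm (Real.exp (q * -v))]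
      exact add_le_add (mul_le_mul_of_nonneg_left (left_le_twoExp hpq _) (hI0 p))
        (mul_le_mul_of_nonneg_left (right_le_twoExp hpq _) (hI0 q))
    · refine ⟨(∫ u, Real.exp (p * u) * κ u) + ∫ u, Real.exp (q * u) * κ u, fun v => ?_⟩
      rcases le_total (-v) 0 with hv | hv
      · rw [twoExp_of_nonpos hv]
        refine (single p hp0 hp1 (fun u => twoExp_le_left hpq u) v).trans ?_
        exact mul_le_mul_of_nonneg_right (by linarith [hI0 q]) (Real.exp_pos _).le
      · rw [twoExp_of_nonneg hv]
        refine (single q hq hq1 (fun u => twoExp_le_right hpq u) v).trans ?_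
        exact mul_le_mul_of_nonneg_right (by linarith [hI0 p]) (Real.exp_pos _).le

include hκ hp0 hp1 hq0 hq1 in
lemma exists_logCorr_le {φ : ℝ → ℝ} (hφ : IsTwoExpSymbol p q φ) :
    ∃ C, ∀ v, |logCorr κ φ v| ≤ C * twoExp p (max q 0) (-v) := by
  obtain ⟨C, hC0, hC⟩ := hφ.exists_bound
  obtain ⟨C', hC'⟩ := exists_integral_twoExp_le hκ hp0 hp1 hq0 hq1
  refine ⟨C * C', fun v => ?_⟩
  rw [mul_assoc]
  refine le_trans ?_ (mul_le_mul_of_nonneg_left (hC' v) hC0)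
  rw [← integral_const_mul, ← Real.norm_eq_abs]
  refine norm_integral_le_of_norm_le
    ((integrable_twoExp_sub_mul hκ hp0 hp1 hq0 hq1 v).const_mul C)
    (Filter.Eventually.of_forall fun u => ?_)
  rw [norm_mul, Real.norm_of_nonneg (hκ.nonneg u), ← mul_assoc]
  exact mul_le_mul_of_nonneg_right (hC _) (hκ.nonneg u)

include hκ hp0 hp1 hq0 hq1 in
lemma exists_iteratedDeriv_logCorr_le {φ : ℝ → ℝ} (hφ : IsTwoExpSymbol p q φ) (n : ℕ) :
    ∃ C, ∀ v, |iteratedDeriv n (logCorr κ φ) v| ≤ C * twoExp p (max q 0) (-v) := by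
  obtain ⟨-, φ', hφ', he⟩ := iteratedDeriv_logCorr hκ hp0 hp1 hq0 hq1 n hφ
  rw [he]; exact exists_logCorr_le hκ hp0 hp1 hq0 hq1 hφ'

include hκ hp0 hp1 hq0 hq1 in
-- It is enough to integrate over one unit window on which κ ≥ c₀, placed so that u - v falls where
-- φ has a known lower bound.
lemma exists_le_logCorr {φ : ℝ → ℝ} (hφ : IsTwoExpSymbol p q φ) (hφ0 : ∀ u, 0 ≤ φ u)
    {A u₀ : ℝ} (hA : 0 < A) (hleft : ∀ u ≤ u₀, A * Real.exp (p * u) ≤ φ u)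
    (hright : 0 < q → ∃ B > 0, ∃ u₁, ∀ u ≥ u₁, B * Real.exp (q * u) ≤ φ u) :
    ∃ c > 0, ∀ v, c * twoExp p (max q 0) (-v) ≤ logCorr κ φ v := by
  obtain ⟨c₀, hc₀, y₀, hlow⟩ := hκ.lower
  have key : ∀ v a m : ℝ, a ≤ y₀ → 0 ≤ m → (∀ u ∈ Icc (a - 1) a, m ≤ φ (u - v)) →
      m * c₀ ≤ logCorr κ φ v := by
    intro v a m ha hm h
    have hi := integrable_logCorr hκ hp0 hp1 hq0 hq1 hφ v
    have h1 : ∫ u in Icc (a - 1) a, φ (u - v) * κ u ≤ logCorr κ φ v :=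
      setIntegral_le_integral hi
        (Filter.Eventually.of_forall fun u => mul_nonneg (hφ0 _) (hκ.nonneg u))
    have h2 : ∫ u in Icc (a - 1) a, m * c₀ ≤ ∫ u in Icc (a - 1) a, φ (u - v) * κ u := by
      refine setIntegral_mono_on (continuous_const.integrableOn_Icc) hi.integrableOn measurableSet_Icc fun u hu => ?_
      exact mul_le_mul (h u hu) (hlow u (hu.2.trans ha)) hc₀.le (hφ0 _)
    simp at h2
    linarith
  set y₁ := min y₀ u₀
  have hy0 : y₁ ≤ y₀ := min_le_left _ _
  have hu0 : y₁ ≤ u₀ := min_le_right _ _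
  set c₁ := A * Real.exp (p * (y₁ - 1)) * c₀ with hc₁
  have hc₁0 : 0 < c₁ := by positivity
  have hpos : ∀ v, 0 ≤ v → c₁ * Real.exp (p * -v) ≤ logCorr κ φ v := by
    intro v hv
    have := key v y₁ (A * Real.exp (p * (y₁ - 1)) * Real.exp (p * -v)) hy0 (by positivity) ?_
    · calc _ = A * Real.exp (p * (y₁ - 1)) * Real.exp (p * -v) * c₀ := by rw [hc₁]; ring
        _ ≤ _ := this
    · intro u hu
      refine le_trans ?_ (hleft (u - v) (by linarith [hu.2]))
      rw [mul_assoc, ← Real.exp_add]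
      refine mul_le_mul_of_nonneg_left (Real.exp_le_exp.2 ?_) hA.le
      nlinarith [hu.1]
  -- The window moves with v and stays left of y₀ because v ≤ 0, so u - v remains in the fixed
  -- interval [y₁ - 1, y₁].
  have hneg : ∀ v, v ≤ 0 → c₁ ≤ logCorr κ φ v := by
    intro v hv
    refine key v (y₁ + v) (A * Real.exp (p * (y₁ - 1))) (by linarith) (by positivity) ?_
    intro u hu
    refine le_trans ?_ (hleft (u - v) (by linarith [hu.2]))
    refine mul_le_mul_of_nonneg_left (Real.exp_le_exp.2 ?_) hA.le
    nlinarith [hu.1]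
  rcases lt_or_gt_of_ne hq0 with hq | hq
  · rw [max_eq_right hq.le]
    refine ⟨c₁, hc₁0, fun v => ?_⟩
    rcases le_total (-v) 0 with hv | hv
    · rw [twoExp_of_nonpos hv]; exact hpos v (by linarith)
    · rw [twoExp_of_nonneg hv]; simpa using hneg v (by linarith)
  · rw [max_eq_left hq.le]
    obtain ⟨B, hB, u₁, hB'⟩ := hright hq
    set c₂ := B * Real.exp (q * (y₀ - 1)) * c₀ with hc₂
    have hc₂0 : 0 < c₂ := by positivity
    -- The constant c₃ covers y₀ - 1 - u₁ ≤ v ≤ 0, where the window used for c₂ does not reach u₁;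
    -- there e^{-qv} is bounded and the bound c₁ suffices.
    set c₃ := c₁ * Real.exp (q * (y₀ - 1 - u₁)) with hc₃
    have hc₃0 : 0 < c₃ := by positivity
    refine ⟨min c₁ (min c₂ c₃), by positivity, fun v => ?_⟩
    rcases le_total (-v) 0 with hv | hv
    · rw [twoExp_of_nonpos hv]
      refine le_trans ?_ (hpos v (by linarith))
      exact mul_le_mul_of_nonneg_right (min_le_left _ _) (Real.exp_pos _).le
    · rw [twoExp_of_nonneg hv]
      rcases le_total v (y₀ - 1 - u₁) with hv' | hv'
      · have := key v y₀ (B * Real.exp (q * (y₀ - 1)) * Real.exp (q * -v)) le_rfl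
          (by positivity) ?_
        · refine le_trans (mul_le_mul_of_nonneg_right ((min_le_right _ _).trans (min_le_left _ _))
            (Real.exp_pos _).le) ?_
          calc _ = B * Real.exp (q * (y₀ - 1)) * Real.exp (q * -v) * c₀ := by rw [hc₂]; ring
            _ ≤ _ := this
        · intro u hu
          refine le_trans ?_ (hB' (u - v) (by linarith [hu.1]))
          rw [mul_assoc, ← Real.exp_add]
          refine mul_le_mul_of_nonneg_left (Real.exp_le_exp.2 ?_) hB.le
          nlinarith [hu.1]
      · refine le_trans ?_ (hneg v (by linarith))
        refine le_trans (mul_le_mul_of_nonneg_right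
          ((min_le_right _ _).trans (min_le_right _ _)) (Real.exp_pos _).le) ?_
        rw [hc₃, mul_assoc, ← Real.exp_add]
        refine mul_le_of_le_one_right hc₁0.le (Real.exp_le_one_iff.2 ?_)
        nlinarith

end LogCorr

/-! ### Derivatives of reciprocals -/

/-- Derivatives of the reciprocal of a function comparable to `w` whose derivatives are controlled
by `w` are controlled by `w⁻¹`. -/
lemma exists_iteratedDeriv_inv_le {G w : ℝ → ℝ} (hG : ContDiff ℝ ∞ G) (hw : ∀ v, 0 < w v)
    {c : ℝ} (hc : 0 < c) (hlow : ∀ v, c * w v ≤ G v)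
    (hup : ∀ n : ℕ, ∃ C, ∀ v, |iteratedDeriv n G v| ≤ C * w v) (n : ℕ) :
    ∃ C, ∀ v, |iteratedDeriv n (fun v => (G v)⁻¹) v| ≤ C * (w v)⁻¹ := by
  have hGpos : ∀ v, 0 < G v := fun v => (mul_pos hc (hw v)).trans_le (hlow v)
  have hQ : ContDiff ℝ ∞ (fun v => (G v)⁻¹) := hG.inv fun v => (hGpos v).ne'
  have hinv : ∀ v, (G v)⁻¹ ≤ c⁻¹ * (w v)⁻¹ := fun v => by
    rw [← mul_inv]; exact inv_anti₀ (mul_pos hc (hw v)) (hlow v)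
  choose D hD using hup
  induction n using Nat.strong_induction_on with
  | _ n ih =>
    rcases Nat.eq_zero_or_pos n with rfl | hn
    · refine ⟨c⁻¹, fun v => ?_⟩
      simp only [iteratedDeriv_zero]
      rw [abs_of_pos (inv_pos.2 (hGpos v))]
      exact hinv v
    · have : ∀ m : ℕ, ∃ C, m < n → ∀ v, |iteratedDeriv m (fun v => (G v)⁻¹) v| ≤ C * (w v)⁻¹ := by
        intro m
        by_cases hm : m < n
        · obtain ⟨C, hC⟩ := ih m hm; exact ⟨C, fun _ => hC⟩
        · exact ⟨0, fun h => absurd h hm⟩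
      choose C hC using this
      refine ⟨c⁻¹ * ∑ i ∈ Finset.range n, (n.choose i) * C i * D (n - i), fun v => ?_⟩
      -- The n-th derivative of (1/G)·G = 1 vanishes. Leibniz' rule is solved for the term carrying
      -- all n derivatives on 1/G, and the induction controls the others.
      have hprod : ((fun v => (G v)⁻¹) * G) = fun _ => (1 : ℝ) := by
        ext v; simp [(hGpos v).ne']
      have h1 := iteratedDeriv_mul (n := n) (x := v) (f := fun v => (G v)⁻¹) (g := G)
        ((hQ.of_le (by exact_mod_cast le_top)).contDiffAt)
        ((hG.of_le (by exact_mod_cast le_top)).contDiffAt)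
      rw [hprod, iteratedDeriv_const, if_neg hn.ne', Finset.sum_range_succ] at h1
      simp only [Nat.choose_self, Nat.cast_one, one_mul, Nat.sub_self, iteratedDeriv_zero] at h1
      have h2 : iteratedDeriv n (fun v => (G v)⁻¹) v = -(G v)⁻¹ *
          ∑ i ∈ Finset.range n, (n.choose i) * iteratedDeriv i (fun v => (G v)⁻¹) v *
            iteratedDeriv (n - i) G v := by
        rw [← mul_inv_cancel_right₀ (hGpos v).ne' (iteratedDeriv n (fun v => (G v)⁻¹) v),
          eq_neg_of_add_eq_zero_right h1.symm]
        ring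
      rw [h2, abs_mul, abs_neg, abs_of_pos (inv_pos.2 (hGpos v))]
      have h3 : |∑ i ∈ Finset.range n, (n.choose i) * iteratedDeriv i (fun v => (G v)⁻¹) v *
            iteratedDeriv (n - i) G v| ≤ ∑ i ∈ Finset.range n, (n.choose i) * C i * D (n - i) := by
        refine (Finset.abs_sum_le_sum_abs _ _).trans (Finset.sum_le_sum fun i hi => ?_)
        rw [abs_mul, abs_mul, Nat.abs_cast]
        have a1 := hC i (Finset.mem_range.1 hi) v
        have a2 := hD (n - i) v
        calc _ ≤ (n.choose i : ℝ) * (C i * (w v)⁻¹) * (D (n - i) * w v) := by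
                refine mul_le_mul (mul_le_mul_of_nonneg_left a1 (by positivity)) a2
                  (abs_nonneg _) ?_
                exact mul_nonneg (by positivity) ((abs_nonneg _).trans a1)
          _ = _ := by have := (hw v).ne'; field_simp
      calc _ ≤ (c⁻¹ * (w v)⁻¹) * ∑ i ∈ Finset.range n, (n.choose i) * C i * D (n - i) :=
            mul_le_mul (hinv v) h3 (abs_nonneg _) (by have := hw v; positivity)
        _ = _ := by ring

/-! ### Polar coordinates -/

section Polar

variable {d : ℕ} {F : Type*} [NormedAddCommGroup F]

/-- The product measure on `S^{d-1} × (0,∞)` corresponding to Lebesgue measure. -/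
noncomputable abbrev polarMeasure (d : ℕ) :
    Measure (Metric.sphere (0 : Rd d) 1 × Ioi (0 : ℝ)) :=
  (volume : Measure (Rd d)).toSphere.prod (Measure.volumeIoiPow (d - 1))

lemma measurePreserving_polar (d : ℕ) :
    MeasurePreserving (homeomorphUnitSphereProd (Rd d))
      ((volume : Measure (Rd d)).comap (Subtype.val : ({0}ᶜ : Set (Rd d)) → Rd d))
      (polarMeasure d) := by
  have := (volume : Measure (Rd d)).measurePreserving_homeomorphUnitSphereProd
  rwa [finrank_euclideanSpace_fin] at this

lemma smul_polar (x : ({0}ᶜ : Set (Rd d))) :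
    ((homeomorphUnitSphereProd (Rd d) x).2 : ℝ) • ((homeomorphUnitSphereProd (Rd d) x).1 : Rd d)
      = x := by
  have hx : ‖(x : Rd d)‖ ≠ 0 := norm_ne_zero_iff.2 x.2
  simp [homeomorphUnitSphereProd, smul_smul, hx]

lemma integrable_polar [NeZero d] {f : Rd d → F} (hf : Integrable f) :
    Integrable (fun x : Metric.sphere (0 : Rd d) 1 × Ioi (0 : ℝ) => f ((x.2 : ℝ) • (x.1 : Rd d)))
      (polarMeasure d) := by
  rw [← (measurePreserving_polar d).integrable_comp_emb (Homeomorph.measurableEmbedding _)]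
  simp only [Function.comp_def, smul_polar]
  exact (integrableOn_iff_comap_subtypeVal (measurableSet_singleton _).compl).1 hf.integrableOn

lemma integral_polar [NeZero d] [NormedSpace ℝ F] (f : Rd d → F) :
    ∫ x, f x = ∫ x, f ((x.2 : ℝ) • (x.1 : Rd d)) ∂(polarMeasure d) := by
  rw [← (measurePreserving_polar d).integral_comp (Homeomorph.measurableEmbedding _)]
  simp only [smul_polar]
  rw [integral_subtype_comap (measurableSet_singleton _).compl f, restrict_compl_singleton]

lemma integral_volumeIoiPow [NormedSpace ℝ F] (n : ℕ) (f : ℝ → F) :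
    ∫ x : Ioi (0 : ℝ), f x ∂(Measure.volumeIoiPow n) = ∫ x in Ioi (0 : ℝ), x ^ n • f x := by
  simp only [Measure.volumeIoiPow, ENNReal.ofReal]
  rw [integral_withDensity_eq_integral_smul,
    integral_subtype_comap measurableSet_Ioi fun a ↦ Real.toNNReal (a ^ n) • f a,
    setIntegral_congr_fun measurableSet_Ioi fun x hx ↦ ?_]
  · rw [NNReal.smul_def, Real.coe_toNNReal _ (pow_nonneg hx.out.le _)]
  · exact (measurable_subtype_coe.pow_const _).real_toNNReal

lemma integral_eq_integral_sphere [NeZero d] [NormedSpace ℝ F] [CompleteSpace F] {f : Rd d → F}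
    (hf : Integrable f) :
    ∫ x, f x = ∫ θ : Metric.sphere (0 : Rd d) 1,
      (∫ ρ in Ioi (0 : ℝ), ρ ^ (d - 1) • f (ρ • (θ : Rd d))) ∂((volume : Measure (Rd d)).toSphere) := by
  rw [integral_polar, integral_prod _ (integrable_polar hf)]
  congr 1 with θ
  exact integral_volumeIoiPow (d - 1) fun ρ => f (ρ • (θ : Rd d))

end Polar

/-! ### Integrability of coordinate powers on the sphere -/

section Singular

variable {d : ℕ}

lemma integrableOn_abs_rpow {β : ℝ} (hβ : β < 1) :
    Integrable ((Icc (-1) 1).indicator fun t : ℝ => |t| ^ (-β)) := by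
  rw [integrable_indicator_iff measurableSet_Icc]
  have h : IntervalIntegrable (fun t : ℝ => |t| ^ (-β)) volume 0 1 := by
    refine (intervalIntegral.intervalIntegrable_rpow' (by linarith : -1 < -β)).congr ?_
    intro t ht
    rw [uIoc_of_le zero_le_one] at ht
    simp only [abs_of_pos ht.1]
  have h' : IntervalIntegrable (fun t : ℝ => |t| ^ (-β)) volume (-1) 0 := by
    have := (IntervalIntegrable.iff_comp_neg (f := fun t : ℝ => |t| ^ (-β))
      (a := 0) (b := 1)).1 h
    simpa using this.symm
  exact (intervalIntegrable_iff_integrableOn_Icc_of_le (by norm_num)).1 (h'.trans h)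

/-- The ball lies in the cube [-1,1]^d, on which the function is a product of one-variable
integrable functions. -/
lemma integrable_abs_coord_rpow (i : Fin d) {β : ℝ} (hβ : β < 1) :
    Integrable ((Metric.ball (0 : Rd d) 1).indicator fun z : Rd d => |z i| ^ (-β)) := by
  set f : Fin d → ℝ → ℝ := fun j => (Icc (-1) 1).indicator
    fun t : ℝ => if j = i then |t| ^ (-β) else 1
  have hf : Integrable (fun x : Fin d → ℝ => ∏ j, f j (x j)) := by
    refine Integrable.fintype_prod fun j => ?_
    by_cases hj : j = i
    · simpa [f, hj] using integrableOn_abs_rpow hβ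
    · simp only [f, hj, if_false]
      rw [integrable_indicator_iff measurableSet_Icc]
      exact continuous_const.integrableOn_Icc
  have h2 := ((EuclideanSpace.volume_preserving_symm_measurableEquiv_toLp
    (Fin d)).symm).integrable_comp_emb (MeasurableEquiv.measurableEmbedding _)
    (g := fun z : Rd d => ∏ j, f j (z j))
  have h3 : Integrable (fun z : Rd d => ∏ j, f j (z j)) := by
    rw [← h2]; exact hf
  refine h3.mono' ?_ (Filter.Eventually.of_forall fun z => ?_)
  · refine Measurable.aestronglyMeasurable (Measurable.indicator ?_ measurableSet_ball)
    fun_prop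
  · by_cases hz : z ∈ Metric.ball (0 : Rd d) 1
    · rw [indicator_of_mem hz]
      have hz' : ‖z‖ < 1 := by simpa using hz
      have : ∀ j, z j ∈ Icc (-1 : ℝ) 1 := fun j =>
        abs_le.1 ((PiLp.norm_apply_le z j).trans hz'.le)
      rw [Real.norm_of_nonneg (by positivity)]
      have h4 : ∏ j, f j (z j) = ∏ j, if j = i then |z i| ^ (-β) else 1 := by
        refine Finset.prod_congr rfl fun j _ => ?_
        simp only [f, indicator_of_mem (this j)]
        split_ifs with h
        · rw [h]
        · rfl
      rw [h4]; simp
    · rw [indicator_of_notMem hz, norm_zero]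
      refine Finset.prod_nonneg fun j _ => indicator_nonneg (fun t _ => ?_) _
      split_ifs <;> positivity

/-- By Fubini in polar coordinates almost every sphere carries an integrable slice. Radii below 1
have positive measure, so some such radius is good, and homogeneity transfers the result to the unit
sphere. -/
lemma integrable_sphere_abs_coord_rpow [NeZero d] (i : Fin d) {β : ℝ} (hβ : β < 1) :
    Integrable (fun θ : Metric.sphere (0 : Rd d) 1 => |(θ : Rd d) i| ^ (-β))
      ((volume : Measure (Rd d)).toSphere) := by
  have h := (integrable_polar (integrable_abs_coord_rpow i hβ)).prod_left_ae
  have hpos : Measure.volumeIoiPow (d - 1) (Iio ⟨1, mem_Ioi.2 one_pos⟩) ≠ 0 := by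
    rw [Measure.volumeIoiPow_apply_Iio]
    simp only [one_pow, ne_eq, ENNReal.ofReal_eq_zero, not_le]
    positivity
  obtain ⟨ρ, hρ, hint⟩ := (Filter.Frequently.and_eventually
    (frequently_ae_mem_iff.2 hpos) h).exists
  have hρ1 : (ρ : ℝ) < 1 := hρ
  have hρ0 : (0 : ℝ) < ρ := ρ.2
  refine (hint.const_mul ((ρ : ℝ) ^ β)).congr (Filter.Eventually.of_forall fun θ => ?_)
  have hθ : ‖(θ : Rd d)‖ = 1 := by simp
  have hmem : (ρ : ℝ) • (θ : Rd d) ∈ Metric.ball (0 : Rd d) 1 := by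
    simp [norm_smul, abs_of_pos hρ0, hθ, hρ1]
  simp only [indicator_of_mem hmem, PiLp.smul_apply, smul_eq_mul, abs_mul, abs_of_pos hρ0]
  rw [Real.mul_rpow hρ0.le (abs_nonneg _), ← mul_assoc, ← Real.rpow_add hρ0]
  simp

end Singular

/-! ### The Fejér function -/

/-- The one-dimensional Fejér-type kernel `∫_0^1 (1 - ρ) cos(2πρy) dρ`. -/
noncomputable def fejer (y : ℝ) : ℝ := ∫ ρ in (0 : ℝ)..1, (1 - ρ) * Real.cos (2 * Real.pi * ρ * y)

/-- The closed form makes it visible that the cosine transform of a triangle is nonnegative and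
decays quadratically. -/
lemma fejer_eq {y : ℝ} (hy : y ≠ 0) :
    fejer y = (1 - Real.cos (2 * Real.pi * y)) / (2 * Real.pi * y) ^ 2 := by
  set c := 2 * Real.pi * y with hc
  have hc0 : c ≠ 0 := by positivity
  have hder : ∀ ρ ∈ uIcc (0 : ℝ) 1, HasDerivAt
      (fun ρ => (1 - ρ) * Real.sin (c * ρ) / c - Real.cos (c * ρ) / c ^ 2)
      ((1 - ρ) * Real.cos (2 * Real.pi * ρ * y)) ρ := by
    intro ρ _
    have h1 : HasDerivAt (fun ρ : ℝ => c * ρ) c ρ := by simpa using (hasDerivAt_id ρ).const_mul c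
    have h2 := ((((hasDerivAt_id ρ).const_sub 1).mul h1.sin).div_const c).sub
      (h1.cos.div_const (c ^ 2))
    refine h2.congr_deriv ?_
    rw [show 2 * Real.pi * ρ * y = c * ρ by rw [hc]; ring]
    simp only [id]
    field_simp
    ring
  rw [fejer, intervalIntegral.integral_eq_sub_of_hasDerivAt hder
    (Continuous.intervalIntegrable (by fun_prop) _ _)]
  simp
  field_simp
  ring

lemma fejer_zero : fejer 0 = 1 / 2 := by
  simp only [fejer, mul_zero, Real.cos_zero, mul_one]
  rw [intervalIntegral.integral_sub (by simp) (by simp), integral_id]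
  norm_num

lemma fejer_nonneg (y : ℝ) : 0 ≤ fejer y := by
  rcases eq_or_ne y 0 with rfl | hy
  · rw [fejer_zero]; norm_num
  · rw [fejer_eq hy]
    exact div_nonneg (by linarith [Real.cos_le_one (2 * Real.pi * y)]) (sq_nonneg _)

lemma fejer_le_one (y : ℝ) : fejer y ≤ 1 := by
  rcases eq_or_ne y 0 with rfl | hy
  · rw [fejer_zero]; norm_num
  · rw [fejer_eq hy, div_le_one (by positivity)]
    linarith [Real.one_sub_sq_div_two_le_cos (x := 2 * Real.pi * y),
      sq_nonneg (2 * Real.pi * y)]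

/-- Boundedness near 0 and decay of order 2 at infinity give every intermediate power. Small powers
are kept because only those are integrable over the sphere. -/
lemma fejer_le_rpow {β : ℝ} (hβ0 : 0 ≤ β) (hβ : β ≤ 2) {y : ℝ} (hy : y ≠ 0) :
    fejer y ≤ |y| ^ (-β) := by
  have hy' := abs_pos.2 hy
  rcases le_total |y| 1 with h | h
  · exact (fejer_le_one y).trans (Real.one_le_rpow_of_pos_of_le_one_of_nonpos hy' h (by linarith))
  · calc fejer y ≤ |y| ^ (-2 : ℝ) := by
          rw [fejer_eq hy, Real.rpow_neg hy'.le, div_le_iff₀ (by positivity)]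
          have : |y| ^ (2 : ℝ) = y ^ 2 := by rw [← sq_abs]; norm_cast
          rw [this, inv_mul_eq_div, le_div_iff₀ (by positivity)]
          have h1 : 1 - Real.cos (2 * Real.pi * y) ≤ 2 := by
            linarith [Real.neg_one_le_cos (2 * Real.pi * y)]
          have h2 := Real.pi_gt_three
          nlinarith [sq_nonneg y, mul_le_mul_of_nonneg_right h1 (sq_nonneg y),
            mul_le_mul_of_nonneg_right (show (2 : ℝ) ≤ (2 * Real.pi) ^ 2 by nlinarith)
              (sq_nonneg y)]
      _ ≤ |y| ^ (-β) := Real.rpow_le_rpow_of_exponent_le h (by linarith)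

/-! ### The cone kernel and its transform -/

/-- The building block `|z|^{1-d} (1 - |z|)_+` of radial kernels with convex profile. -/
noncomputable def coneKernel {d : ℕ} (z : Rd d) : ℝ := (‖z‖ ^ (d - 1))⁻¹ * max (1 - ‖z‖) 0

/-- The cosine transform of `coneKernel`. -/
noncomputable def coneSymbol {d : ℕ} (ξ : Rd d) : ℝ :=
  ∫ z, coneKernel z * Real.cos (2 * Real.pi * inner ℝ z ξ)

section Cone

variable {d : ℕ}

lemma coneKernel_nonneg (z : Rd d) : 0 ≤ coneKernel z := by unfold coneKernel; positivity

lemma coneKernel_eq_zero {z : Rd d} (hz : 1 ≤ ‖z‖) : coneKernel z = 0 := by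
  rw [coneKernel, max_eq_right (by linarith), mul_zero]

lemma measurable_coneKernel : Measurable (coneKernel (d := d)) := by
  unfold coneKernel; fun_prop

lemma integrable_coneKernel [NeZero d] : Integrable (coneKernel (d := d)) := by
  have := NeZero.pos d
  have : Nontrivial (Rd d) := by
    apply Module.nontrivial_of_finrank_pos (R := ℝ); simp [this]
  refine (integrable_fun_norm_addHaar (volume : Measure (Rd d))
    (f := fun r => (r ^ (d - 1))⁻¹ * max (1 - r) 0)).2 ?_
  have h : IntegrableOn (fun r : ℝ => max (1 - r) 0) (Ioi 0) := by
    have h1 : IntegrableOn (fun r : ℝ => max (1 - r) 0) (Ioc 0 1) :=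
      (Continuous.integrableOn_Icc (by fun_prop)).mono_set Ioc_subset_Icc_self
    have h2 : IntegrableOn (fun r : ℝ => max (1 - r) 0) (Ioi 1) :=
      integrableOn_zero.congr_fun (fun r hr => (max_eq_right (by linarith [mem_Ioi.1 hr])).symm)
        measurableSet_Ioi
    rw [← Ioc_union_Ioi_eq_Ioi zero_le_one]
    exact h1.union h2
  refine h.congr_fun (fun r hr => ?_) measurableSet_Ioi
  have : r ^ (d - 1) ≠ 0 := pow_ne_zero _ (ne_of_gt hr)
  simp [this]

lemma integral_coneKernel_pos [NeZero d] : 0 < ∫ z : Rd d, coneKernel z := by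
  rw [integral_pos_iff_support_of_nonneg coneKernel_nonneg integrable_coneKernel]
  have : (Metric.ball (0 : Rd d) 1 \ {0}) ⊆ Function.support (coneKernel (d := d)) := by
    rintro z ⟨hz, hz0⟩
    have hz1 : ‖z‖ < 1 := by simpa using hz
    have : 0 < ‖z‖ := norm_pos_iff.2 hz0
    have h2 : 0 < max (1 - ‖z‖) 0 := lt_max_of_lt_left (by linarith)
    exact (by unfold coneKernel; positivity : 0 < coneKernel z).ne'
  refine lt_of_lt_of_le ?_ (measure_mono this)
  have := NeZero.pos d
  have : Nontrivial (Rd d) := by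
    apply Module.nontrivial_of_finrank_pos (R := ℝ); simp [this]
  rw [measure_sdiff_null (measure_singleton _)]
  exact Metric.measure_ball_pos _ _ one_pos

lemma integrable_coneKernel_mul_cos [NeZero d] (ξ : Rd d) :
    Integrable (fun z : Rd d => coneKernel z * Real.cos (2 * Real.pi * inner ℝ z ξ)) := by
  refine integrable_coneKernel.mono'
    (measurable_coneKernel.mul (by fun_prop)).aestronglyMeasurable
    (Filter.Eventually.of_forall fun z => ?_)
  rw [norm_mul, Real.norm_of_nonneg (coneKernel_nonneg z)]
  exact mul_le_of_le_one_right (coneKernel_nonneg z) (Real.abs_cos_le_one _)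

/-- The Jacobian ρ^{d-1} cancels the factor |z|^{1-d}, leaving on each ray the cosine transform of
the triangle (1-ρ)_+. Positivity of the transform follows. -/
lemma coneSymbol_eq_integral_sphere [NeZero d] (ξ : Rd d) :
    coneSymbol ξ = ∫ θ : Metric.sphere (0 : Rd d) 1, fejer (inner ℝ (θ : Rd d) ξ)
      ∂((volume : Measure (Rd d)).toSphere) := by
  rw [coneSymbol, integral_eq_integral_sphere (integrable_coneKernel_mul_cos ξ)]
  congr 1 with θ
  have hθ : ‖(θ : Rd d)‖ = 1 := by simp
  rw [fejer, intervalIntegral.integral_of_le zero_le_one]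
  have e1 : ∀ ρ : ℝ, 0 < ρ → ρ ^ (d - 1) • (coneKernel (ρ • (θ : Rd d)) *
      Real.cos (2 * Real.pi * inner ℝ (ρ • (θ : Rd d)) ξ)) =
      max (1 - ρ) 0 * Real.cos (2 * Real.pi * ρ * inner ℝ (θ : Rd d) ξ) := by
    intro ρ hρ
    have : ρ ^ (d - 1) ≠ 0 := pow_ne_zero _ hρ.ne'
    rw [coneKernel, norm_smul, hθ, mul_one, Real.norm_of_nonneg hρ.le, real_inner_smul_left,
      smul_eq_mul, ← mul_assoc, ← mul_assoc, mul_inv_cancel₀ this, one_mul]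
    ring_nf
  rw [setIntegral_congr_fun measurableSet_Ioi (fun ρ hρ => e1 ρ hρ)]
  rw [setIntegral_eq_of_subset_of_forall_sdiff_eq_zero measurableSet_Ioi
    (s := Ioc (0 : ℝ) 1) (fun ρ hρ => hρ.1)]
  · refine setIntegral_congr_fun measurableSet_Ioc fun ρ hρ => ?_
    rw [max_eq_left (by linarith [hρ.2])]
  · rintro ρ ⟨h1, h2⟩
    have : 1 < ρ := by
      by_contra h; exact h2 ⟨h1, not_lt.1 h⟩
    rw [max_eq_right (by linarith), zero_mul]

lemma coneSymbol_nonneg [NeZero d] (ξ : Rd d) : 0 ≤ coneSymbol ξ := by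
  rw [coneSymbol_eq_integral_sphere]
  exact integral_nonneg fun θ => fejer_nonneg _

lemma coneSymbol_le [NeZero d] (ξ : Rd d) : coneSymbol ξ ≤ ∫ z : Rd d, coneKernel z :=
  integral_mono (integrable_coneKernel_mul_cos ξ) integrable_coneKernel fun z =>
    mul_le_of_le_one_right (coneKernel_nonneg z) (Real.cos_le_one _)

lemma continuous_coneSymbol [NeZero d] : Continuous (coneSymbol (d := d)) := by
  refine continuous_of_dominated (bound := coneKernel)
    (fun ξ => (integrable_coneKernel_mul_cos ξ).aestronglyMeasurable)
    (fun ξ => Filter.Eventually.of_forall fun z => ?_) integrable_coneKernel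
    (Filter.Eventually.of_forall fun z => by fun_prop)
  rw [norm_mul, Real.norm_of_nonneg (coneKernel_nonneg z)]
  exact mul_le_of_le_one_right (coneKernel_nonneg z) (Real.abs_cos_le_one _)

/-- The reflection exchanging ξ and η preserves Lebesgue measure, the inner product and the kernel.
-/
lemma coneSymbol_eq_of_norm_eq {ξ η : Rd d} (h : ‖ξ‖ = ‖η‖) : coneSymbol ξ = coneSymbol η := by
  set A := (ℝ ∙ (η - ξ))ᗮ.reflection
  have hA : A η = ξ := Submodule.reflection_sub h.symm
  rw [coneSymbol, coneSymbol, ← hA,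
    ← A.measurePreserving.integral_comp A.toMeasurableEquiv.measurableEmbedding]
  congr 1 with z
  change coneKernel (A z) * Real.cos (2 * Real.pi * inner ℝ (A z) (A η)) = _
  rw [A.inner_map_map, coneKernel, coneKernel, A.norm_map]

/-- On the support of the kernel the phase 2π⟨z,ξ⟩ is at most π/4 in modulus, so its cosine exceeds
1/2. -/
lemma half_integral_le_coneSymbol [NeZero d] {ξ : Rd d} (hξ : ‖ξ‖ ≤ 1 / 8) :
    (1 / 2) * ∫ z : Rd d, coneKernel z ≤ coneSymbol ξ := by
  rw [← integral_const_mul]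
  refine integral_mono (integrable_coneKernel.const_mul _) (integrable_coneKernel_mul_cos ξ)
    fun z => ?_
  simp only
  rcases le_total 1 ‖z‖ with hz | hz
  · simp [coneKernel_eq_zero hz]
  · rw [mul_comm]
    refine mul_le_mul_of_nonneg_left ?_ (coneKernel_nonneg z)
    have h1 : |inner ℝ z ξ| ≤ 1 / 8 := (abs_real_inner_le_norm z ξ).trans (by
      nlinarith [norm_nonneg z, norm_nonneg ξ])
    have h2 := Real.one_sub_sq_div_two_le_cos (x := 2 * Real.pi * inner ℝ z ξ)
    have h3 : (inner ℝ z ξ) ^ 2 ≤ 1 / 64 := by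
      rw [← sq_abs]; nlinarith [abs_nonneg (inner ℝ z ξ)]
    have h4 := Real.pi_lt_d2
    have h5 := Real.pi_pos
    have h6 : Real.pi ^ 2 ≤ 10 := by nlinarith
    have h7 : Real.pi ^ 2 * (inner ℝ z ξ) ^ 2 ≤ 10 * (1 / 64) :=
      mul_le_mul h6 h3 (sq_nonneg _) (by norm_num)
    nlinarith

/-- The cone over this equator lies in a hyperplane, which is Lebesgue null. -/
lemma toSphere_coord_eq_zero (i : Fin d) :
    ((volume : Measure (Rd d)).toSphere) {θ : Metric.sphere (0 : Rd d) 1 | (θ : Rd d) i = 0} = 0 := by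
  have hm : MeasurableSet {θ : Metric.sphere (0 : Rd d) 1 | (θ : Rd d) i = 0} :=
    measurableSet_eq_fun (by fun_prop) measurable_const
  rw [Measure.toSphere_apply' _ hm]
  refine mul_eq_zero_of_right _ (measure_mono_null (t := ((EuclideanSpace.proj i :
    Rd d →L[ℝ] ℝ) : Rd d →ₗ[ℝ] ℝ).ker) ?_ (Measure.addHaar_submodule _ _ ?_))
  · rintro _ ⟨r, -, _, ⟨θ, hθ, rfl⟩, rfl⟩
    have : (θ : Rd d) i = 0 := hθ
    simp [this]
  · intro h
    have : (EuclideanSpace.single i (1 : ℝ) : Rd d) ∈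
        ((EuclideanSpace.proj i : Rd d →L[ℝ] ℝ) : Rd d →ₗ[ℝ] ℝ).ker := by
      rw [h]; trivial
    simp at this

/-- The Fejér bound is averaged over the sphere; β < 1 is exactly what makes |θ_i|^{-β} integrable
there. -/
lemma exists_coneSymbol_le_rpow [NeZero d] (i : Fin d) {β : ℝ} (hβ0 : 0 ≤ β) (hβ : β < 1) :
    ∃ C, 0 ≤ C ∧ ∀ p : ℝ, 0 < p →
      coneSymbol (p • EuclideanSpace.single i (1 : ℝ) : Rd d) ≤ C * p ^ (-β) := by
  refine ⟨∫ θ : Metric.sphere (0 : Rd d) 1, |(θ : Rd d) i| ^ (-β)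
    ∂((volume : Measure (Rd d)).toSphere),
    integral_nonneg fun θ => by positivity, fun p hp => ?_⟩
  rw [coneSymbol_eq_integral_sphere, ← integral_mul_const]
  refine integral_mono_of_nonneg (Filter.Eventually.of_forall fun θ => fejer_nonneg _)
    ((integrable_sphere_abs_coord_rpow i hβ).mul_const _) ?_
  have h0 : ∀ᵐ θ : Metric.sphere (0 : Rd d) 1 ∂((volume : Measure (Rd d)).toSphere), (θ : Rd d) i ≠ 0 :=
    by
    have := toSphere_coord_eq_zero i
    rwa [measure_eq_zero_iff_ae_notMem] at this
  filter_upwards [h0] with θ hθ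
  have e : inner ℝ (θ : Rd d) (p • EuclideanSpace.single i (1 : ℝ)) = (θ : Rd d) i * p := by
    rw [real_inner_smul_right, EuclideanSpace.inner_single_right]; simp [mul_comm]
  rw [e]
  refine (fejer_le_rpow hβ0 (by linarith) (mul_ne_zero hθ hp.ne')).trans_eq ?_
  rw [abs_mul, abs_of_pos hp, Real.mul_rpow (abs_nonneg _) hp.le]

/-- The radial profile of `coneSymbol` in the logarithmic variable. -/
noncomputable def coneLog (i : Fin d) (u : ℝ) : ℝ :=
  coneSymbol (Real.exp u • EuclideanSpace.single i (1 : ℝ) : Rd d)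

lemma coneLog_log_norm (i : Fin d) {ξ : Rd d} (hξ : ξ ≠ 0) (u : ℝ) :
    coneLog i (u + Real.log ‖ξ‖) = coneSymbol (Real.exp u • ξ) := by
  refine coneSymbol_eq_of_norm_eq ?_
  rw [norm_smul, norm_smul, PiLp.norm_single, Real.norm_of_nonneg (Real.exp_pos _).le,
    Real.norm_of_nonneg (Real.exp_pos _).le, Real.exp_add, Real.exp_log (norm_pos_iff.2 hξ)]
  simp

lemma isLogKernel_coneLog [NeZero d] (i : Fin d) : IsLogKernel (coneLog i) where
  measurable := by
    unfold coneLog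
    exact (continuous_coneSymbol.comp (by fun_prop)).measurable
  nonneg u := coneSymbol_nonneg _
  bounded := ⟨_, fun u => coneSymbol_le _⟩
  integrable_exp θ h0 h1 := by
    -- Any β strictly between θ and 1 works: the decay e^{-βu} of the symbol beats e^{θu} at +∞, and
    -- e^{θu} itself decays at -∞.
    set β := (1 + θ) / 2
    obtain ⟨C, hC0, hC⟩ := exists_coneSymbol_le_rpow (d := d) i (β := β)
      (by simp only [β]; linarith) (by simp only [β]; linarith)
    set D := max C (∫ z : Rd d, coneKernel z)
    have hθβ : θ - β < 0 := by simp only [β]; linarith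
    refine ((integrable_twoExp h0 hθβ).const_mul D).mono' ?_
      (Filter.Eventually.of_forall fun u => ?_)
    · refine Measurable.aestronglyMeasurable (Measurable.mul (by fun_prop) ?_)
      unfold coneLog
      exact (continuous_coneSymbol.comp (by fun_prop)).measurable
    · rw [norm_mul, Real.norm_of_nonneg (Real.exp_pos _).le,
        Real.norm_of_nonneg (show 0 ≤ coneLog i u from coneSymbol_nonneg _)]
      rcases le_total u 0 with hu | hu
      · rw [twoExp_of_nonpos hu, mul_comm]
        exact mul_le_mul_of_nonneg_right ((coneSymbol_le _).trans (le_max_right _ _))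
          (Real.exp_pos _).le
      · rw [twoExp_of_nonneg hu]
        have h2 : coneLog i u ≤ D * Real.exp (-β * u) := by
          refine (hC _ (Real.exp_pos u)).trans ?_
          rw [← Real.exp_mul, mul_comm u]
          exact mul_le_mul_of_nonneg_right (le_max_left _ _) (Real.exp_pos _).le
        calc _ ≤ Real.exp (θ * u) * (D * Real.exp (-β * u)) :=
              mul_le_mul_of_nonneg_left h2 (Real.exp_pos _).le
          _ = D * Real.exp ((θ - β) * u) := by
              rw [mul_left_comm, ← Real.exp_add]; ring_nf
  lower := by
    refine ⟨(1 / 2) * ∫ z : Rd d, coneKernel z, by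
      have := integral_coneKernel_pos (d := d); positivity, Real.log (1 / 8), fun u hu => ?_⟩
    refine half_integral_le_coneSymbol ?_
    rw [norm_smul, PiLp.norm_single, Real.norm_of_nonneg (Real.exp_pos _).le]
    simpa using (Real.le_log_iff_exp_le (by norm_num)).1 hu

end Cone
open scoped FourierTransform

/-! ### Smooth cutoffs -/

section Bumps

variable {d : ℕ}

/-- A smooth cutoff equal to `1` on the unit ball and supported in the ball of radius `2`. -/
noncomputable def unitBump (d : ℕ) : ContDiffBump (0 : Rd d) := ⟨1, 2, one_pos, one_lt_two⟩

lemma unitBump_eq_one {x : Rd d} (hx : ‖x‖ ≤ 1) : unitBump d x = 1 :=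
  (unitBump d).one_of_mem_closedBall (by simpa [unitBump] using hx)

lemma unitBump_eq_zero {x : Rd d} (hx : 2 ≤ ‖x‖) : unitBump d x = 0 :=
  (unitBump d).zero_of_le_dist (by simpa [unitBump] using hx)

/-- The Littlewood–Paley cutoff, supported in `1/2 ≤ |x| ≤ 2`. -/
noncomputable def dyadicCut (x : Rd d) : ℝ := unitBump d x - unitBump d ((2 : ℝ) • x)

lemma dyadicCut_eq_zero_of_le {x : Rd d} (hx : ‖x‖ ≤ 1 / 2) : dyadicCut x = 0 := by
  rw [dyadicCut, unitBump_eq_one (by linarith), unitBump_eq_one, sub_self]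
  rw [norm_smul]; norm_num; linarith

lemma dyadicCut_eq_zero_of_ge {x : Rd d} (hx : 2 ≤ ‖x‖) : dyadicCut x = 0 := by
  rw [dyadicCut, unitBump_eq_zero hx, unitBump_eq_zero, sub_self]
  rw [norm_smul]; norm_num; linarith

lemma contDiff_dyadicCut : ContDiff ℝ ∞ (dyadicCut (d := d)) :=
  (unitBump d).contDiff.sub ((unitBump d).contDiff.comp (contDiff_const_smul 2))

lemma contDiff_of_eventuallyEq_zero {F : Type*} [NormedAddCommGroup F] [NormedSpace ℝ F]
    {f : Rd d → F} {ε : ℝ} (hε : 0 < ε) (h0 : ∀ x, ‖x‖ < ε → f x = 0)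
    (h : ∀ x, x ≠ 0 → ContDiffAt ℝ ∞ f x) : ContDiff ℝ ∞ f := by
  rw [contDiff_iff_contDiffAt]
  intro x
  rcases eq_or_ne x 0 with rfl | hx
  · refine (contDiffAt_const (c := (0 : F))).congr_of_eventuallyEq ?_
    filter_upwards [Metric.ball_mem_nhds (0 : Rd d) hε] with y hy
    exact h0 y (by simpa using hy)
  · exact h x hx

/-- A smooth compactly supported function equal to `log |x|` for `1/4 ≤ |x| ≤ 2`. -/
noncomputable def cutLog (x : Rd d) : ℝ :=
  (1 - unitBump d ((8 : ℝ) • x)) * unitBump d ((1 / 2 : ℝ) • x) * Real.log ‖x‖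

lemma cutLog_eq {x : Rd d} (h1 : 1 / 4 ≤ ‖x‖) (h2 : ‖x‖ ≤ 2) : cutLog x = Real.log ‖x‖ := by
  rw [cutLog, unitBump_eq_zero, unitBump_eq_one, sub_zero, one_mul, one_mul]
  · rw [norm_smul]; norm_num; linarith
  · rw [norm_smul]; norm_num; linarith

lemma contDiff_cutLog : ContDiff ℝ ∞ (cutLog (d := d)) := by
  refine contDiff_of_eventuallyEq_zero (ε := 1 / 8) (by norm_num) (fun x hx => ?_) fun x hx => ?_
  · rw [cutLog, unitBump_eq_one, sub_self, zero_mul, zero_mul]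
    rw [norm_smul]; norm_num; linarith
  · refine ContDiffAt.mul (ContDiff.contDiffAt ?_) ((contDiffAt_norm ℝ hx).log (by simpa using hx))
    exact (contDiff_const.sub ((unitBump d).contDiff.comp (contDiff_const_smul _))).mul
      ((unitBump d).contDiff.comp (contDiff_const_smul _))

lemma hasCompactSupport_of_eq_zero {F : Type*} [Zero F] {f : Rd d → F} {r : ℝ}
    (h : ∀ x, r ≤ ‖x‖ → f x = 0) : HasCompactSupport f := by
  refine HasCompactSupport.intro (isCompact_closedBall (0 : Rd d) r) fun x hx => h x ?_
  simp at hx; exact hx.le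

lemma hasCompactSupport_cutLog : HasCompactSupport (cutLog (d := d)) := by
  refine hasCompactSupport_of_eq_zero (r := 4) fun x hx => ?_
  rw [cutLog, unitBump_eq_zero (x := (1 / 2 : ℝ) • x), mul_zero, zero_mul]
  rw [norm_smul]; norm_num; linarith

/-- The function `dyadicCut x / (4π²|x|²)`. -/
noncomputable def dyadicBase (x : Rd d) : ℝ := dyadicCut x * (4 * Real.pi ^ 2 * ‖x‖ ^ 2)⁻¹

lemma contDiff_dyadicBase : ContDiff ℝ ∞ (dyadicBase (d := d)) := by
  refine contDiff_of_eventuallyEq_zero (ε := 1 / 2) (by norm_num) (fun x hx => ?_) fun x hx => ?_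
  · rw [dyadicBase, dyadicCut_eq_zero_of_le hx.le, zero_mul]
  · refine contDiff_dyadicCut.contDiffAt.mul (ContDiffAt.inv ?_ ?_)
    · exact (contDiff_const.mul (contDiff_norm_sq ℝ)).contDiffAt
    · have := norm_pos_iff.2 hx
      positivity

lemma dyadicBase_eq_zero_of_ge {x : Rd d} (hx : 2 ≤ ‖x‖) : dyadicBase x = 0 := by
  rw [dyadicBase, dyadicCut_eq_zero_of_ge hx, zero_mul]

lemma hasCompactSupport_dyadicBase : HasCompactSupport (dyadicBase (d := d)) :=
  hasCompactSupport_of_eq_zero fun _ hx => dyadicBase_eq_zero_of_ge hx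

lemma exists_iteratedFDeriv_le {E : Type*} [NormedAddCommGroup E] [NormedSpace ℝ E]
    {F : Type*} [NormedAddCommGroup F] [NormedSpace ℝ F] {f : E → F}
    (hf : ContDiff ℝ ∞ f) (hs : HasCompactSupport f) (n : ℕ) :
    ∃ C, 0 ≤ C ∧ ∀ x, ‖iteratedFDeriv ℝ n f x‖ ≤ C := by
  obtain ⟨C, hC⟩ := (hs.iteratedFDeriv n).exists_bound_of_continuous
    (hf.continuous_iteratedFDeriv (m := n) (by exact_mod_cast le_top))
  exact ⟨C, (norm_nonneg _).trans (hC 0), hC⟩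

end Bumps

/-! ### Rescaled dyadic pieces of the multiplier -/

/-- The hypotheses on the reciprocal symbol `Q`, with weight `twoExp p q (-·)`. -/
structure IsReciprocalSymbol (p q : ℝ) (Q : ℝ → ℝ) : Prop where
  contDiff : ContDiff ℝ ∞ Q
  bound : ∀ n : ℕ, ∃ C, ∀ v, |iteratedDeriv n Q v| ≤ C * (twoExp p q (-v))⁻¹

/-- The rescaled dyadic piece of the multiplier `Q(log|ξ|) / (4π²|ξ|²)`. -/
noncomputable def dyadicSymbol {d : ℕ} (p q : ℝ) (Q : ℝ → ℝ) (ℓ : ℝ) (x : Rd d) : ℝ :=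
  dyadicBase x * (twoExp p q ℓ * Q (cutLog x - ℓ))

section Dyadic

variable {d : ℕ} {p q : ℝ} {Q : ℝ → ℝ}

lemma contDiff_dyadicSymbol (hQ : IsReciprocalSymbol p q Q) (ℓ : ℝ) :
    ContDiff ℝ ∞ (dyadicSymbol (d := d) p q Q ℓ) :=
  contDiff_dyadicBase.mul (contDiff_const.mul
    (hQ.contDiff.comp (contDiff_cutLog.sub contDiff_const)))

lemma dyadicSymbol_eq_zero_of_ge (ℓ : ℝ) {x : Rd d} (hx : 2 ≤ ‖x‖) :
    dyadicSymbol p q Q ℓ x = 0 := by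
  rw [dyadicSymbol, dyadicBase_eq_zero_of_ge hx, zero_mul]

/-- The derivatives of Q at v - ℓ have size at most 1/`twoExp p q (ℓ - v)`. As v is bounded this is
comparable to 1/`twoExp p q ℓ`, which the normalizing factor removes: the bound is uniform in ℓ. -/
lemma IsReciprocalSymbol.shift_bound (hQ : IsReciprocalSymbol p q Q) (hp : |p| ≤ 1) (hq : |q| ≤ 1)
    (B : ℝ) (n : ℕ) : ∃ C, 0 ≤ C ∧ ∀ ℓ v, |v| ≤ B →
      ‖iteratedFDeriv ℝ n (fun v => twoExp p q ℓ * Q (v - ℓ)) v‖ ≤ C := by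
  obtain ⟨C, hC⟩ := hQ.bound n
  have hC0 : 0 ≤ C := by
    have := (abs_nonneg _).trans (hC 0)
    exact nonneg_of_mul_nonneg_left this (inv_pos.2 (twoExp_pos _ _ _))
  refine ⟨C * Real.exp B, by positivity, fun ℓ v hv => ?_⟩
  rw [norm_iteratedFDeriv_eq_norm_iteratedDeriv]
  have e : iteratedDeriv n (fun v => twoExp p q ℓ * Q (v - ℓ)) v =
      twoExp p q ℓ * iteratedDeriv n Q (v - ℓ) := by
    rw [iteratedDeriv_const_mul_field, iteratedDeriv_comp_sub_const]
  rw [e, norm_mul, Real.norm_of_nonneg (twoExp_pos _ _ _).le, Real.norm_eq_abs]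
  have h1 := hC (v - ℓ)
  have h2 : twoExp p q ℓ ≤ Real.exp (1 * |ℓ - -(v - ℓ)|) * twoExp p q (-(v - ℓ)) :=
    twoExp_le_exp_mul hp hq
  have e2 : |ℓ - -(v - ℓ)| = |v| := by ring_nf
  rw [e2, one_mul] at h2
  have hT := twoExp_pos p q (-(v - ℓ))
  calc twoExp p q ℓ * |iteratedDeriv n Q (v - ℓ)|
      ≤ (Real.exp |v| * twoExp p q (-(v - ℓ))) * (C * (twoExp p q (-(v - ℓ)))⁻¹) :=
        mul_le_mul h2 h1 (abs_nonneg _) (by positivity)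
    _ = C * Real.exp |v| := by field_simp
    _ ≤ C * Real.exp B := mul_le_mul_of_nonneg_left (Real.exp_le_exp.2 hv) hC0

/-- The only ℓ-dependence sits in a one-variable factor with uniformly bounded derivatives on the
range of `cutLog`; it is composed and multiplied with fixed compactly supported functions. -/
lemma exists_iteratedFDeriv_dyadicSymbol_le (hQ : IsReciprocalSymbol p q Q) (hp : |p| ≤ 1)
    (hq : |q| ≤ 1) (n : ℕ) :
    ∃ C, 0 ≤ C ∧ ∀ ℓ (x : Rd d), ‖iteratedFDeriv ℝ n (dyadicSymbol p q Q ℓ) x‖ ≤ C := by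
  choose A hA0 hA using fun n => exists_iteratedFDeriv_le (contDiff_dyadicBase (d := d))
    hasCompactSupport_dyadicBase n
  choose D hD0 hD using fun n => exists_iteratedFDeriv_le (contDiff_cutLog (d := d))
    hasCompactSupport_cutLog n
  have hB : ∀ x : Rd d, |cutLog x| ≤ D 0 := fun x => by simpa using hD 0 x
  choose S hS0 hS using fun n => hQ.shift_bound hp hq (D 0) n
  have hcomp : ∀ m : ℕ, ∃ C, 0 ≤ C ∧ ∀ ℓ (x : Rd d),
      ‖iteratedFDeriv ℝ m (fun x => twoExp p q ℓ * Q (cutLog x - ℓ)) x‖ ≤ C := by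
    intro m
    set C := ∑ i ∈ Finset.range (m + 1), S i
    set D' := 1 + ∑ i ∈ Finset.range (m + 1), D i
    have hC0 : 0 ≤ C := Finset.sum_nonneg fun i _ => hS0 i
    have hD1 : 1 ≤ D' := by
      simp only [D']; linarith [Finset.sum_nonneg (s := Finset.range (m + 1)) fun i _ => hD0 i]
    refine ⟨m.factorial * C * D' ^ m, by positivity, fun ℓ x => ?_⟩
    refine norm_iteratedFDeriv_comp_le (N := ∞) (g := fun v => twoExp p q ℓ * Q (v - ℓ))
      (f := cutLog)
      (contDiff_const.mul (hQ.contDiff.comp (contDiff_id.sub contDiff_const))) contDiff_cutLog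
      (by exact_mod_cast le_top) x (fun i hi => ?_) fun i hi1 hi => ?_
    · exact (hS i ℓ _ (hB x)).trans (Finset.single_le_sum (f := S) (fun i _ => hS0 i)
        (Finset.mem_range.2 (by omega)))
    · refine (hD i x).trans (le_trans ?_ (le_self_pow₀ hD1 (by omega)))
      have := Finset.single_le_sum (f := D) (s := Finset.range (m + 1)) (fun i _ => hD0 i)
        (Finset.mem_range.2 (by omega : i < m + 1))
      simp only [D']; linarith
  choose T hT0 hT using hcomp
  refine ⟨∑ i ∈ Finset.range (n + 1), (n.choose i : ℝ) * A i * T (n - i),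
    Finset.sum_nonneg fun i _ => mul_nonneg (mul_nonneg (by positivity) (hA0 i)) (hT0 _),
    fun ℓ x => ?_⟩
  refine (norm_iteratedFDeriv_mul_le (N := ∞) contDiff_dyadicBase (contDiff_const.mul
    (hQ.contDiff.comp (contDiff_cutLog.sub contDiff_const))) x (by exact_mod_cast le_top)).trans ?_
  refine Finset.sum_le_sum fun i _ => ?_
  exact mul_le_mul (mul_le_mul_of_nonneg_left (hA i x) (by positivity)) (hT _ ℓ x)
    (norm_nonneg _) (mul_nonneg (by positivity) (hA0 i))

/-- `dyadicSymbol` as a complex Schwartz function. -/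
noncomputable def dyadicSchwartz (hQ : IsReciprocalSymbol p q Q) (ℓ : ℝ) : SchwartzMap (Rd d) ℂ :=
  HasCompactSupport.toSchwartzMap (f := fun x : Rd d => (dyadicSymbol p q Q ℓ x : ℂ))
    (hasCompactSupport_of_eq_zero fun x hx => by rw [dyadicSymbol_eq_zero_of_ge ℓ hx]; simp)
    (Complex.ofRealCLM.contDiff.comp (contDiff_dyadicSymbol hQ ℓ))

lemma dyadicSchwartz_apply (hQ : IsReciprocalSymbol p q Q) (ℓ : ℝ) (x : Rd d) :
    dyadicSchwartz hQ ℓ x = (dyadicSymbol p q Q ℓ x : ℂ) := rfl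

lemma norm_iteratedFDeriv_dyadicSchwartz (hQ : IsReciprocalSymbol p q Q) (ℓ : ℝ) (n : ℕ)
    (x : Rd d) : ‖iteratedFDeriv ℝ n (dyadicSchwartz hQ ℓ) x‖ =
      ‖iteratedFDeriv ℝ n (dyadicSymbol p q Q ℓ) x‖ :=
  Complex.ofRealLI.norm_iteratedFDeriv_comp_left (n := ∞)
    (contDiff_dyadicSymbol hQ ℓ).contDiffAt (by exact_mod_cast le_top)

/-- The symbols live in one ball with derivatives bounded uniformly in ℓ, so every Schwartz seminorm
of their transforms is bounded uniformly in ℓ. -/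
lemma exists_fourier_dyadicSchwartz_le (hQ : IsReciprocalSymbol p q Q) (hp : |p| ≤ 1)
    (hq : |q| ≤ 1) (k n : ℕ) : ∃ C, 0 ≤ C ∧ ∀ ℓ (x : Rd d),
      ‖x‖ ^ n * ‖iteratedFDeriv ℝ k (𝓕 ⇑(dyadicSchwartz (d := d) hQ ℓ)) x‖ ≤ C := by
  choose A hA0 hA using fun n =>
    exists_iteratedFDeriv_dyadicSymbol_le (d := d) hQ hp hq n
  set I := volume.real (Metric.closedBall (0 : Rd d) 2)
  refine ⟨(2 * Real.pi) ^ k * (2 * k + 2) ^ n *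
    ∑ a ∈ Finset.range (k + 1) ×ˢ Finset.range (n + 1), (2 ^ a.1 * A a.2) * I, ?_, fun ℓ x => ?_⟩
  · refine mul_nonneg (by positivity) (Finset.sum_nonneg fun a _ => ?_)
    have := hA0 a.2
    positivity
  · have h := Real.pow_mul_norm_iteratedFDeriv_fourier_le (K := ⊤) (N := ⊤) (k := k) (n := n)
      ((dyadicSchwartz (d := d) hQ ℓ).smooth ⊤)
      (fun k n _ _ => (dyadicSchwartz (d := d) hQ ℓ).integrable_pow_mul_iteratedFDeriv volume k n)
      le_top le_top x
    refine h.trans (mul_le_mul_of_nonneg_left (Finset.sum_le_sum fun a _ => ?_) (by positivity))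
    have hz : ∀ v : Rd d, v ∉ Metric.closedBall (0 : Rd d) 2 →
        ‖v‖ ^ a.1 * ‖iteratedFDeriv ℝ a.2 (dyadicSchwartz (d := d) hQ ℓ) v‖ = 0 := by
      intro v hv
      have : v ∉ Function.support (iteratedFDeriv ℝ a.2 (dyadicSchwartz (d := d) hQ ℓ)) := by
        intro h
        refine hv (closure_minimal ?_ Metric.isClosed_closedBall
          (support_iteratedFDeriv_subset a.2 h))
        intro y hy
        by_contra hy'
        refine hy ?_
        rw [dyadicSchwartz_apply, dyadicSymbol_eq_zero_of_ge]
        · simp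
        · simp at hy'; exact hy'.le
      rw [Function.notMem_support.1 this, norm_zero, mul_zero]
    rw [← setIntegral_eq_integral_of_forall_compl_eq_zero hz]
    refine (setIntegral_mono_on ?_ (integrableOn_const (C := 2 ^ a.1 * A a.2)
      measure_closedBall_lt_top.ne) measurableSet_closedBall fun v hv => ?_).trans_eq ?_
    · exact ((dyadicSchwartz (d := d) hQ ℓ).integrable_pow_mul_iteratedFDeriv volume
        a.1 a.2).integrableOn
    · rw [norm_iteratedFDeriv_dyadicSchwartz]
      refine mul_le_mul (pow_le_pow_left₀ (norm_nonneg _) (by simpa using hv) _) (hA _ _ _)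
        (norm_nonneg _) (by positivity)
    · rw [setIntegral_const, smul_eq_mul, mul_comm]

end Dyadic

/-! ### Summation of dyadic families -/

/-- The profile `min (2^j/ρ) (ρ/2^j)`, which localizes to `2^j ∼ ρ`. -/
noncomputable def dyadicProfile (j : ℤ) (ρ : ℝ) : ℝ := min ((2 : ℝ) ^ j / ρ) (ρ / (2 : ℝ) ^ j)

lemma dyadicProfile_nonneg (j : ℤ) {ρ : ℝ} (hρ : 0 < ρ) : 0 ≤ dyadicProfile j ρ := by
  unfold dyadicProfile; positivity

lemma summable_half_pow_natAbs : Summable fun i : ℤ => (1 / 2 : ℝ) ^ i.natAbs := by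
  rw [summable_int_iff_summable_nat_and_neg]
  constructor <;> simpa using summable_geometric_two

lemma dyadicProfile_le {j n : ℤ} {ρ : ℝ} (hn : ρ ∈ Ico ((2 : ℝ) ^ n) ((2 : ℝ) ^ (n + 1))) :
    dyadicProfile j ρ ≤ 2 * (1 / 2 : ℝ) ^ (j - n).natAbs := by
  have h2 : (0 : ℝ) < 2 ^ n := by positivity
  have hρ : 0 < ρ := h2.trans_le hn.1
  rcases le_total n j with h | h
  · obtain ⟨m, rfl⟩ := Int.le.dest h
    refine (min_le_right _ _).trans ?_
    rw [add_sub_cancel_left, Int.natAbs_natCast, div_le_iff₀ (by positivity)]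
    refine hn.2.le.trans_eq ?_
    rw [zpow_add₀ two_ne_zero, zpow_add₀ two_ne_zero, zpow_natCast, one_div, inv_pow]
    field_simp
  · obtain ⟨m, rfl⟩ := Int.le.dest h
    refine (min_le_left _ _).trans ?_
    rw [show j - (j + m) = -(m : ℤ) by ring, Int.natAbs_neg, Int.natAbs_natCast,
      div_le_iff₀ hρ]
    have : (2 : ℝ) ^ j = (1 / 2) ^ m * 2 ^ (j + (m : ℤ)) := by
      rw [zpow_add₀ two_ne_zero, zpow_natCast, one_div, inv_pow]
      field_simp
    rw [this, mul_assoc]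
    have h3 : (0 : ℝ) < (1 / 2) ^ m := by positivity
    nlinarith [mul_le_mul_of_nonneg_left hn.1 h3.le, mul_pos h3 hρ]

/-- If 2^n ≤ ρ < 2^{n+1}, the profile decays geometrically in |j - n|; translating the index by n
gives a sum independent of ρ. -/
lemma exists_tsum_dyadicProfile_le : ∃ T, ∀ ρ : ℝ, 0 < ρ →
    Summable (fun j => dyadicProfile j ρ) ∧ ∑' j, dyadicProfile j ρ ≤ T := by
  refine ⟨∑' i : ℤ, 2 * (1 / 2 : ℝ) ^ i.natAbs, fun ρ hρ => ?_⟩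
  obtain ⟨n, hn⟩ := exists_mem_Ico_zpow hρ one_lt_two
  have hs : Summable fun j : ℤ => 2 * (1 / 2 : ℝ) ^ (j - n).natAbs :=
    ((Equiv.subRight n).summable_iff
      (f := fun i : ℤ => 2 * (1 / 2 : ℝ) ^ i.natAbs)).2 (summable_half_pow_natAbs.mul_left 2)
  have hsum := Summable.of_nonneg_of_le (fun j => dyadicProfile_nonneg j hρ)
    (fun j => dyadicProfile_le hn) hs
  refine ⟨hsum, (hsum.tsum_le_tsum (fun j => dyadicProfile_le hn) hs).trans_eq ?_⟩
  exact (Equiv.subRight n).tsum_eq (fun i : ℤ => 2 * (1 / 2 : ℝ) ^ i.natAbs)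

lemma dyadicProfile_le_two_mul (j : ℤ) {ρ σ : ℝ} (hρ : 0 < ρ) (h1 : ρ / 2 ≤ σ) (h2 : σ ≤ 2 * ρ) :
    dyadicProfile j σ ≤ 2 * dyadicProfile j ρ := by
  have hj : (0 : ℝ) < 2 ^ j := by positivity
  have hσ : 0 < σ := by linarith
  rw [dyadicProfile, dyadicProfile, mul_min_of_nonneg _ _ zero_le_two]
  refine min_le_min ?_ ?_
  · rw [mul_div_assoc', div_le_div_iff₀ hσ hρ]; nlinarith
  · rw [mul_div_assoc', div_le_div_iff_of_pos_right hj]; exact h2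

/-- A function on `(0,∞)` bounded near every point. -/
def LocallyBddAbove (U : ℝ → ℝ) : Prop :=
  ∀ ρ > 0, ∃ M, ∀ σ, ρ / 2 ≤ σ → σ ≤ 2 * ρ → U σ ≤ M

/-- Smooth functions `f j` whose derivatives of order `k` at `x` are bounded by
`U(|x|) |x|^{-k} dyadicProfile j |x|`. -/
def IsDyadicFamily {d : ℕ} {E : Type*} [NormedAddCommGroup E] [NormedSpace ℝ E] (U : ℝ → ℝ)
    (f : ℤ → Rd d → E) : Prop :=
  (∀ j, ContDiff ℝ ∞ (f j)) ∧ ∀ k : ℕ, ∃ C, 0 ≤ C ∧ ∀ j x, x ≠ 0 →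
    ‖iteratedFDeriv ℝ k (f j) x‖ ≤ C * (U ‖x‖ * ‖x‖⁻¹ ^ k * dyadicProfile j ‖x‖)

section Series

variable {d : ℕ} {U : ℝ → ℝ}

lemma LocallyBddAbove.mul_inv (hU : LocallyBddAbove U) (hU0 : ∀ ρ > 0, 0 ≤ U ρ) :
    LocallyBddAbove fun ρ => U ρ * ρ⁻¹ := by
  intro ρ hρ
  obtain ⟨M, hM⟩ := hU ρ hρ
  refine ⟨M * (ρ / 2)⁻¹, fun σ h1 h2 => ?_⟩
  have hσ : 0 < σ := by linarith
  exact mul_le_mul (hM σ h1 h2) (inv_anti₀ (by positivity) h1) (by positivity)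
    ((hU0 σ hσ).trans (hM σ h1 h2))

/-- The class is stable under differentiation, at the cost of a factor 1/ρ in U. This drives the
induction on the order of smoothness. -/
lemma IsDyadicFamily.fderiv {E : Type*} [NormedAddCommGroup E] [NormedSpace ℝ E]
    {f : ℤ → Rd d → E} (hf : IsDyadicFamily U f) :
    IsDyadicFamily (fun ρ => U ρ * ρ⁻¹) fun j => fderiv ℝ (f j) := by
  refine ⟨fun j => (contDiff_infty_iff_fderiv.1 (hf.1 j)).2, fun k => ?_⟩
  obtain ⟨C, hC0, hC⟩ := hf.2 (k + 1)
  refine ⟨C, hC0, fun j x hx => ?_⟩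
  rw [norm_iteratedFDeriv_fderiv]
  refine (hC j x hx).trans_eq ?_
  rw [pow_succ]; ring

lemma IsDyadicFamily.summable_norm {E : Type*} [NormedAddCommGroup E] [NormedSpace ℝ E]
    {f : ℤ → Rd d → E} (hf : IsDyadicFamily U f) :
    ∃ C, 0 ≤ C ∧ ∀ x, x ≠ 0 → Summable (fun j => ‖f j x‖) ∧ ∑' j, ‖f j x‖ ≤ C * U ‖x‖ := by
  obtain ⟨C, hC0, hC⟩ := hf.2 0
  obtain ⟨T, hT⟩ := exists_tsum_dyadicProfile_le
  have hT0 : 0 ≤ T := (tsum_nonneg fun j => dyadicProfile_nonneg j one_pos).trans (hT 1 one_pos).2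
  refine ⟨C * T, by positivity, fun x hx => ?_⟩
  have hx' := norm_pos_iff.2 hx
  have hle : ∀ j, ‖f j x‖ ≤ C * U ‖x‖ * dyadicProfile j ‖x‖ := fun j => by
    simpa [mul_assoc] using hC j x hx
  have hs := Summable.of_nonneg_of_le (fun j => norm_nonneg _) hle
    ((hT _ hx').1.mul_left (C * U ‖x‖))
  refine ⟨hs, (hs.tsum_le_tsum hle ((hT _ hx').1.mul_left _)).trans ?_⟩
  rw [tsum_mul_left]
  have hCU : 0 ≤ C * U ‖x‖ := by
    refine nonneg_of_mul_nonneg_left ((norm_nonneg _).trans (hle 0)) ?_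
    unfold dyadicProfile; positivity
  nlinarith [mul_le_mul_of_nonneg_left (hT _ hx').2 hCU]

/-- On the ball of radius |x|/2 about x all norms are comparable to |x|, so the profiles at x, up to
a factor 2, give a summable majorant of the derivatives. -/
lemma IsDyadicFamily.hasFDerivAt_tsum {E : Type*} [NormedAddCommGroup E] [NormedSpace ℝ E]
    [CompleteSpace E] {f : ℤ → Rd d → E} (hf : IsDyadicFamily U f) (hU : LocallyBddAbove U)
    (hU0 : ∀ ρ > 0, 0 ≤ U ρ) {x : Rd d} (hx : x ≠ 0) :
    HasFDerivAt (fun y => ∑' j, f j y) (∑' j, _root_.fderiv ℝ (f j) x) x := by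
  have hx' := norm_pos_iff.2 hx
  obtain ⟨C, hC0, hC⟩ := hf.fderiv.2 0
  obtain ⟨M, hM⟩ := hU.mul_inv hU0 ‖x‖ hx'
  obtain ⟨T, hT⟩ := exists_tsum_dyadicProfile_le
  obtain ⟨D, hD0, hD⟩ := hf.summable_norm
  have hmem : x ∈ Metric.ball x (‖x‖ / 2) := Metric.mem_ball_self (by positivity)
  refine hasFDerivAt_tsum_of_isPreconnected (u := fun j => C * (M * (2 * dyadicProfile j ‖x‖)))
    (((hT _ hx').1.mul_left 2).mul_left M |>.mul_left C) (Metric.isOpen_ball (x := x) (ε := ‖x‖ / 2))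
    (convex_ball _ _).isPreconnected
    (fun j y _ => ((hf.1 j).differentiable (by simp) y).hasFDerivAt)
    (fun j y hy => ?_) hmem (hD x hx).1.of_norm hmem
  have hd : ‖y - x‖ < ‖x‖ / 2 := by simpa [dist_eq_norm] using hy
  have h1 : ‖x‖ / 2 ≤ ‖y‖ := by
    have := norm_sub_norm_le x y
    rw [norm_sub_rev] at this; linarith
  have h2 : ‖y‖ ≤ 2 * ‖x‖ := by
    have := norm_sub_norm_le y x; linarith
  have hy' : 0 < ‖y‖ := by linarith
  have h3 := hC j y (norm_pos_iff.1 hy')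
  simp only [norm_iteratedFDeriv_zero, pow_zero, mul_one] at h3
  refine h3.trans (mul_le_mul_of_nonneg_left ?_ hC0)
  refine mul_le_mul (hM _ h1 h2) (dyadicProfile_le_two_mul j hx' h1 h2)
    (dyadicProfile_nonneg j hy') ?_
  exact (mul_nonneg (hU0 _ hy') (inv_nonneg.2 hy'.le)).trans (hM _ h1 h2)

/-- The induction passes from the family to its derivatives, which take values in another space;
hence the quantification over E, U and f inside the statement. -/
lemma IsDyadicFamily.contDiffOn_tsum_nat (n : ℕ) : ∀ {E : Type} [NormedAddCommGroup E]
    [NormedSpace ℝ E] [CompleteSpace E] {U : ℝ → ℝ} {f : ℤ → Rd d → E}, IsDyadicFamily U f →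
    LocallyBddAbove U → (∀ ρ > 0, 0 ≤ U ρ) →
    ContDiffOn ℝ n (fun x => ∑' j, f j x) {0}ᶜ ∧
    ∃ C, 0 ≤ C ∧ ∀ x, x ≠ 0 →
      ‖iteratedFDeriv ℝ n (fun x => ∑' j, f j x) x‖ ≤ C * (U ‖x‖ * ‖x‖⁻¹ ^ n) := by
  induction n with
  | zero =>
    intro E _ _ _ U f hf hU hU0
    constructor
    · refine contDiffOn_zero.2 fun x hx => ?_
      exact (hf.hasFDerivAt_tsum hU hU0 hx).continuousAt.continuousWithinAt
    · obtain ⟨C, hC0, hC⟩ := hf.summable_norm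
      refine ⟨C, hC0, fun x hx => ?_⟩
      obtain ⟨h1, h2⟩ := hC x hx
      simpa using (norm_tsum_le_tsum_norm h1).trans h2
  | succ n ih =>
    intro E _ _ _ U f hf hU hU0
    obtain ⟨h1, C, hC0, hC⟩ := ih hf.fderiv (hU.mul_inv hU0)
      fun ρ hρ => mul_nonneg (hU0 ρ hρ) (inv_nonneg.2 (le_of_lt hρ))
    have hd : ∀ x ∈ ({0}ᶜ : Set (Rd d)), HasFDerivAt (fun y => ∑' j, f j y)
        (∑' j, _root_.fderiv ℝ (f j) x) x := fun x hx => hf.hasFDerivAt_tsum hU hU0 hx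
    have hopen : IsOpen ({0}ᶜ : Set (Rd d)) := isOpen_compl_singleton
    constructor
    · rw [show ((n + 1 : ℕ) : ℕ∞ω) = (n : ℕ∞ω) + 1 by simp,
        contDiffOn_succ_iff_fderiv_of_isOpen hopen]
      refine ⟨fun x hx => (hd x hx).differentiableAt.differentiableWithinAt, by simp, ?_⟩
      exact h1.congr fun x hx => (hd x hx).fderiv
    · refine ⟨C, hC0, fun x hx => ?_⟩
      rw [← norm_iteratedFDeriv_fderiv]
      have he : _root_.fderiv ℝ (fun y => ∑' j, f j y) =ᶠ[nhds x]
          fun x => ∑' j, _root_.fderiv ℝ (f j) x := by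
        filter_upwards [hopen.mem_nhds hx] with y hy using (hd y hy).fderiv
      rw [(he.iteratedFDeriv ℝ n).eq_of_nhds]
      refine (hC x hx).trans_eq ?_
      rw [pow_succ]; ring

lemma IsDyadicFamily.contDiffOn_tsum {E : Type} [NormedAddCommGroup E]
    [NormedSpace ℝ E] [CompleteSpace E] {f : ℤ → Rd d → E} (hf : IsDyadicFamily U f)
    (hU : LocallyBddAbove U) (hU0 : ∀ ρ > 0, 0 ≤ U ρ) :
    ContDiffOn ℝ ∞ (fun x => ∑' j, f j x) {0}ᶜ :=
  contDiffOn_infty.2 fun n => (IsDyadicFamily.contDiffOn_tsum_nat n hf hU hU0).1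

end Series

/-! ### Size of the potential across scales -/

section Kernel

variable {d : ℕ}

/-- The size `ρ^{-(d-2)} / twoExp p q (log ρ)` of the fundamental kernel at distance `ρ`. -/
noncomputable def kernelSize (d : ℕ) (p q ρ : ℝ) : ℝ :=
  ρ⁻¹ ^ (d - 2) * (twoExp p q (Real.log ρ))⁻¹

lemma kernelSize_pos (d : ℕ) (p q : ℝ) {ρ : ℝ} (hρ : 0 < ρ) : 0 < kernelSize d p q ρ := by
  have := twoExp_pos p q (Real.log ρ)
  unfold kernelSize; positivity

lemma twoExp_mono {p q u v : ℝ} (hp : 0 ≤ p) (hq : 0 ≤ q) (h : u ≤ v) :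
    twoExp p q u ≤ twoExp p q v := by
  rcases le_total u 0 with hu | hu
  · rcases le_total v 0 with hv | hv
    · rw [twoExp_of_nonpos hu, twoExp_of_nonpos hv]; exact Real.exp_le_exp.2 (by nlinarith)
    · rw [twoExp_of_nonpos hu, twoExp_of_nonneg hv]; exact Real.exp_le_exp.2 (by nlinarith)
  · rw [twoExp_of_nonneg hu, twoExp_of_nonneg (hu.trans h)]
    exact Real.exp_le_exp.2 (by nlinarith)

/-- The factor ρ/λ, which makes the large scales summable, is one of the d - 2 ≥ 1 inverse powers:
this uses d ≥ 3. -/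
lemma kernelSize_le_of_le (hd : 3 ≤ d) {p q lam ρ : ℝ} (hp : 0 ≤ p) (hq : 0 ≤ q) (hρ : 0 < ρ)
    (h : ρ ≤ lam) : kernelSize d p q lam ≤ kernelSize d p q ρ * (ρ / lam) := by
  obtain ⟨m, rfl⟩ : ∃ m, d = m + 3 := ⟨d - 3, by omega⟩
  have hlam := hρ.trans_le h
  rw [kernelSize, kernelSize, show m + 3 - 2 = m + 1 by omega, pow_succ, pow_succ]
  have h1 : (twoExp p q (Real.log lam))⁻¹ ≤ (twoExp p q (Real.log ρ))⁻¹ :=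
    inv_anti₀ (twoExp_pos _ _ _) (twoExp_mono hp hq (Real.log_le_log hρ h))
  have h2 : lam⁻¹ ^ m ≤ ρ⁻¹ ^ m := pow_le_pow_left₀ (by positivity) (inv_anti₀ hρ h) m
  have h3 := twoExp_pos p q (Real.log lam)
  have h4 := twoExp_pos p q (Real.log ρ)
  calc _ = (lam⁻¹ ^ m * (twoExp p q (Real.log lam))⁻¹) * lam⁻¹ := by ring
    _ ≤ (ρ⁻¹ ^ m * (twoExp p q (Real.log ρ))⁻¹) * lam⁻¹ := by gcongr
    _ = _ := by field_simp

/-- The weight grows at most linearly since |p|, |q| ≤ 1. The polynomial loss on small scales is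
later absorbed by Schwartz decay. -/
lemma kernelSize_le_of_ge (hd : 3 ≤ d) {p q lam ρ : ℝ} (hp : |p| ≤ 1) (hq : |q| ≤ 1)
    (hlam : 0 < lam) (h : lam ≤ ρ) :
    kernelSize d p q lam ≤ kernelSize d p q ρ * (ρ / lam) ^ (d - 1) := by
  have hρ := hlam.trans_le h
  have h1 : twoExp p q (Real.log ρ) ≤ ρ / lam * twoExp p q (Real.log lam) := by
    have := twoExp_le_exp_mul (u := Real.log ρ) (v := Real.log lam) hp hq
    rwa [one_mul, abs_of_nonneg (sub_nonneg.2 (Real.log_le_log hlam h)),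
      ← Real.log_div hρ.ne' hlam.ne', Real.exp_log (by positivity)] at this
  have h3 := twoExp_pos p q (Real.log lam)
  have h4 := twoExp_pos p q (Real.log ρ)
  rw [kernelSize, kernelSize, show d - 1 = d - 2 + 1 by omega, pow_succ (ρ / lam), div_pow,
    inv_pow, inv_pow]
  have h5 : (twoExp p q (Real.log lam))⁻¹ ≤ ρ / lam * (twoExp p q (Real.log ρ))⁻¹ := by
    rw [inv_le_iff_one_le_mul₀ h3, mul_right_comm, ← div_eq_mul_inv, one_le_div h4]
    exact h1
  calc _ ≤ (lam ^ (d - 2))⁻¹ * (ρ / lam * (twoExp p q (Real.log ρ))⁻¹) := by gcongr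
    _ = _ := by field_simp

lemma locallyBddAbove_kernelSize (hd : 3 ≤ d) {p q : ℝ} (hp : 0 ≤ p) (hq : 0 ≤ q) :
    LocallyBddAbove (kernelSize d p q) := by
  intro ρ hρ
  refine ⟨kernelSize d p q (ρ / 2), fun σ h1 h2 => ?_⟩
  refine (kernelSize_le_of_le hd hp hq (by positivity) h1).trans ?_
  exact mul_le_of_le_one_right (kernelSize_pos _ _ _ (by positivity)).le
    ((div_le_one (by linarith)).2 h1)

end Kernel

/-! ### Multi-index derivatives -/

section MultiDeriv

variable {d : ℕ}

lemma partialDeriv_bound {U : Rd d → Rd d} (hU : ContDiffOn ℝ ∞ U {0}ᶜ) (i : Fin d) :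
    ContDiffOn ℝ ∞ (partialDeriv i U) {0}ᶜ ∧ ∀ (k : ℕ) (x : Rd d), x ≠ 0 →
      ‖iteratedFDeriv ℝ k (partialDeriv i U) x‖ ≤ ‖iteratedFDeriv ℝ (k + 1) U x‖ := by
  have hopen : IsOpen ({0}ᶜ : Set (Rd d)) := isOpen_compl_singleton
  have hd := ((contDiffOn_infty_iff_fderiv_of_isOpen hopen).1 hU).2
  set A : (Rd d →L[ℝ] Rd d) →L[ℝ] Rd d :=
    ContinuousLinearMap.apply ℝ (Rd d) (EuclideanSpace.single i (1 : ℝ))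
  have hA : ‖A‖ ≤ 1 := by
    refine ContinuousLinearMap.opNorm_le_bound _ zero_le_one fun T => ?_
    simpa [A] using T.le_opNorm (EuclideanSpace.single i (1 : ℝ))
  refine ⟨A.contDiff.comp_contDiffOn hd, fun k x hx => ?_⟩
  have h := A.norm_iteratedFDeriv_comp_left (N := ∞) (n := k)
    ((hd.contDiffAt (hopen.mem_nhds hx))) (by exact_mod_cast le_top)
  rw [norm_iteratedFDeriv_fderiv] at h
  refine h.trans (mul_le_of_le_one_left (norm_nonneg _) hA)

lemma partialDeriv_iterate_bound {U : Rd d → Rd d} (hU : ContDiffOn ℝ ∞ U {0}ᶜ) (i : Fin d)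
    (m : ℕ) : ContDiffOn ℝ ∞ ((partialDeriv i)^[m] U) {0}ᶜ ∧ ∀ (k : ℕ) (x : Rd d), x ≠ 0 →
      ‖iteratedFDeriv ℝ k ((partialDeriv i)^[m] U) x‖ ≤ ‖iteratedFDeriv ℝ (k + m) U x‖ := by
  induction m with
  | zero => exact ⟨hU, fun k x _ => le_rfl⟩
  | succ m ih =>
    rw [Function.iterate_succ_apply']
    obtain ⟨h1, h2⟩ := partialDeriv_bound ih.1 i
    refine ⟨h1, fun k x hx => (h2 k x hx).trans ((ih.2 (k + 1) x hx).trans_eq ?_)⟩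
    rw [add_assoc, add_comm 1 m]

/-- A coordinate derivative is the total derivative evaluated at a unit vector, so each one raises
the order of `iteratedFDeriv` by one without increasing the norm. -/
lemma norm_multiDeriv_le {U : Rd d → Rd d} (hU : ContDiffOn ℝ ∞ U {0}ᶜ) (ν : Fin d → ℕ) {x : Rd d}
    (hx : x ≠ 0) : ‖multiDeriv ν U x‖ ≤ ‖iteratedFDeriv ℝ (∑ i, ν i) U x‖ := by
  have key : ∀ l : List (Fin d),
      ContDiffOn ℝ ∞ (l.foldr (fun i W => (partialDeriv i)^[ν i] W) U) {0}ᶜ ∧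
      ∀ (k : ℕ) (x : Rd d), x ≠ 0 →
        ‖iteratedFDeriv ℝ k (l.foldr (fun i W => (partialDeriv i)^[ν i] W) U) x‖ ≤
          ‖iteratedFDeriv ℝ (k + (l.map ν).sum) U x‖ := by
    intro l
    induction l with
    | nil => exact ⟨hU, fun k x _ => le_rfl⟩
    | cons i l ih =>
      obtain ⟨h1, h2⟩ := partialDeriv_iterate_bound ih.1 i (ν i)
      refine ⟨h1, fun k x hx => (h2 k x hx).trans ((ih.2 _ x hx).trans_eq ?_)⟩
      rw [List.map_cons, List.sum_cons, add_assoc]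
  have := (key (List.finRange d)).2 0 x hx
  rwa [norm_iteratedFDeriv_zero, zero_add, ← Fin.sum_univ_def] at this

end MultiDeriv

/-! ### The potential and the representing field -/

section Potential

variable {d : ℕ} {p q : ℝ} {Q : ℝ → ℝ}

/-- The dyadic piece, at scale `2^j`, of the potential with symbol `Q(log|ξ|) / (4π²|ξ|²)`. -/
noncomputable def dyadicPotential (hQ : IsReciprocalSymbol p q Q) (j : ℤ) (x : Rd d) : ℝ :=
  kernelSize d p q ((2 : ℝ) ^ j) *
    (𝓕 (dyadicSchwartz (d := d) hQ (Real.log ((2 : ℝ) ^ j))) (((2 : ℝ) ^ j)⁻¹ • x)).re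

lemma contDiff_dyadicPotential (hQ : IsReciprocalSymbol p q Q) (j : ℤ) :
    ContDiff ℝ ∞ (dyadicPotential (d := d) hQ j) :=
  contDiff_const.mul (Complex.reCLM.contDiff.comp
    (((𝓕 (dyadicSchwartz (d := d) hQ _)).smooth ⊤).comp (contDiff_const_smul _)))

lemma norm_iteratedFDeriv_dyadicPotential_le (hQ : IsReciprocalSymbol p q Q) (j : ℤ) (k : ℕ)
    (x : Rd d) : ‖iteratedFDeriv ℝ k (dyadicPotential hQ j) x‖ ≤
      kernelSize d p q ((2 : ℝ) ^ j) * (((2 : ℝ) ^ j)⁻¹ ^ k *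
        ‖iteratedFDeriv ℝ k (𝓕 ⇑(dyadicSchwartz (d := d) hQ (Real.log ((2 : ℝ) ^ j))))
          (((2 : ℝ) ^ j)⁻¹ • x)‖) := by
  set lam := (2 : ℝ) ^ j
  have hlam : 0 < lam := by positivity
  set F : Rd d → ℂ := 𝓕 ⇑(dyadicSchwartz (d := d) hQ (Real.log lam))
  have hF : ContDiff ℝ k F :=
    ((𝓕 (dyadicSchwartz (d := d) hQ (Real.log lam))).smooth ⊤).of_le (by exact_mod_cast le_top)
  have hre : ContDiff ℝ k fun y => (F y).re := Complex.reCLM.contDiff.comp hF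
  have e : dyadicPotential (d := d) hQ j =
      fun x => kernelSize d p q lam • (F (lam⁻¹ • x)).re := rfl
  rw [e, iteratedFDeriv_const_smul_apply'
    (f := fun x => (F (lam⁻¹ • x)).re) (hre.comp (contDiff_const_smul _)).contDiffAt, norm_smul,
    Real.norm_of_nonneg (kernelSize_pos _ _ _ hlam).le]
  refine mul_le_mul_of_nonneg_left ?_ (kernelSize_pos _ _ _ hlam).le
  rw [iteratedFDeriv_comp_const_smul (f := fun y => (F y).re) lam⁻¹ hre, norm_smul, norm_pow,
    Real.norm_of_nonneg (inv_nonneg.2 hlam.le)]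
  refine mul_le_mul_of_nonneg_left ?_ (by positivity)
  refine (Complex.reCLM.norm_iteratedFDeriv_comp_left (N := k) hF.contDiffAt le_rfl).trans ?_
  rw [Complex.reCLM_norm, one_mul]

/-- At scales λ ≥ |x| boundedness of the rescaled piece suffices, the gain coming from the
prefactor. At scales λ ≤ |x| the gain comes from rapid decay of the Schwartz profile. -/
lemma isDyadicFamily_dyadicPotential (hd : 3 ≤ d) (hQ : IsReciprocalSymbol p q Q) (hp0 : 0 ≤ p)
    (hp : p ≤ 1) (hq0 : 0 ≤ q) (hq : q ≤ 1) :
    IsDyadicFamily (kernelSize d p q) (dyadicPotential (d := d) hQ) := by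
  have hp' : |p| ≤ 1 := by rwa [abs_of_nonneg hp0]
  have hq' : |q| ≤ 1 := by rwa [abs_of_nonneg hq0]
  refine ⟨contDiff_dyadicPotential hQ, fun k => ?_⟩
  obtain ⟨C, hC0, hC⟩ := exists_fourier_dyadicSchwartz_le (d := d) hQ hp' hq' k 0
  -- Decay of order d + k pays for the loss (ρ/λ)^{d-1} of the prefactor and the (ρ/λ)^k that turns
  -- λ^{-k} into ρ^{-k}, and leaves one factor λ/ρ.
  obtain ⟨D, hD0, hD⟩ := exists_fourier_dyadicSchwartz_le (d := d) hQ hp' hq' k (d + k)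
  refine ⟨C + D, by positivity, fun j x hx => ?_⟩
  refine (norm_iteratedFDeriv_dyadicPotential_le hQ j k x).trans ?_
  set lam := (2 : ℝ) ^ j with hlamdef
  have hlam : 0 < lam := by positivity
  have hρ := norm_pos_iff.2 hx
  set ρ := ‖x‖
  have hC' := hC (Real.log lam) (lam⁻¹ • x)
  have hD' := hD (Real.log lam) (lam⁻¹ • x)
  set B := ‖iteratedFDeriv ℝ k (𝓕 ⇑(dyadicSchwartz (d := d) hQ (Real.log lam))) (lam⁻¹ • x)‖
  have hB0 : 0 ≤ B := norm_nonneg _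
  have hKρ := kernelSize_pos d p q hρ
  have hKl := kernelSize_pos d p q hlam
  rw [pow_zero, one_mul] at hC'
  rw [norm_smul, Real.norm_of_nonneg (inv_nonneg.2 hlam.le)] at hD'
  change (lam⁻¹ * ρ) ^ (d + k) * B ≤ D at hD'
  rcases le_total ρ lam with h | h
  · have hmin : dyadicProfile j ρ = ρ / lam := by
      rw [dyadicProfile, ← hlamdef]
      exact min_eq_right (((div_le_one hlam).2 h).trans ((one_le_div hρ).2 h))
    rw [hmin]
    have h1 := kernelSize_le_of_le hd hp0 hq0 hρ h
    have h2 : lam⁻¹ ^ k ≤ ρ⁻¹ ^ k := pow_le_pow_left₀ (by positivity) (inv_anti₀ hρ h) k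
    calc _ ≤ (kernelSize d p q ρ * (ρ / lam)) * (ρ⁻¹ ^ k * (C + D)) := by
          gcongr; linarith
      _ = _ := by ring
  · have hmin : dyadicProfile j ρ = lam / ρ := by
      rw [dyadicProfile, ← hlamdef]
      exact min_eq_left (((div_le_one hρ).2 h).trans ((one_le_div hlam).2 h))
    rw [hmin]
    have h1 := kernelSize_le_of_ge hd hp' hq' hlam h
    have h3 : B ≤ D * (lam / ρ) ^ (d + k) := by
      have e : (lam / ρ) ^ (d + k) * (lam⁻¹ * ρ) ^ (d + k) = 1 := by
        rw [← mul_pow]; field_simp; simp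
      calc B = (lam / ρ) ^ (d + k) * ((lam⁻¹ * ρ) ^ (d + k) * B) := by
            rw [← mul_assoc, e, one_mul]
        _ ≤ (lam / ρ) ^ (d + k) * D := by gcongr
        _ = _ := mul_comm _ _
    calc _ ≤ (kernelSize d p q ρ * (ρ / lam) ^ (d - 1)) * (lam⁻¹ ^ k *
          (D * (lam / ρ) ^ (d + k))) := by gcongr
      _ = D * (kernelSize d p q ρ * ρ⁻¹ ^ k * (lam / ρ)) := by
          obtain ⟨m, rfl⟩ : ∃ m, d = m + 1 := ⟨d - 1, by omega⟩
          rw [Nat.add_sub_cancel, show m + 1 + k = m + k + 1 by ring, pow_succ, pow_add]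
          simp only [div_pow, inv_pow]
          field_simp
      _ ≤ _ := by gcongr; linarith

/-- The linear map sending a functional to the vector representing it. -/
noncomputable def dualVector (d : ℕ) : (Rd d →L[ℝ] ℝ) →L[ℝ] Rd d :=
  ∑ i, (ContinuousLinearMap.apply ℝ ℝ (EuclideanSpace.single i (1 : ℝ) : Rd d)).smulRight
    (EuclideanSpace.single i (1 : ℝ))

lemma dualVector_apply (T : Rd d →L[ℝ] ℝ) (i : Fin d) :
    dualVector d T i = T (EuclideanSpace.single i 1) := by
  simp [dualVector, Pi.single_apply]

lemma inner_dualVector (T : Rd d →L[ℝ] ℝ) (w : Rd d) : inner ℝ (dualVector d T) w = T w := by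
  conv_rhs => rw [← (EuclideanSpace.basisFun (Fin d) ℝ).sum_repr w, map_sum]
  simp only [PiLp.inner_apply, dualVector_apply, map_smul]
  refine Finset.sum_congr rfl fun i _ => ?_
  simp

/-- The vector field `-∇ Σ_j N_j`, with `N_j` the dyadic potentials. -/
noncomputable def representingField (hQ : IsReciprocalSymbol p q Q) (x : Rd d) : Rd d :=
  -dualVector d (fderiv ℝ (fun x => ∑' j, dyadicPotential hQ j x) x)

lemma representingField_spec (hd : 3 ≤ d) (hQ : IsReciprocalSymbol p q Q) (hp0 : 0 ≤ p)
    (hp : p ≤ 1) (hq0 : 0 ≤ q) (hq : q ≤ 1) :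
    ContDiffOn ℝ ∞ (representingField (d := d) hQ) {0}ᶜ ∧ ∀ k : ℕ, ∃ C, 0 ≤ C ∧ ∀ x : Rd d, x ≠ 0 →
      ‖iteratedFDeriv ℝ k (representingField hQ) x‖ ≤
        C * (kernelSize d p q ‖x‖ * ‖x‖⁻¹ ^ (k + 1)) := by
  have hfam := isDyadicFamily_dyadicPotential hd hQ hp0 hp hq0 hq
  have hU := locallyBddAbove_kernelSize hd hp0 hq0
  have hU0 : ∀ ρ > 0, 0 ≤ kernelSize d p q ρ := fun ρ hρ => (kernelSize_pos d p q hρ).le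
  have hopen : IsOpen ({0}ᶜ : Set (Rd d)) := isOpen_compl_singleton
  have hN := hfam.contDiffOn_tsum hU hU0
  have hdN := ((contDiffOn_infty_iff_fderiv_of_isOpen hopen).1 hN).2
  have e : representingField (d := d) hQ =
      (-dualVector d) ∘ fderiv ℝ (fun x => ∑' j, dyadicPotential hQ j x) := rfl
  refine ⟨by rw [e]; exact (-dualVector d).contDiff.comp_contDiffOn hdN, fun k => ?_⟩
  obtain ⟨-, C, hC0, hC⟩ := IsDyadicFamily.contDiffOn_tsum_nat (k + 1) hfam hU hU0
  refine ⟨‖-dualVector d‖ * C, by positivity, fun x hx => ?_⟩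
  have h := (-dualVector d).norm_iteratedFDeriv_comp_left (N := ∞) (n := k)
    (hdN.contDiffAt (hopen.mem_nhds hx)) (by exact_mod_cast le_top)
  rw [norm_iteratedFDeriv_fderiv] at h
  rw [e, mul_assoc]
  exact h.trans (mul_le_mul_of_nonneg_left (hC x hx) (norm_nonneg _))

/-- The exponents add up as (d - 2) + (1 - s) + (k + 1) = d - s + k; the last summand includes the
extra derivative in V = -∇N. -/
lemma kernelSize_mul_le_one (hd : 3 ≤ d) {s τ : ℝ} {ρ : ℝ} (hρ : 0 < ρ) (h1 : ρ ≤ 1) (k : ℕ) :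
    kernelSize d (1 - s) (1 - τ) ρ * ρ⁻¹ ^ (k + 1) = (ρ ^ ((d : ℝ) - s + k))⁻¹ := by
  rw [kernelSize, twoExp_of_nonpos (Real.log_nonpos hρ.le h1), mul_comm (1 - s),
    ← Real.rpow_def_of_pos hρ, ← Real.rpow_natCast, ← Real.rpow_natCast, Real.inv_rpow hρ.le,
    Real.inv_rpow hρ.le, ← mul_inv, ← mul_inv, ← Real.rpow_add hρ, ← Real.rpow_add hρ]
  congr 2
  rw [Nat.cast_sub (by omega)]; push_cast; ring

lemma kernelSize_mul_one_le (hd : 3 ≤ d) {s τ : ℝ} {ρ : ℝ} (h1 : 1 ≤ ρ) (k : ℕ) :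
    kernelSize d (1 - s) (1 - τ) ρ * ρ⁻¹ ^ (k + 1) = (ρ ^ ((d : ℝ) - τ + k))⁻¹ := by
  have hρ : 0 < ρ := by linarith
  rw [kernelSize, twoExp_of_nonneg (Real.log_nonneg h1), mul_comm (1 - τ),
    ← Real.rpow_def_of_pos hρ, ← Real.rpow_natCast, ← Real.rpow_natCast, Real.inv_rpow hρ.le,
    Real.inv_rpow hρ.le, ← mul_inv, ← mul_inv, ← Real.rpow_add hρ, ← Real.rpow_add hρ]
  congr 2
  rw [Nat.cast_sub (by omega)]; push_cast; ring

lemma derivativeBounds_representingField (hd : 3 ≤ d) {s τ : ℝ} (hs0 : 0 ≤ s) (hs1 : s ≤ 1)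
    (hτ0 : 0 ≤ τ) (hτ1 : τ ≤ 1) (hQ : IsReciprocalSymbol (1 - s) (1 - τ) Q) :
    DerivativeBounds s τ (representingField (d := d) hQ) := by
  intro ν
  obtain ⟨hsm, hb⟩ := representingField_spec hd hQ (by linarith) (by linarith) (by linarith)
    (by linarith)
  obtain ⟨C, hC0, hC⟩ := hb (∑ i, ν i)
  refine ⟨C + 1, by linarith, fun x hx h1 => ?_, fun x h1 => ?_⟩
  · have hρ := norm_pos_iff.2 hx
    refine (norm_multiDeriv_le hsm ν hx).trans ((hC x hx).trans ?_)
    rw [kernelSize_mul_le_one hd hρ h1, div_eq_mul_inv]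
    exact mul_le_mul_of_nonneg_right (by linarith) (by positivity)
  · have hρ : 0 < ‖x‖ := by linarith
    have hx := norm_pos_iff.1 hρ
    refine (norm_multiDeriv_le hsm ν hx).trans ((hC x hx).trans ?_)
    rw [kernelSize_mul_one_le hd h1, div_eq_mul_inv]
    exact mul_le_mul_of_nonneg_right (by linarith) (by positivity)

end Potential

/-! ### Convex profiles as superpositions of cones -/

lemma isTwoExpSymbol_of_eq_exp {p q A B u₀ u₁ : ℝ} {f : ℝ → ℝ} (hf : ContDiff ℝ ∞ f)
    (h0 : ∀ u ≤ u₀, f u = A * Real.exp (p * u)) (h1 : ∀ u ≥ u₁, f u = B * Real.exp (q * u)) :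
    IsTwoExpSymbol p q f := by
  refine ⟨hf, fun n => ?_⟩
  -- The endpoints are pushed past 0, so that outside [a, b] the weight is on the branch matching
  -- the exact exponential; between them compactness gives the bound.
  set a := min u₀ 0
  set b := max u₁ 0
  have ha : a ≤ 0 := min_le_right _ _
  have hb : 0 ≤ b := le_max_right _ _
  have hcont : Continuous (iteratedDeriv n f) :=
    hf.continuous_iteratedDeriv n (by exact_mod_cast le_top)
  obtain ⟨M, hM⟩ := isCompact_Icc.exists_bound_of_continuousOn (s := Icc a b) hcont.continuousOn
  have hM0 : 0 ≤ M := (norm_nonneg _).trans (hM 0 ⟨ha, hb⟩)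
  set c := max |p| |q|
  have hc : 0 ≤ c := (abs_nonneg p).trans (le_max_left _ _)
  have hconst : ∀ (D r u : ℝ), iteratedDeriv n (fun u => D * Real.exp (r * u)) u =
      D * (r ^ n * Real.exp (r * u)) := fun D r u => by
    rw [iteratedDeriv_const_mul_field, iteratedDeriv_exp_const_mul]
  have hm0 : 0 ≤ M * Real.exp (c * (b - a)) := by positivity
  have hA0 : 0 ≤ |A| * |p| ^ n := by positivity
  have hB0 : 0 ≤ |B| * |q| ^ n := by positivity
  refine ⟨|A| * |p| ^ n + |B| * |q| ^ n + M * Real.exp (c * (b - a)), fun u => ?_⟩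
  have hT := twoExp_pos p q u
  rcases lt_or_ge u a with hu | hu
  · have e : f =ᶠ[nhds u] fun u => A * Real.exp (p * u) := by
      filter_upwards [Iio_mem_nhds hu] with v hv using h0 v ((le_of_lt hv).trans (min_le_left _ _))
    rw [e.iteratedDeriv_eq n, hconst, abs_mul, abs_mul, abs_pow, Real.abs_exp, ← mul_assoc,
      twoExp_of_nonpos (hu.le.trans ha)]
    exact mul_le_mul_of_nonneg_right (by linarith) (Real.exp_pos _).le
  · rcases lt_or_ge b u with hu' | hu'
    · have e : f =ᶠ[nhds u] fun u => B * Real.exp (q * u) := by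
        filter_upwards [Ioi_mem_nhds hu'] with v hv using h1 v ((le_max_left _ _).trans (le_of_lt hv))
      rw [e.iteratedDeriv_eq n, hconst, abs_mul, abs_mul, abs_pow, Real.abs_exp, ← mul_assoc,
        twoExp_of_nonneg (hb.trans hu'.le)]
      exact mul_le_mul_of_nonneg_right (by linarith) (Real.exp_pos _).le
    · have h2 := twoExp_le_exp_mul (u := 0) (v := u) (le_max_left |p| |q|) (le_max_right |p| |q|)
      rw [show twoExp p q 0 = 1 by simp [twoExp]] at h2
      have h3 : Real.exp (c * |0 - u|) ≤ Real.exp (c * (b - a)) := by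
        refine Real.exp_le_exp.2 (mul_le_mul_of_nonneg_left (abs_le.2 ⟨?_, ?_⟩) hc) <;> linarith
      have h4 : 1 ≤ Real.exp (c * (b - a)) * twoExp p q u :=
        h2.trans (mul_le_mul_of_nonneg_right h3 hT.le)
      calc |iteratedDeriv n f u| ≤ M * 1 := by simpa using hM u ⟨hu, hu'⟩
        _ ≤ M * (Real.exp (c * (b - a)) * twoExp p q u) := mul_le_mul_of_nonneg_left h4 hM0
        _ = (M * Real.exp (c * (b - a))) * twoExp p q u := by ring
        _ ≤ _ := mul_le_mul_of_nonneg_right (by linarith) hT.le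

/-- A smooth profile, in the logarithmic variable, which is a multiple of `e^{-su}` near `-∞` and of
`e^{-δu}` near `+∞`, and which is convex in the variable `e^u`. -/
structure IsTwoScaleProfile (s δ : ℝ) (h : ℝ → ℝ) : Prop where
  contDiff : ContDiff ℝ ∞ h
  left : ∃ A > 0, ∃ u₀, ∀ u ≤ u₀, h u = A * Real.exp (-s * u)
  right : ∃ B, ∃ u₁, (∀ u ≥ u₁, h u = B * Real.exp (-δ * u)) ∧ (δ < 1 → 0 < B)
  convex : ∀ u, 0 ≤ deriv (deriv h) u - deriv h u

/-- The density `e^u (h'' - h')` of the superposition of cone kernels giving `h`. -/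
noncomputable def coneDensity (h : ℝ → ℝ) (u : ℝ) : ℝ :=
  Real.exp u * (deriv (deriv h) u - deriv h u)

section Profile

variable {s δ : ℝ} {h : ℝ → ℝ} (hh : IsTwoScaleProfile s δ h)

include hh

lemma IsTwoScaleProfile.isTwoExpSymbol : IsTwoExpSymbol (-s) (-δ) h := by
  obtain ⟨A, -, u₀, h0⟩ := hh.left
  obtain ⟨B, u₁, h1, -⟩ := hh.right
  exact isTwoExpSymbol_of_eq_exp hh.contDiff h0 h1

omit hh in
lemma coneDensity_eq_of_eventuallyEq {A r u : ℝ}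
    (e : h =ᶠ[nhds u] fun u => A * Real.exp (r * u)) :
    coneDensity h u = A * (r ^ 2 - r) * Real.exp ((1 + r) * u) := by
  have hd : ∀ D : ℝ, deriv (fun u => D * Real.exp (r * u)) =
      fun u => D * r * Real.exp (r * u) := by
    intro D
    ext v
    have h1 : HasDerivAt (fun v : ℝ => r * v) r v := by simpa using (hasDerivAt_id v).const_mul r
    rw [(h1.exp.const_mul D).deriv]; ring
  rw [coneDensity, e.deriv.deriv_eq, e.deriv_eq, hd, hd, add_mul, one_mul, Real.exp_add]
  ring

lemma IsTwoScaleProfile.coneDensity_left : ∃ A > 0, ∃ u₀, ∀ u ≤ u₀,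
    coneDensity h u = A * (s ^ 2 + s) * Real.exp ((1 - s) * u) := by
  obtain ⟨A, hA, u₀, h0⟩ := hh.left
  refine ⟨A, hA, u₀ - 1, fun u hu => ?_⟩
  rw [coneDensity_eq_of_eventuallyEq (A := A) (r := -s)]
  · ring_nf
  · filter_upwards [Iio_mem_nhds (show u < u₀ by linarith)] with v hv using h0 v (le_of_lt hv)

lemma IsTwoScaleProfile.coneDensity_right : ∃ B, ∃ u₁, (∀ u ≥ u₁,
    coneDensity h u = B * (δ ^ 2 + δ) * Real.exp ((1 - δ) * u)) ∧ (δ < 1 → 0 < B) := by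
  obtain ⟨B, u₁, h1, hB⟩ := hh.right
  refine ⟨B, u₁ + 1, fun u hu => ?_, hB⟩
  rw [coneDensity_eq_of_eventuallyEq (A := B) (r := -δ)]
  · ring_nf
  · filter_upwards [Ioi_mem_nhds (show u₁ < u by linarith)] with v hv using h1 v (le_of_lt hv)

lemma IsTwoScaleProfile.contDiff_coneDensity : ContDiff ℝ ∞ (coneDensity h) := by
  have h1 := (contDiff_infty_iff_deriv.1 hh.contDiff).2
  have h2 := (contDiff_infty_iff_deriv.1 h1).2
  exact Real.contDiff_exp.mul (h2.sub h1)

lemma IsTwoScaleProfile.isTwoExpSymbol_coneDensity :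
    IsTwoExpSymbol (1 - s) (1 - δ) (coneDensity h) := by
  obtain ⟨A, -, u₀, h0⟩ := hh.coneDensity_left
  obtain ⟨B, u₁, h1, -⟩ := hh.coneDensity_right
  exact isTwoExpSymbol_of_eq_exp hh.contDiff_coneDensity h0 h1

lemma IsTwoScaleProfile.coneDensity_nonneg (u : ℝ) : 0 ≤ coneDensity h u :=
  mul_nonneg (Real.exp_pos _).le (hh.convex u)

/-- The density behaves like e^{(1-s)u} at -∞ and like a multiple of e^{(1-δ)u} at +∞. Small scales
of g govern high frequencies and its tail governs low ones, with saturation when δ > 1; δ = 1 is the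
logarithmic case. -/
lemma IsTwoScaleProfile.isReciprocalSymbol (hs0 : 0 < s) (hs1 : s < 1) (hδ0 : 0 < δ) (hδ1 : δ ≠ 1)
    {κ : ℝ → ℝ} (hκ : IsLogKernel κ) :
    (∀ v, 0 < logCorr κ (coneDensity h) v) ∧
    IsReciprocalSymbol (1 - s) (max (1 - δ) 0) (fun v => (logCorr κ (coneDensity h) v)⁻¹) := by
  have hφ := hh.isTwoExpSymbol_coneDensity
  have p0 : 0 < 1 - s := by linarith
  have p1 : 1 - s < 1 := by linarith
  have q0 : 1 - δ ≠ 0 := fun h => hδ1 (by linarith)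
  have q1 : 1 - δ < 1 := by linarith
  obtain ⟨c, hc, hlow⟩ : ∃ c > 0, ∀ v, c * twoExp (1 - s) (max (1 - δ) 0) (-v) ≤
      logCorr κ (coneDensity h) v := by
    obtain ⟨A, hA, u₀, h0⟩ := hh.coneDensity_left
    refine exists_le_logCorr hκ p0 p1 q0 q1 hφ hh.coneDensity_nonneg
      (A := A * (s ^ 2 + s)) (by positivity) (fun u hu => (h0 u hu).ge) fun hq => ?_
    obtain ⟨B, u₁, h1, hB⟩ := hh.coneDensity_right
    have hB' := hB (by linarith)
    exact ⟨B * (δ ^ 2 + δ), by positivity, u₁, fun u hu => (h1 u hu).ge⟩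
  have hG := contDiff_logCorr hκ p0 p1 q0 q1 hφ
  have hpos : ∀ v, 0 < logCorr κ (coneDensity h) v := fun v =>
    (mul_pos hc (twoExp_pos _ _ _)).trans_le (hlow v)
  refine ⟨hpos, hG.inv fun v => (hpos v).ne', fun n => ?_⟩
  exact exists_iteratedDeriv_inv_le hG (w := fun v => twoExp (1 - s) (max (1 - δ) 0) (-v))
    (fun v => twoExp_pos _ _ _) hc hlow
    (fun n => exists_iteratedDeriv_logCorr_le hκ p0 p1 q0 q1 hφ n) n

omit hh in
lemma tendsto_zero_of_isTwoExpSymbol {p q : ℝ} (hq : q < 0) {f : ℝ → ℝ}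
    (hf : IsTwoExpSymbol p q f) : Filter.Tendsto f Filter.atTop (nhds 0) := by
  obtain ⟨C, hC0, hC⟩ := hf.exists_bound
  have h1 : Filter.Tendsto (fun u => C * Real.exp (q * u)) Filter.atTop (nhds (C * 0)) :=
    (Real.tendsto_exp_atBot.comp (Filter.tendsto_id.const_mul_atTop_of_neg hq)).const_mul C
  rw [mul_zero] at h1
  refine squeeze_zero_norm' ?_ h1
  filter_upwards [Filter.eventually_ge_atTop 0] with u hu
  have := hC u
  rwa [twoExp_of_nonneg hu] at this

/-- The profile is a superposition of the profiles `(1 - e^{y-u})_+` of cone kernels. -/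
lemma IsTwoScaleProfile.eq_integral (hδ0 : 0 < δ) (y : ℝ) :
    Integrable (fun u => coneDensity h u * (Real.exp (-u) * max (1 - Real.exp (y - u)) 0)) ∧
    h y = ∫ u, coneDensity h u * (Real.exp (-u) * max (1 - Real.exp (y - u)) 0) := by
  -- F is a primitive of f with F y = -h y and limit 0 at +∞. This is Taylor's formula at infinity
  -- in the variable e^u, and f ≥ 0 gives integrability for free.
  set F : ℝ → ℝ := fun u => deriv h u * (1 - Real.exp (y - u)) - h u
  set f : ℝ → ℝ := fun u => (deriv (deriv h) u - deriv h u) * (1 - Real.exp (y - u))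
  have hsym := hh.isTwoExpSymbol
  have hder : ∀ u ∈ Ici y, HasDerivAt F (f u) u := by
    intro u _
    have a1 : HasDerivAt h (deriv h u) u := (hh.contDiff.differentiable (by simp) u).hasDerivAt
    have a2 : HasDerivAt (deriv h) (deriv (deriv h) u) u :=
      (hsym.deriv.1.differentiable (by simp) u).hasDerivAt
    have a3 : HasDerivAt (fun u => y - u) (-1) u := by simpa using (hasDerivAt_id u).const_sub y
    refine ((a2.mul (a3.exp.const_sub 1)).sub a1).congr_deriv ?_
    simp only [f]; ring
  have hpos : ∀ u ∈ Ioi y, 0 ≤ f u := fun u hu => mul_nonneg (hh.convex u)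
    (sub_nonneg.2 (Real.exp_le_one_iff.2 (by linarith [mem_Ioi.1 hu])))
  have hlim : Filter.Tendsto F Filter.atTop (nhds 0) := by
    have b1 := tendsto_zero_of_isTwoExpSymbol (neg_neg_of_pos hδ0) hsym.deriv
    have b2 := tendsto_zero_of_isTwoExpSymbol (neg_neg_of_pos hδ0) hsym
    have b4 : Filter.Tendsto (fun u : ℝ => y - u) Filter.atTop Filter.atBot := by
      simpa only [sub_eq_add_neg] using
        Filter.tendsto_atBot_add_const_left Filter.atTop y Filter.tendsto_neg_atTop_atBot
    have b3 : Filter.Tendsto (fun u => Real.exp (y - u)) Filter.atTop (nhds 0) :=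
      Real.tendsto_exp_atBot.comp b4
    simpa using (b1.mul (b3.const_sub 1)).sub b2
  have hI := integrableOn_Ioi_deriv_of_nonneg' hder hpos hlim
  have hE := integral_Ioi_of_hasDerivAt_of_nonneg' hder hpos hlim
  have e : (fun u => coneDensity h u * (Real.exp (-u) * max (1 - Real.exp (y - u)) 0)) =
      (Ioi y).indicator f := by
    ext u
    by_cases hu : u ∈ Ioi y
    · have : Real.exp (y - u) ≤ 1 := Real.exp_le_one_iff.2 (by linarith [mem_Ioi.1 hu])
      rw [indicator_of_mem hu, max_eq_left (by linarith), coneDensity, Real.exp_neg]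
      have := (Real.exp_pos u).ne'
      simp only [f]; field_simp
    · have : 1 ≤ Real.exp (y - u) := Real.one_le_exp (by linarith [notMem_Ioi.1 hu])
      rw [indicator_of_notMem hu, max_eq_right (by linarith), mul_zero, mul_zero]
  rw [e]
  refine ⟨(integrable_indicator_iff measurableSet_Ioi).2 hI, ?_⟩
  rw [integral_indicator measurableSet_Ioi, hE]
  simp [F]

end Profile

/-! ### The logarithmic profile of a radial kernel -/

section Radial

variable {d : ℕ}

/-- The profile `e^{(d-1)y} g(e^y e_i)` of a radial function `g`. -/
noncomputable def logProfile (i : Fin d) (g : Rd d → ℝ) (y : ℝ) : ℝ :=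
  Real.exp (((d : ℝ) - 1) * y) * g (Real.exp y • EuclideanSpace.single i (1 : ℝ))

lemma contDiff_logProfile {g : Rd d → ℝ} (hg : ContDiffOn ℝ ∞ g {0}ᶜ) (i : Fin d) :
    ContDiff ℝ ∞ (logProfile i g) := by
  refine (Real.contDiff_exp.comp (contDiff_const.mul contDiff_id)).mul ?_
  rw [← contDiffOn_univ]
  refine hg.comp (Real.contDiff_exp.smul contDiff_const).contDiffOn fun y _ => ?_
  have : Real.exp y ≠ 0 := (Real.exp_pos y).ne'
  simp [this]

lemma eq_logProfile {g : Rd d → ℝ} (hg : ∀ x y : Rd d, ‖x‖ = ‖y‖ → g x = g y) (i : Fin d)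
    {x : Rd d} (hx : x ≠ 0) :
    g x = Real.exp (-((d : ℝ) - 1) * Real.log ‖x‖) * logProfile i g (Real.log ‖x‖) := by
  rw [logProfile, ← mul_assoc, ← Real.exp_add, neg_mul, neg_add_cancel, Real.exp_zero, one_mul]
  refine hg _ _ ?_
  rw [norm_smul, PiLp.norm_single, Real.exp_log (norm_pos_iff.2 hx)]
  simp

/-- For k(ρ) = h(log ρ) one has ρ²k'' = h'' - h'. Convexity enters as monotonicity of k', that is,
of h'(y)e^{-y}. -/
lemma logProfile_convex {g : Rd d → ℝ} (hg : PositivityAssumption g) (i : Fin d) (u : ℝ) :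
    0 ≤ deriv (deriv (logProfile i g)) u - deriv (logProfile i g) u := by
  set h := logProfile i g
  set e : Rd d := EuclideanSpace.single i (1 : ℝ)
  have he : e ≠ 0 := by simp [e]
  have hsm : ContDiff ℝ ∞ h := contDiff_logProfile hg.smooth i
  have hd1 : ∀ y, HasDerivAt h (deriv h y) y := fun y =>
    (hsm.differentiable (by simp) y).hasDerivAt
  have hd2 : ∀ y, HasDerivAt (deriv h) (deriv (deriv h) y) y := fun y =>
    ((contDiff_infty_iff_deriv.1 hsm).2.differentiable (by simp) y).hasDerivAt
  have hconv : ConvexOn ℝ (Ioi 0) (fun ρ => h (Real.log ρ)) := by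
    refine (hg.convex e he).congr fun ρ hρ => ?_
    have hρ' : (0 : ℝ) < ρ := hρ
    simp only [h, logProfile, Real.exp_log hρ']
    rw [Real.rpow_def_of_pos hρ', mul_comm (Real.log ρ)]
  have hder : ∀ ρ : ℝ, 0 < ρ → HasDerivAt (fun ρ => h (Real.log ρ))
      (deriv h (Real.log ρ) * ρ⁻¹) ρ := fun ρ hρ =>
    (hd1 _).comp ρ (Real.hasDerivAt_log hρ.ne')
  have hmono := hconv.monotoneOn_deriv fun ρ hρ => (hder ρ hρ).differentiableAt
  have hmono' : Monotone fun y => deriv h y * Real.exp (-y) := by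
    intro y z hyz
    have := hmono (Real.exp_pos y) (Real.exp_pos z) (Real.exp_le_exp.2 hyz)
    rw [(hder _ (Real.exp_pos y)).deriv, (hder _ (Real.exp_pos z)).deriv, Real.log_exp,
      Real.log_exp, ← Real.exp_neg, ← Real.exp_neg] at this
    exact this
  have h3 := hmono'.deriv_nonneg (x := u)
  have h4 : HasDerivAt (fun y => deriv h y * Real.exp (-y))
      (deriv (deriv h) u * Real.exp (-u) + deriv h u * (Real.exp (-u) * -1)) u :=
    (hd2 u).mul ((hasDerivAt_neg u).exp)
  rw [h4.deriv] at h3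
  have h5 : (deriv (deriv h) u - deriv h u) * Real.exp (-u) ≥ 0 := by linarith
  exact nonneg_of_mul_nonneg_left h5 (Real.exp_pos _)

end Radial

/-! ### Radial envelopes and their integrability -/

/-- The radial weight `|z|^{-k} twoExp a b (log |z|)`. -/
noncomputable def envelope {d : ℕ} (a b : ℝ) (k : ℕ) (z : Rd d) : ℝ :=
  ‖z‖⁻¹ ^ k * twoExp a b (Real.log ‖z‖)

section Envelope

variable {d : ℕ} {a b : ℝ}

lemma envelope_nonneg (k : ℕ) (z : Rd d) : 0 ≤ envelope a b k z :=
  mul_nonneg (by positivity) (twoExp_pos _ _ _).le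

lemma envelope_succ (k : ℕ) (z : Rd d) :
    envelope a b (k + 1) z = ‖z‖⁻¹ * envelope a b k z := by
  rw [envelope, envelope, pow_succ]; ring

lemma twoExp_log_of_le_one {ρ : ℝ} (hρ : 0 < ρ) (h : ρ ≤ 1) : twoExp a b (Real.log ρ) = ρ ^ a := by
  rw [twoExp_of_nonpos (Real.log_nonpos hρ.le h), Real.rpow_def_of_pos hρ, mul_comm]

lemma twoExp_log_of_one_le {ρ : ℝ} (h : 1 ≤ ρ) : twoExp a b (Real.log ρ) = ρ ^ b := by
  rw [twoExp_of_nonneg (Real.log_nonneg h), Real.rpow_def_of_pos (by linarith), mul_comm]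

lemma nontrivial_Rd (d : ℕ) [NeZero d] : Nontrivial (Rd d) := by
  apply Module.nontrivial_of_finrank_pos (R := ℝ); simp [NeZero.pos d]

lemma measurable_envelope (k : ℕ) : Measurable (envelope (d := d) a b k) := by
  unfold envelope
  exact (by fun_prop : Measurable fun z : Rd d => ‖z‖⁻¹ ^ k).mul
    ((measurable_twoExp a b).comp (by fun_prop))

lemma integrableOn_envelope_ball [NeZero d] (ha : -1 < a) (hb : b ≤ 0) (r : ℝ) :
    IntegrableOn (envelope (d := d) a b (d - 1)) (Metric.ball 0 r) := by
  have := nontrivial_Rd d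
  rcases le_or_gt r 0 with hr | hr
  · simp [Metric.ball_eq_empty.2 hr]
  refine (integrableOn_fun_norm_addHaar (volume : Measure (Rd d))
    (f := fun ρ => ρ⁻¹ ^ (d - 1) * twoExp a b (Real.log ρ))).2 ?_
  rw [finrank_euclideanSpace_fin]
  have h1 : IntegrableOn (fun ρ : ℝ => ρ ^ a + 1) (Ioo 0 r) := by
    refine Integrable.add ?_ ?_
    · exact (intervalIntegral.integrableOn_Ioo_rpow_iff hr).2 ha
    · exact continuous_const.integrableOn_Icc.mono_set Ioo_subset_Icc_self
  refine Integrable.mono' h1 ?_ ?_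
  · have m1 : Measurable fun ρ : ℝ => twoExp a b (Real.log ρ) :=
      (measurable_twoExp a b).comp Real.measurable_log
    exact Measurable.aestronglyMeasurable (by fun_prop)
  · filter_upwards [ae_restrict_mem measurableSet_Ioo] with ρ hρ
    have hρ0 : ρ ^ (d - 1) ≠ 0 := pow_ne_zero _ hρ.1.ne'
    rw [smul_eq_mul, ← mul_assoc, inv_pow, mul_inv_cancel₀ hρ0, one_mul,
      Real.norm_of_nonneg (twoExp_pos _ _ _).le]
    have h3 : 0 ≤ ρ ^ a := Real.rpow_nonneg hρ.1.le a
    rcases le_total ρ 1 with h | h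
    · rw [twoExp_log_of_le_one hρ.1 h]; linarith
    · rw [twoExp_log_of_one_le h]
      linarith [Real.rpow_le_one_of_one_le_of_nonpos h hb]

lemma integrableOn_envelope_compl [NeZero d] (hb : b < 0) :
    IntegrableOn (envelope (d := d) a b d) (Metric.ball 0 1)ᶜ := by
  have := nontrivial_Rd d
  rw [← integrable_indicator_iff measurableSet_ball.compl]
  have h := (integrable_fun_norm_addHaar (volume : Measure (Rd d))
    (f := (Ici 1).indicator fun ρ => ρ⁻¹ ^ d * twoExp a b (Real.log ρ))).2 ?_
  · refine h.congr (Filter.Eventually.of_forall fun z => ?_)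
    by_cases hz : z ∈ (Metric.ball (0 : Rd d) 1)ᶜ
    · have : ‖z‖ ∈ Ici (1 : ℝ) := by simpa using hz
      simp only [indicator_of_mem this, indicator_of_mem hz, envelope]
    · have : ‖z‖ ∉ Ici (1 : ℝ) := by simpa using hz
      simp only [indicator_of_notMem this, indicator_of_notMem hz]
  · rw [finrank_euclideanSpace_fin]
    have h1 : IntegrableOn (fun ρ : ℝ => ρ ^ (b - 1)) (Ioi (1 / 2)) :=
      integrableOn_Ioi_rpow_of_lt (by linarith) (by norm_num)
    have h2 : Integrable ((Ici 1).indicator fun ρ : ℝ => ρ ^ (b - 1)) :=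
      (integrable_indicator_iff measurableSet_Ici).2
        (h1.mono_set fun ρ hρ => lt_of_lt_of_le (by norm_num) (mem_Ici.1 hρ))
    refine h2.integrableOn.congr_fun (fun ρ hρ => ?_) measurableSet_Ioi
    by_cases h : ρ ∈ Ici (1 : ℝ)
    · have hρ' : (0 : ℝ) < ρ := hρ
      obtain ⟨m, rfl⟩ : ∃ m, d = m + 1 := ⟨d - 1, by have := NeZero.pos d; omega⟩
      simp only [indicator_of_mem h, smul_eq_mul, Nat.add_sub_cancel]
      rw [twoExp_log_of_one_le h, pow_succ, inv_pow, Real.rpow_sub_one hρ'.ne']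
      field_simp
    · simp only [indicator_of_notMem h, smul_zero]

lemma integrableOn_inv_norm_pow_compl [NeZero d] {m : ℕ} (hm : d < m) :
    IntegrableOn (fun z : Rd d => ‖z‖⁻¹ ^ m) (Metric.ball 0 1)ᶜ := by
  refine (integrableOn_envelope_compl (d := d) (a := 0) (b := (d : ℝ) - m)
    (by have : (d : ℝ) < m := by exact_mod_cast hm
        linarith)).congr_fun (fun z hz => ?_) measurableSet_ball.compl
  have h1 : 1 ≤ ‖z‖ := by simpa using hz
  have h0 : 0 < ‖z‖ := by linarith
  simp only [envelope]
  rw [twoExp_log_of_one_le h1, Real.rpow_sub h0, Real.rpow_natCast, Real.rpow_natCast, inv_pow,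
    inv_pow]
  field_simp

end Envelope

/-! ### Bounds on the kernel and its gradient -/

/-- Writing the Riesz map as a continuous ℝ-linear map lets the gradient pass through integrals. -/
lemma gradient_eq_dualVector {d : ℕ} (f : Rd d → ℝ) (x : Rd d) :
    gradient f x = dualVector d (fderiv ℝ f x) := by
  refine ext_inner_right ℝ fun w => ?_
  rw [inner_dualVector, gradient, InnerProductSpace.toDual_symm_apply]

lemma norm_gradient_eq {d : ℕ} (f : Rd d → ℝ) (x : Rd d) : ‖gradient f x‖ = ‖fderiv ℝ f x‖ := by
  rw [gradient, LinearIsometryEquiv.norm_map]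

/-- A kernel smooth off the origin, singular of order less than `d` at the origin and with
integrable gradient at infinity. -/
structure IsRadialKernelBound {d : ℕ} (a b C : ℝ) (g : Rd d → ℝ) : Prop where
  smooth : ContDiffOn ℝ ∞ g {0}ᶜ
  bound : ∀ z, z ≠ 0 → |g z| ≤ C * envelope a b (d - 1) z
  fderiv_bound : ∀ z, z ≠ 0 → ‖fderiv ℝ g z‖ ≤ C * envelope a b d z

/-- Off the origin g is |z|^{-(d-1)} h(log|z|). A derivative falls on the power or on h, and either
way costs 1/|z|, while h' has the same weight as h. -/
lemma exists_isRadialKernelBound {d : ℕ} (hd : 1 ≤ d) {g : Rd d → ℝ} (hg : PositivityAssumption g)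
    (i : Fin d) {a b : ℝ} (hs : IsTwoExpSymbol a b (logProfile i g)) :
    ∃ C, 0 ≤ C ∧ IsRadialKernelBound a b C g := by
  set h := logProfile i g with hdef
  obtain ⟨C₀, hC₀, h0⟩ := hs.exists_bound
  obtain ⟨C₁, hC₁, h1⟩ := hs.deriv.exists_bound
  have hsm : ContDiff ℝ ∞ h := hs.1
  have hexp : ∀ z : Rd d, z ≠ 0 → Real.exp (-((d : ℝ) - 1) * Real.log ‖z‖) = ‖z‖⁻¹ ^ (d - 1) := by
    intro z hz
    have hz' := norm_pos_iff.2 hz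
    rw [mul_comm, ← Real.rpow_def_of_pos hz', Real.rpow_neg hz'.le, inv_pow, ← Real.rpow_natCast,
      Nat.cast_sub hd, Nat.cast_one]
  have hopen : IsOpen ({0}ᶜ : Set (Rd d)) := isOpen_compl_singleton
  have hd1 : (1 : ℝ) ≤ d := by exact_mod_cast hd
  refine ⟨d * C₀ + C₁, by positivity, hg.smooth, fun z hz => ?_, fun z hz => ?_⟩
  · rw [eq_logProfile hg.radial i hz, hexp z hz, abs_mul, abs_of_nonneg (by positivity), envelope]
    have := h0 (Real.log ‖z‖)
    have hT := twoExp_pos a b (Real.log ‖z‖)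
    calc _ ≤ ‖z‖⁻¹ ^ (d - 1) * (C₀ * twoExp a b (Real.log ‖z‖)) := by gcongr
      _ ≤ ‖z‖⁻¹ ^ (d - 1) * ((d * C₀ + C₁) * twoExp a b (Real.log ‖z‖)) := by
        gcongr; nlinarith
      _ = _ := by ring
  · have hz' := norm_pos_iff.2 hz
    set γ : ℝ → ℝ := fun y => Real.exp (-((d : ℝ) - 1) * y) * h y
    have e : g =ᶠ[nhds z] fun z => γ (Real.log ‖z‖) := by
      filter_upwards [hopen.mem_nhds hz] with w hw using eq_logProfile hg.radial i hw
    have hγ : HasDerivAt γ (Real.exp (-((d : ℝ) - 1) * Real.log ‖z‖) *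
        (-((d : ℝ) - 1) * h (Real.log ‖z‖) + deriv h (Real.log ‖z‖))) (Real.log ‖z‖) := by
      have a1 : HasDerivAt (fun y : ℝ => -((d : ℝ) - 1) * y) (-((d : ℝ) - 1)) (Real.log ‖z‖) := by
        simpa using (hasDerivAt_id (Real.log ‖z‖)).const_mul (-((d : ℝ) - 1))
      refine (a1.exp.mul ((hsm.differentiable (by simp) _).hasDerivAt)).congr_deriv ?_
      ring
    have hlog : HasDerivAt (fun ρ => γ (Real.log ρ)) _ ‖z‖ :=
      hγ.comp ‖z‖ (Real.hasDerivAt_log hz'.ne')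
    have hn : HasFDerivAt (fun z : Rd d => ‖z‖) (fderiv ℝ (fun z : Rd d => ‖z‖) z) z :=
      ((contDiffAt_norm ℝ (n := 1) hz).differentiableAt (by simp)).hasFDerivAt
    have hn1 : ‖fderiv ℝ (fun z : Rd d => ‖z‖) z‖ ≤ 1 := by
      simpa using norm_fderiv_le_of_lipschitz ℝ (lipschitzWith_one_norm (E := Rd d)) (x₀ := z)
    have hcomp := hlog.comp_hasFDerivAt z hn
    have e2 : fderiv ℝ g z = _ := e.fderiv_eq.trans hcomp.fderiv
    rw [e2, norm_smul, hexp z hz]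
    have b0 := h0 (Real.log ‖z‖)
    have b1 := h1 (Real.log ‖z‖)
    have hT := twoExp_pos a b (Real.log ‖z‖)
    have b2 : |-((d : ℝ) - 1) * h (Real.log ‖z‖) + deriv h (Real.log ‖z‖)| ≤
        (d * C₀ + C₁) * twoExp a b (Real.log ‖z‖) := by
      refine (abs_add_le _ _).trans ?_
      rw [abs_mul, abs_neg, abs_of_nonneg (by linarith : 0 ≤ (d : ℝ) - 1)]
      have : ((d : ℝ) - 1) * |h (Real.log ‖z‖)| ≤ d * (C₀ * twoExp a b (Real.log ‖z‖)) :=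
        mul_le_mul (by linarith) b0 (abs_nonneg _) (by positivity)
      nlinarith
    rw [norm_mul, norm_mul, Real.norm_of_nonneg (by positivity : 0 ≤ ‖z‖⁻¹ ^ (d - 1)),
      Real.norm_eq_abs, Real.norm_of_nonneg (inv_nonneg.2 hz'.le)]
    have e3 : envelope a b d z = ‖z‖⁻¹ ^ (d - 1) * twoExp a b (Real.log ‖z‖) * ‖z‖⁻¹ := by
      obtain ⟨m, rfl⟩ : ∃ m, d = m + 1 := ⟨d - 1, by omega⟩
      rw [envelope, Nat.add_sub_cancel, pow_succ]; ring
    rw [e3]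
    calc _ ≤ ‖z‖⁻¹ ^ (d - 1) * ((d * C₀ + C₁) * twoExp a b (Real.log ‖z‖)) * ‖z‖⁻¹ * 1 := by
          gcongr
      _ = _ := by ring

section KernelBound

variable {d : ℕ} {a b C : ℝ} {g : Rd d → ℝ}

lemma ae_ne_zero [NeZero d] : ∀ᵐ z : Rd d, z ≠ 0 := by
  have := nontrivial_Rd d
  exact measure_eq_zero_iff_ae_notMem.1 (measure_singleton (0 : Rd d))

lemma aestronglyMeasurable_of_continuousOn [NeZero d] {F : Type*} [NormedAddCommGroup F]
    {f : Rd d → F} (hf : ContinuousOn f {0}ᶜ) : AEStronglyMeasurable f := by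
  have := nontrivial_Rd d
  have h := hf.aestronglyMeasurable (μ := volume) (measurableSet_singleton (0 : Rd d)).compl
  rwa [restrict_compl_singleton] at h

lemma norm_mul_envelope (hd : 1 ≤ d) {z : Rd d} (hz : z ≠ 0) :
    ‖z‖ * envelope a b d z = envelope a b (d - 1) z := by
  obtain ⟨m, rfl⟩ : ∃ m, d = m + 1 := ⟨d - 1, by omega⟩
  have := norm_ne_zero_iff.2 hz
  rw [envelope_succ, ← mul_assoc, mul_inv_cancel₀ this, one_mul, Nat.add_sub_cancel]

lemma IsRadialKernelBound.gradientCondition [NeZero d] (hg : IsRadialKernelBound a b C g)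
    (ha : -1 < a) (hb : b < 0) : GradientCondition g := by
  have hd : 1 ≤ d := NeZero.pos d
  constructor
  · refine Integrable.mono' ((integrableOn_envelope_ball ha hb.le 1).const_mul C) ?_ ?_
    · simp only [norm_gradient_eq]
      exact ((measurable_norm.mul (measurable_fderiv ℝ g).norm)).aestronglyMeasurable
    · filter_upwards [ae_restrict_of_ae ae_ne_zero] with z hz
      rw [norm_mul, norm_norm, norm_norm, norm_gradient_eq, ← norm_mul_envelope hd hz,
        mul_left_comm]
      exact mul_le_mul_of_nonneg_left (hg.fderiv_bound z hz) (norm_nonneg _)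
  · refine Integrable.mono' ((integrableOn_envelope_compl (a := a) hb).const_mul C) ?_ ?_
    · simp only [norm_gradient_eq]
      exact (measurable_fderiv ℝ g).norm.aestronglyMeasurable
    · filter_upwards [ae_restrict_of_ae ae_ne_zero] with z hz
      rw [norm_norm, norm_gradient_eq]
      exact hg.fderiv_bound z hz

end KernelBound

/-! ### Cutoffs away from the origin and infinity -/

section Cutoff

variable {d : ℕ}

/-- A smooth cutoff, equal to `1` on the annulus `2/(n+1) ≤ |z| ≤ n+1`. -/
noncomputable def annulusCut (d n : ℕ) (z : Rd d) : ℝ :=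
  unitBump d (((n : ℝ) + 1)⁻¹ • z) * (1 - unitBump d (((n : ℝ) + 1) • z))

lemma contDiff_annulusCut (n : ℕ) : ContDiff ℝ ∞ (annulusCut d n) :=
  ((unitBump d).contDiff.comp (contDiff_const_smul _)).mul
    (contDiff_const.sub ((unitBump d).contDiff.comp (contDiff_const_smul _)))

lemma abs_annulusCut_le_one (n : ℕ) (z : Rd d) : |annulusCut d n z| ≤ 1 := by
  rw [annulusCut, abs_mul]
  have h1 := (unitBump d).nonneg (x := ((n : ℝ) + 1)⁻¹ • z)
  have h2 := (unitBump d).nonneg (x := ((n : ℝ) + 1) • z)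
  have h3 := (unitBump d).le_one (x := ((n : ℝ) + 1)⁻¹ • z)
  have h4 := (unitBump d).le_one (x := ((n : ℝ) + 1) • z)
  exact mul_le_one₀ (abs_le.2 ⟨by linarith, h3⟩) (abs_nonneg _)
    (abs_le.2 ⟨by linarith, by linarith⟩)

lemma annulusCut_eventuallyEq {z : Rd d} (hz : z ≠ 0) :
    ∀ᶠ n : ℕ in Filter.atTop, annulusCut d n =ᶠ[nhds z] fun _ => 1 := by
  have hz' := norm_pos_iff.2 hz
  obtain ⟨N, hN⟩ := exists_nat_gt (max (2 * ‖z‖) (4 / ‖z‖))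
  filter_upwards [Filter.eventually_ge_atTop N] with n hn
  have hNn : (N : ℝ) ≤ n := by exact_mod_cast hn
  have h1 : 2 * ‖z‖ < n + 1 := by linarith [(le_max_left (2 * ‖z‖) (4 / ‖z‖)).trans_lt hN]
  have h2 : 4 / ‖z‖ < n + 1 := by linarith [(le_max_right (2 * ‖z‖) (4 / ‖z‖)).trans_lt hN]
  have hn0 : (0 : ℝ) < n + 1 := by positivity
  filter_upwards [Metric.ball_mem_nhds z (half_pos hz')] with y hy
  have hd : ‖y - z‖ < ‖z‖ / 2 := by simpa [dist_eq_norm] using hy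
  have h3 : ‖z‖ / 2 ≤ ‖y‖ := by
    have := norm_sub_norm_le z y
    rw [norm_sub_rev] at this; linarith
  have h4 : ‖y‖ ≤ 2 * ‖z‖ := by
    have := norm_sub_norm_le y z; linarith
  rw [annulusCut, unitBump_eq_one, unitBump_eq_zero]
  · simp
  · rw [norm_smul, Real.norm_of_nonneg hn0.le]
    rw [div_lt_iff₀ hz'] at h2
    nlinarith
  · rw [norm_smul, Real.norm_of_nonneg (by positivity), inv_mul_le_iff₀ hn0]
    linarith

lemma annulusCut_eq_zero_of_norm_le {n : ℕ} {z : Rd d} (hz : ‖z‖ ≤ ((n : ℝ) + 1)⁻¹) :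
    annulusCut d n z = 0 := by
  have hn0 : (0 : ℝ) < n + 1 := by positivity
  rw [annulusCut, unitBump_eq_one (x := ((n : ℝ) + 1) • z), sub_self, mul_zero]
  rw [norm_smul, Real.norm_of_nonneg hn0.le]
  calc _ ≤ ((n : ℝ) + 1) * ((n : ℝ) + 1)⁻¹ := by gcongr
    _ = 1 := mul_inv_cancel₀ hn0.ne'

lemma annulusCut_eq_zero_of_le_norm {n : ℕ} {z : Rd d} (hz : 2 * ((n : ℝ) + 1) ≤ ‖z‖) :
    annulusCut d n z = 0 := by
  have hn0 : (0 : ℝ) < n + 1 := by positivity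
  rw [annulusCut, unitBump_eq_zero (x := ((n : ℝ) + 1)⁻¹ • z), zero_mul]
  rw [norm_smul, Real.norm_of_nonneg (by positivity), inv_mul_eq_div, le_div_iff₀ hn0]
  exact hz

/-- The quantity |y||∇χ(y)| is bounded and |z||∇| is scale invariant, so M does not depend on n. -/
lemma exists_norm_fderiv_annulusCut_le :
    ∃ M, 0 ≤ M ∧ ∀ (n : ℕ) (z : Rd d), z ≠ 0 → ‖fderiv ℝ (annulusCut d n) z‖ ≤ M * ‖z‖⁻¹ := by
  have hφ : ContDiff ℝ ∞ (unitBump d) := (unitBump d).contDiff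
  have hcs : HasCompactSupport fun y : Rd d => ‖y‖ * ‖fderiv ℝ (unitBump d) y‖ :=
    ((unitBump d).hasCompactSupport.fderiv ℝ).norm.mul_left
  obtain ⟨M, hM⟩ := hcs.exists_bound_of_continuous
    (continuous_norm.mul (hφ.continuous_fderiv (by simp)).norm)
  have hM0 : 0 ≤ M := (norm_nonneg _).trans (hM 0)
  have hscale : ∀ (c : ℝ) (z : Rd d), 0 < c → z ≠ 0 →
      ‖fderiv ℝ (fun z => unitBump d (c • z)) z‖ ≤ M * ‖z‖⁻¹ := by
    intro c z hc hz
    have hz' := norm_pos_iff.2 hz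
    rw [fderiv_comp_smul, norm_smul, Real.norm_of_nonneg hc.le]
    have := hM (c • z)
    rw [norm_mul, norm_norm, norm_norm, norm_smul, Real.norm_of_nonneg hc.le] at this
    rw [← div_eq_mul_inv, le_div_iff₀ hz']
    calc _ = c * ‖z‖ * ‖fderiv ℝ (unitBump d) (c • z)‖ := by ring
      _ ≤ M := this
  refine ⟨2 * M, by positivity, fun n z hz => ?_⟩
  have hn0 : (0 : ℝ) < n + 1 := by positivity
  set A : Rd d → ℝ := fun z => unitBump d (((n : ℝ) + 1)⁻¹ • z)
  set B : Rd d → ℝ := fun z => unitBump d (((n : ℝ) + 1) • z)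
  have hA : DifferentiableAt ℝ A z :=
    (hφ.comp (contDiff_const_smul _)).differentiable (by simp) z
  have hB : DifferentiableAt ℝ B z :=
    (hφ.comp (contDiff_const_smul _)).differentiable (by simp) z
  have e : fderiv ℝ (annulusCut d n) z = A z • fderiv ℝ (fun z => 1 - B z) z +
      (1 - B z) • fderiv ℝ A z := fderiv_mul hA (hB.const_sub 1)
  rw [e, fderiv_const_sub]
  refine (norm_add_le _ _).trans ?_
  rw [norm_smul, norm_smul, norm_neg]
  have a1 : ‖A z‖ ≤ 1 := by
    rw [Real.norm_of_nonneg (unitBump d).nonneg]; exact (unitBump d).le_one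
  have a2 : ‖1 - B z‖ ≤ 1 := by
    have h1 : 0 ≤ B z := (unitBump d).nonneg
    have h2 : B z ≤ 1 := (unitBump d).le_one
    rw [Real.norm_of_nonneg (by linarith)]; linarith
  have b1 := hscale _ z (inv_pos.2 hn0) hz
  have b2 := hscale _ z hn0 hz
  have : 0 ≤ M * ‖z‖⁻¹ := by positivity
  calc _ ≤ 1 * (M * ‖z‖⁻¹) + 1 * (M * ‖z‖⁻¹) := by gcongr
    _ = _ := by ring

end Cutoff

/-! ### The fractional gradient as a convolution -/

section IntegrationByParts

variable {d : ℕ} {a b C : ℝ} {g : Rd d → ℝ}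

lemma integral_fderiv_eq_zero {P : Rd d → ℝ} (hP : ContDiff ℝ ∞ P) (hc : HasCompactSupport P) :
    ∫ z, fderiv ℝ P z = 0 := by
  have hcont : Continuous (fderiv ℝ P) := hP.continuous_fderiv (by simp)
  have hint : Integrable (fderiv ℝ P) := hcont.integrable_of_hasCompactSupport (hc.fderiv ℝ)
  ext v
  rw [ContinuousLinearMap.integral_apply hint, zero_apply]
  have h := integral_mul_fderiv_eq_neg_fderiv_mul_of_integrable (μ := volume)
    (f := fun _ : Rd d => (1 : ℝ)) (g := P) (v := v) (by simp)
    (by simpa using hint.apply_continuousLinearMap v)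
    (by simpa using hP.continuous.integrable_of_hasCompactSupport hc)
    (by simp) (fun x _ => hP.differentiable (by simp) x)
  simpa using h

lemma IsRadialKernelBound.aestronglyMeasurable [NeZero d] (hg : IsRadialKernelBound a b C g) :
    AEStronglyMeasurable g :=
  aestronglyMeasurable_of_continuousOn hg.smooth.continuousOn

lemma IsRadialKernelBound.integrable_smul [NeZero d] (hg : IsRadialKernelBound a b C g)
    (ha : -1 < a) (hb : b ≤ 0) {F : Type*} [NormedAddCommGroup F] [NormedSpace ℝ F]
    {v : Rd d → F} (hv : Continuous v) (hc : HasCompactSupport v) :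
    Integrable fun z => g z • v z := by
  obtain ⟨B, hB⟩ := hc.exists_bound_of_continuous hv
  obtain ⟨r, hr⟩ := hc.isCompact.isBounded.subset_ball (0 : Rd d)
  have h1 : IntegrableOn (fun z => g z • v z) (Metric.ball 0 r) := by
    refine Integrable.mono' (((integrableOn_envelope_ball ha hb r).const_mul C).mul_const B)
      (hg.aestronglyMeasurable.smul hv.aestronglyMeasurable).restrict ?_
    filter_upwards [ae_restrict_of_ae ae_ne_zero] with z hz
    rw [norm_smul]
    exact mul_le_mul (hg.bound z hz) (hB z) (norm_nonneg _)
      ((abs_nonneg _).trans (hg.bound z hz))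
  refine (integrableOn_iff_integrable_of_support_subset fun z hz => ?_).1 h1
  refine hr (subset_tsupport _ fun h => hz ?_)
  simp [h]

/-- Vanishing of w to first order tames the singularity at the origin; boundedness of w suffices for
the tail. -/
lemma IsRadialKernelBound.integrable_smul_fderiv [NeZero d] (hg : IsRadialKernelBound a b C g)
    (ha : -1 < a) (hb : b < 0) {w : Rd d → ℝ} (hw : Continuous w) {L B : ℝ}
    (hL : ∀ z, |w z| ≤ L * ‖z‖) (hB : ∀ z, |w z| ≤ B) :
    Integrable fun z => |w z| * (C * envelope a b d z) := by
  have hd : 1 ≤ d := NeZero.pos d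
  have hm : AEStronglyMeasurable (fun z => |w z| * (C * envelope a b d z)) :=
    (hw.abs.measurable.mul ((measurable_envelope d).const_mul C)).aestronglyMeasurable
  have hpos : ∀ z, z ≠ 0 → 0 ≤ C * envelope a b d z := fun z hz =>
    (norm_nonneg _).trans (hg.fderiv_bound z hz)
  rw [← integrableOn_univ, ← union_compl_self (Metric.ball (0 : Rd d) 1)]
  refine IntegrableOn.union ?_ ?_
  · refine Integrable.mono' ((integrableOn_envelope_ball ha hb.le 1).const_mul (L * C))
      hm.restrict ?_
    filter_upwards [ae_restrict_of_ae ae_ne_zero] with z hz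
    rw [Real.norm_of_nonneg (mul_nonneg (abs_nonneg _) (hpos z hz)), ← norm_mul_envelope hd hz]
    calc _ ≤ L * ‖z‖ * (C * envelope a b d z) :=
          mul_le_mul_of_nonneg_right (hL z) (hpos z hz)
      _ = _ := by ring
  · refine Integrable.mono' ((integrableOn_envelope_compl (a := a) hb).const_mul (B * C))
      hm.restrict ?_
    filter_upwards [ae_restrict_of_ae ae_ne_zero] with z hz
    rw [Real.norm_of_nonneg (mul_nonneg (abs_nonneg _) (hpos z hz)), mul_assoc]
    exact mul_le_mul_of_nonneg_right (hB z) (hpos z hz)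

lemma IsRadialKernelBound.contDiff_annulusCut_mul (hg : IsRadialKernelBound a b C g)
    {w : Rd d → ℝ} (hw : ContDiff ℝ ∞ w) (n : ℕ) :
    ContDiff ℝ ∞ fun z => annulusCut d n z * (w z * g z) := by
  rw [contDiff_iff_contDiffAt]
  intro z
  by_cases hz : z = 0
  · subst hz
    refine (contDiffAt_const (c := (0 : ℝ))).congr_of_eventuallyEq ?_
    filter_upwards [Metric.ball_mem_nhds (0 : Rd d)
      (by positivity : 0 < ((n : ℝ) + 1)⁻¹)] with y hy
    rw [annulusCut_eq_zero_of_norm_le (by simpa using (mem_ball_zero_iff.1 hy).le), zero_mul]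
  · exact (contDiff_annulusCut n).contDiffAt.mul (hw.contDiffAt.mul
      (hg.smooth.contDiffAt (isOpen_compl_singleton.mem_nhds hz)))

/-- The identity is exact for the cut-off product. The error w g ∇χ_n has the same envelope as w ∇g
because |∇χ_n| ≤ M/|z|, and at each z ≠ 0 it eventually vanishes, so dominated convergence removes
it. -/
lemma IsRadialKernelBound.integral_smul_fderiv_eq [NeZero d] (hg : IsRadialKernelBound a b C g)
    (ha : -1 < a) (hb : b < 0) {w : Rd d → ℝ} (hw : ContDiff ℝ ∞ w)
    (hc : HasCompactSupport (fderiv ℝ w)) {L B : ℝ}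
    (hL : ∀ z, |w z| ≤ L * ‖z‖) (hB : ∀ z, |w z| ≤ B) :
    ∫ z, w z • fderiv ℝ g z = -∫ z, g z • fderiv ℝ w z := by
  have hd : 1 ≤ d := NeZero.pos d
  have hdom := hg.integrable_smul_fderiv ha hb hw.continuous hL hB
  have hI2 := hg.integrable_smul ha hb.le (hw.continuous_fderiv (by simp)) hc
  have hI1 : Integrable fun z => w z • fderiv ℝ g z := by
    refine hdom.mono' (hw.continuous.aestronglyMeasurable.smul
      (measurable_fderiv ℝ g).aestronglyMeasurable) ?_
    filter_upwards [ae_ne_zero] with z hz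
    rw [norm_smul, Real.norm_eq_abs]
    exact mul_le_mul_of_nonneg_left (hg.fderiv_bound z hz) (abs_nonneg _)
  rw [eq_neg_iff_add_eq_zero, ← integral_add hI1 hI2]
  obtain ⟨M, hM0, hM⟩ := exists_norm_fderiv_annulusCut_le (d := d)
  set P : ℕ → Rd d → ℝ := fun n z => annulusCut d n z * (w z * g z)
  have hgd : ∀ z, z ≠ 0 → DifferentiableAt ℝ g z := fun z hz =>
    (hg.smooth.contDiffAt (isOpen_compl_singleton.mem_nhds hz)).differentiableAt (by simp)
  have hwd : Differentiable ℝ w := hw.differentiable (by simp)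
  have hP : ∀ n z, z ≠ 0 → fderiv ℝ (P n) z =
      annulusCut d n z • (w z • fderiv ℝ g z + g z • fderiv ℝ w z) +
        (w z * g z) • fderiv ℝ (annulusCut d n) z := by
    intro n z hz
    have := fderiv_mul ((contDiff_annulusCut n).differentiable (by simp) z)
      ((hwd z).mul (hgd z hz))
    exact this.trans (by rw [← fderiv_mul (hwd z) (hgd z hz)]; rfl)
  have hlim := tendsto_integral_of_dominated_convergence (μ := volume)
    (F := fun n z => fderiv ℝ (P n) z)
    (f := fun z => w z • fderiv ℝ g z + g z • fderiv ℝ w z)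
    (fun z => (1 + M) * (|w z| * (C * envelope a b d z)) + ‖g z • fderiv ℝ w z‖)
    (fun n => (measurable_fderiv ℝ (P n)).aestronglyMeasurable)
    ((hdom.const_mul _).add hI2.norm) (fun n => ?_) ?_
  · refine tendsto_nhds_unique hlim ?_
    have : ∀ n, ∫ z, fderiv ℝ (P n) z = 0 := fun n =>
      integral_fderiv_eq_zero (hg.contDiff_annulusCut_mul hw n)
        (hasCompactSupport_of_eq_zero (r := 2 * ((n : ℝ) + 1)) fun z hz => by
          simp only [P, annulusCut_eq_zero_of_le_norm hz, zero_mul])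
    simp [this]
  · filter_upwards [ae_ne_zero] with z hz
    rw [hP n z hz]
    have h1 : ‖annulusCut d n z • (w z • fderiv ℝ g z + g z • fderiv ℝ w z)‖ ≤
        |w z| * (C * envelope a b d z) + ‖g z • fderiv ℝ w z‖ := by
      rw [norm_smul]
      refine (mul_le_of_le_one_left (norm_nonneg _) (abs_annulusCut_le_one n z)).trans ?_
      refine (norm_add_le _ _).trans (add_le_add ?_ le_rfl)
      rw [norm_smul]
      exact mul_le_mul_of_nonneg_left (hg.fderiv_bound z hz) (abs_nonneg _)
    have h2 : ‖(w z * g z) • fderiv ℝ (annulusCut d n) z‖ ≤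
        M * (|w z| * (C * envelope a b d z)) := by
      have e : C * envelope a b d z = C * envelope a b (d - 1) z * ‖z‖⁻¹ := by
        rw [← norm_mul_envelope hd hz]
        have := norm_ne_zero_iff.2 hz
        field_simp
      rw [norm_smul, norm_mul, Real.norm_eq_abs, Real.norm_eq_abs, e]
      have h3 := hg.bound z hz
      calc _ ≤ |w z| * (C * envelope a b (d - 1) z) * (M * ‖z‖⁻¹) := by
            gcongr
            · exact mul_nonneg (abs_nonneg _) ((abs_nonneg _).trans h3)
            · exact hM n z hz
        _ = _ := by ring
    calc _ ≤ _ := norm_add_le _ _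
      _ ≤ _ := add_le_add h1 h2
      _ = _ := by ring
  · filter_upwards [ae_ne_zero] with z hz
    refine tendsto_nhds_of_eventually_eq ?_
    filter_upwards [annulusCut_eventuallyEq hz] with n hn
    rw [hP n z hz, hn.fderiv_eq, hn.eq_of_nhds]
    simp

lemma IsTestFunction.hasCompactSupport_gradient {u : Rd d → ℝ} (hu : IsTestFunction u) :
    HasCompactSupport (gradient u) := by
  refine (hu.2.fderiv ℝ).mono' ?_
  refine fun x hx => subset_tsupport _ fun h => hx ?_
  rw [gradient_eq_dualVector, h, map_zero]

lemma IsTestFunction.continuous_gradient {u : Rd d → ℝ} (hu : IsTestFunction u) :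
    Continuous (gradient u) := by
  simp only [funext (gradient_eq_dualVector u)]
  exact (dualVector d).continuous.comp (hu.1.continuous_fderiv (by simp))

lemma HasCompactSupport.comp_const_sub {F : Type*} [Zero F] {v : Rd d → F}
    (hv : HasCompactSupport v) (x : Rd d) : HasCompactSupport fun z => v (x - z) :=
  hv.comp_homeomorph (Homeomorph.subLeft x)

/-- The fractional gradient is the convolution of the kernel with the gradient. -/
lemma IsRadialKernelBound.fractionalGradient_eq [NeZero d] (hg : IsRadialKernelBound a b C g)
    (ha : -1 < a) (hb : b < 0) {u : Rd d → ℝ} (hu : IsTestFunction u) (x : Rd d) :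
    fractionalGradient g u x = ∫ z, g z • gradient u (x - z) := by
  set w : Rd d → ℝ := fun z => u x - u (x - z) with hwdef
  have hw : ContDiff ℝ ∞ w := contDiff_const.sub (hu.1.comp (contDiff_const.sub contDiff_id))
  have hfd : ∀ z, fderiv ℝ w z = fderiv ℝ u (x - z) := by
    intro z
    have h1 : HasFDerivAt u (fderiv ℝ u (x - z)) (x - z) :=
      (hu.1.differentiable (by simp) _).hasFDerivAt
    have h2 : HasFDerivAt (fun z : Rd d => x - z) (-ContinuousLinearMap.id ℝ (Rd d)) z :=
      (hasFDerivAt_id z).const_sub x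
    have h3 := ((h1.comp z h2).const_sub (u x)).fderiv
    refine h3.trans ?_
    ext v; simp
  obtain ⟨B, hB⟩ := hu.2.exists_bound_of_continuous hu.1.continuous
  obtain ⟨L, hL⟩ := (hu.2.fderiv ℝ).exists_bound_of_continuous (hu.1.continuous_fderiv (by simp))
  have hLip : ∀ z, |w z| ≤ L * ‖z‖ := by
    intro z
    have := convex_univ.norm_image_sub_le_of_norm_fderiv_le (𝕜 := ℝ) (f := u) (C := L)
      (fun y _ => hu.1.differentiable (by simp) y) (fun y _ => hL y) (mem_univ (x - z))
      (mem_univ x)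
    simpa [hwdef] using this
  have hBd : ∀ z, |w z| ≤ B + B := fun z =>
    (abs_sub _ _).trans (add_le_add (hB _) (hB _))
  have hc : HasCompactSupport (fderiv ℝ w) := by
    rw [funext hfd]; exact (hu.2.fderiv ℝ).comp_const_sub x
  have key := hg.integral_smul_fderiv_eq ha hb hw hc hLip hBd
  have hdom := hg.integrable_smul_fderiv ha hb hw.continuous hLip hBd
  have hI1 : Integrable fun z => w z • fderiv ℝ g z := by
    refine hdom.mono' (hw.continuous.aestronglyMeasurable.smul
      (measurable_fderiv ℝ g).aestronglyMeasurable) ?_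
    filter_upwards [ae_ne_zero] with z hz
    rw [norm_smul, Real.norm_eq_abs]
    exact mul_le_mul_of_nonneg_left (hg.fderiv_bound z hz) (abs_nonneg _)
  have hI2 := hg.integrable_smul ha hb.le (hw.continuous_fderiv (by simp)) hc
  have e1 : ∫ y, (u x - u y) • gradient g (x - y) = ∫ z, w z • gradient g z := by
    rw [← integral_sub_left_eq_self (fun z => w z • gradient g z) volume x]
    simp [hwdef]
  rw [fractionalGradient, e1]
  simp only [gradient_eq_dualVector, ← map_smul, ← hfd]
  rw [ContinuousLinearMap.integral_comp_comm _ hI1, ContinuousLinearMap.integral_comp_comm _ hI2,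
    key, map_neg, neg_neg]

/-- Near the origin local integrability of g gives boundedness. Far away the support of v(x - ·)
lies in |z| ≥ |x|/2, where the size of g is at most that of |x|^{-(d-1)}. Applied to v = ∇u this is
the decay of 𝒢u. -/
lemma IsRadialKernelBound.exists_norm_integral_le [NeZero d] (hg : IsRadialKernelBound a b C g)
    (hC : 0 ≤ C) (ha : -1 < a) (hb : b ≤ 0) {F : Type*} [NormedAddCommGroup F] [NormedSpace ℝ F]
    {v : Rd d → F} (hv : Continuous v) (hc : HasCompactSupport v) :
    ∃ K, 0 ≤ K ∧ ∀ x, ‖∫ z, g z • v (x - z)‖ ≤ K ∧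
      (x ≠ 0 → ‖∫ z, g z • v (x - z)‖ ≤ K * ‖x‖⁻¹ ^ (d - 1)) := by
  obtain ⟨B, hB⟩ := hc.exists_bound_of_continuous hv
  have hB0 : 0 ≤ B := (norm_nonneg _).trans (hB 0)
  obtain ⟨r', hr'⟩ := hc.isCompact.isBounded.subset_ball (0 : Rd d)
  set r := max r' 0
  have hr0 : 0 ≤ r := le_max_right _ _
  have hr : ∀ y, v y ≠ 0 → ‖y‖ ≤ r := fun y hy =>
    (mem_ball_zero_iff.1 (hr' (subset_tsupport _ hy))).le.trans (le_max_left _ _)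
  -- The radius 3r + 3 exceeds (2r + 2) + r, so the ball contains every z with |x| ≤ 2r + 2 and |x -
  -- z| ≤ r.
  have henv := integrableOn_envelope_ball (d := d) ha hb (3 * r + 3)
  set K₁ := ∫ z in Metric.ball (0 : Rd d) (3 * r + 3), C * envelope a b (d - 1) z * B
  have hK₁ : 0 ≤ K₁ := integral_nonneg fun z =>
    mul_nonneg (mul_nonneg hC (envelope_nonneg _ _)) hB0
  set K₂ := C * 2 ^ (d - 1) * ∫ y, ‖v y‖
  have hK₂ : 0 ≤ K₂ := by positivity
  have near : ∀ x : Rd d, ‖x‖ ≤ 2 * r + 2 → ‖∫ z, g z • v (x - z)‖ ≤ K₁ := by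
    intro x hx
    have : K₁ = ∫ z, (Metric.ball (0 : Rd d) (3 * r + 3)).indicator
        (fun z => C * envelope a b (d - 1) z * B) z := (integral_indicator measurableSet_ball).symm
    rw [this]
    refine norm_integral_le_of_norm_le
      ((integrable_indicator_iff measurableSet_ball).2 ((henv.const_mul C).mul_const B)) ?_
    filter_upwards [ae_ne_zero] with z hz
    by_cases hvz : v (x - z) = 0
    · rw [hvz, smul_zero, norm_zero]
      exact indicator_nonneg (fun z _ => mul_nonneg (mul_nonneg hC (envelope_nonneg _ _)) hB0) z
    · have h1 := hr _ hvz
      have h2 : ‖z‖ ≤ ‖x‖ + ‖x - z‖ := by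
        have := norm_sub_le x (x - z); simpa using this
      rw [indicator_of_mem (by rw [mem_ball_zero_iff]; linarith), norm_smul]
      exact mul_le_mul (hg.bound z hz) (hB _) (norm_nonneg _)
        (mul_nonneg hC (envelope_nonneg _ _))
  have far : ∀ x : Rd d, 2 * r + 2 ≤ ‖x‖ →
      ‖∫ z, g z • v (x - z)‖ ≤ K₂ * ‖x‖⁻¹ ^ (d - 1) := by
    intro x hx
    have hx0 : 0 < ‖x‖ := by linarith
    have hI : Integrable fun z => ‖v (x - z)‖ :=
      (hv.norm.comp (continuous_const.sub continuous_id)).integrable_of_hasCompactSupport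
        (hc.comp_const_sub x).norm
    have : K₂ * ‖x‖⁻¹ ^ (d - 1) =
        ∫ z, C * 2 ^ (d - 1) * ‖x‖⁻¹ ^ (d - 1) * ‖v (x - z)‖ := by
      rw [integral_const_mul, integral_sub_left_eq_self (fun y => ‖v y‖) volume x]; ring
    rw [this]
    refine norm_integral_le_of_norm_le (hI.const_mul _) ?_
    filter_upwards [ae_ne_zero] with z hz
    by_cases hvz : v (x - z) = 0
    · simp [hvz]
    · have h1 := hr _ hvz
      have h2 : ‖x‖ ≤ ‖z‖ + ‖x - z‖ := by
        have := norm_add_le z (x - z); simpa using this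
      have h3 : ‖x‖ / 2 ≤ ‖z‖ := by linarith
      have h4 : 1 ≤ ‖z‖ := by linarith
      have h5 : ‖z‖⁻¹ ≤ 2 * ‖x‖⁻¹ := by
        rw [show 2 * ‖x‖⁻¹ = (‖x‖ / 2)⁻¹ by rw [inv_div]; rfl]
        exact inv_anti₀ (by linarith) h3
      rw [norm_smul]
      refine mul_le_mul_of_nonneg_right ((hg.bound z hz).trans ?_) (norm_nonneg _)
      rw [mul_assoc, ← mul_pow, envelope, twoExp_log_of_one_le h4]
      refine mul_le_mul_of_nonneg_left ?_ hC
      calc _ ≤ (2 * ‖x‖⁻¹) ^ (d - 1) * 1 := by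
            gcongr
            exact Real.rpow_le_one_of_one_le_of_nonpos h4 hb
        _ = _ := mul_one _
  refine ⟨K₁ * (2 * r + 2) ^ (d - 1) + K₁ + K₂, by positivity, fun x => ?_⟩
  rcases le_total ‖x‖ (2 * r + 2) with hx | hx
  · have h := near x hx
    have h0 : 0 ≤ K₁ * (2 * r + 2) ^ (d - 1) := by positivity
    refine ⟨by linarith, fun hx0 => h.trans ?_⟩
    have hx0' := norm_pos_iff.2 hx0
    have : 1 ≤ (2 * r + 2) ^ (d - 1) * ‖x‖⁻¹ ^ (d - 1) := by
      rw [← mul_pow]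
      refine one_le_pow₀ ?_
      rw [← div_eq_mul_inv, one_le_div hx0']; exact hx
    have h6 : 0 ≤ ‖x‖⁻¹ ^ (d - 1) := by positivity
    nlinarith
  · have h := far x hx
    have h0 : 0 ≤ K₁ * (2 * r + 2) ^ (d - 1) := by positivity
    have h6 : 0 ≤ ‖x‖⁻¹ ^ (d - 1) := by positivity
    have h7 : ‖x‖⁻¹ ^ (d - 1) ≤ 1 := pow_le_one₀ (by positivity)
      (inv_le_one_of_one_le₀ (by linarith))
    exact ⟨by nlinarith, fun _ => by nlinarith⟩

end IntegrationByParts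

/-! ### Fourier transforms of dilated cones -/

section FourierPairing

variable {d : ℕ}

lemma integrable_fourierChar_smul {H : Rd d → ℂ} (hH : Integrable H) (x : Rd d) :
    Integrable fun ξ => Real.fourierChar (inner ℝ ξ x) • H ξ := by
  have := (Real.fourierIntegral_convergent_iff (μ := volume) (f := H) (-x)).2 hH
  simpa using this

/-- Convolution with an inverse Fourier transform is multiplication on the Fourier side. -/
lemma integral_mul_fourierInv_sub {n H : Rd d → ℂ} (hn : Integrable n) (hH : Integrable H)
    (x : Rd d) : ∫ y, n y * 𝓕⁻ H (x - y) = 𝓕⁻ (fun ξ => 𝓕 n ξ * H ξ) x := by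
  have h := VectorFourier.integral_fourierIntegral_smul_eq_flip (L := innerₗ (Rd d))
    (μ := volume) (ν := volume) Real.continuous_fourierChar continuous_inner hn
    (integrable_fourierChar_smul hH x)
  rw [Real.fourierInv_eq]
  calc _ = ∫ y, n y • VectorFourier.fourierIntegral Real.fourierChar volume (innerₗ (Rd d)).flip
        (fun ξ => Real.fourierChar (inner ℝ ξ x) • H ξ) y := by
        congr 1 with y
        rw [smul_eq_mul, Real.fourierInv_eq, VectorFourier.fourierIntegral]
        congr 2 with ξ
        rw [smul_smul, ← AddChar.map_add_eq_mul]
        congr 2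
        simp [inner_sub_right]; ring
    _ = _ := h.symm
    _ = _ := by
        congr 1 with ξ
        simp only [smul_eq_mul, Circle.smul_def]
        rw [mul_left_comm]
        rfl

/-- The `L¹`-normalized dilation of `coneKernel` by the factor `e^u`. -/
noncomputable def coneDilation (u : ℝ) (z : Rd d) : ℝ :=
  Real.exp (-u * d) * coneKernel (Real.exp (-u) • z)

lemma coneDilation_nonneg (u : ℝ) (z : Rd d) : 0 ≤ coneDilation u z :=
  mul_nonneg (Real.exp_pos _).le (coneKernel_nonneg _)

lemma measurable_coneDilation :
    Measurable fun p : Rd d × ℝ => coneDilation p.2 p.1 := by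
  unfold coneDilation
  exact (by fun_prop : Measurable fun p : Rd d × ℝ => Real.exp (-p.2 * d)).mul
    (measurable_coneKernel.comp (by fun_prop))

lemma integrable_coneDilation [NeZero d] (u : ℝ) : Integrable (coneDilation (d := d) u) :=
  (integrable_coneKernel.comp_smul (Real.exp_pos _).ne').const_mul _

/-- The kernel is even, so the sine part integrates to zero and only the cosine transform remains.
-/
lemma fourier_coneKernel [NeZero d] (ξ : Rd d) :
    𝓕 (fun z : Rd d => (coneKernel z : ℂ)) ξ = coneSymbol ξ := by
  have hI : Integrable fun z : Rd d =>
      Complex.exp ((↑(-2 * Real.pi * inner ℝ z ξ) * Complex.I)) • (coneKernel z : ℂ) := by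
    have := (Real.fourierIntegral_convergent_iff (μ := volume) ξ).2
      ((integrable_coneKernel (d := d)).ofReal (𝕜 := ℂ))
    simpa [Circle.smul_def, Real.fourierChar_apply] using this
  rw [Real.fourier_eq']
  apply Complex.ext
  · rw [← Complex.reCLM_apply, ← ContinuousLinearMap.integral_comp_comm _ hI, Complex.ofReal_re,
      coneSymbol]
    congr 1 with z
    simp only [Complex.reCLM_apply, smul_eq_mul, Complex.re_mul_ofReal, Complex.exp_ofReal_mul_I_re]
    rw [mul_comm, neg_mul, neg_mul, Real.cos_neg]
  · rw [← Complex.imCLM_apply, ← ContinuousLinearMap.integral_comp_comm _ hI, Complex.ofReal_im]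
    simp only [Complex.imCLM_apply, smul_eq_mul, Complex.im_mul_ofReal, Complex.exp_ofReal_mul_I_im]
    have h := integral_neg_eq_self (μ := (volume : Measure (Rd d)))
      (fun z => Real.sin (-2 * Real.pi * inner ℝ z ξ) * coneKernel z)
    have e : ∀ z : Rd d, Real.sin (-2 * Real.pi * inner ℝ (-z) ξ) * coneKernel (-z) =
        -(Real.sin (-2 * Real.pi * inner ℝ z ξ) * coneKernel z) := by
      intro z
      rw [inner_neg_left, mul_neg, Real.sin_neg, coneKernel, coneKernel, norm_neg, neg_mul]
    simp only [e] at h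
    rw [integral_neg] at h
    linarith

lemma fourier_coneDilation [NeZero d] (u : ℝ) (ξ : Rd d) :
    𝓕 (fun z : Rd d => (coneDilation u z : ℂ)) ξ = coneSymbol (Real.exp u • ξ) := by
  rw [← fourier_coneKernel, Real.fourier_eq, Real.fourier_eq]
  have e : ∀ z : Rd d, Real.fourierChar (-inner ℝ z ξ) • (coneDilation u z : ℂ) =
      (fun w : Rd d => (Real.exp (-u * d) : ℂ) *
        (Real.fourierChar (-inner ℝ w (Real.exp u • ξ)) • (coneKernel w : ℂ)))
        (Real.exp (-u) • z) := by
    intro z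
    simp only [coneDilation, Complex.ofReal_mul]
    rw [mul_smul_comm, inner_smul_left, inner_smul_right]
    simp only [conj_trivial, ← mul_assoc]
    rw [← Real.exp_add, neg_add_cancel, Real.exp_zero, one_mul]
  simp only [e]
  rw [Measure.integral_comp_smul volume (fun w : Rd d => (Real.exp (-u * d) : ℂ) *
        (Real.fourierChar (-inner ℝ w (Real.exp u • ξ)) • (coneKernel w : ℂ))),
    integral_const_mul, finrank_euclideanSpace_fin, ← Real.exp_nat_mul, ← Real.exp_neg,
    abs_of_pos (Real.exp_pos _), Complex.real_smul, ← mul_assoc, ← Complex.ofReal_mul,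
    ← Real.exp_add, show -(d * -u) + -u * d = (0 : ℝ) by ring]
  simp

/-- The normalization e^{-ud} against |e^{-u}z|^{1-d} leaves a factor e^{-u}, which the e^u in
`coneDensity` compensates. -/
lemma coneDilation_eq [NeZero d] (u : ℝ) {z : Rd d} (hz : z ≠ 0) :
    coneDilation u z = Real.exp (-((d : ℝ) - 1) * Real.log ‖z‖) *
      (Real.exp (-u) * max (1 - Real.exp (Real.log ‖z‖ - u)) 0) := by
  have hz' := norm_pos_iff.2 hz
  have hd : 1 ≤ d := NeZero.pos d
  have h1 : ‖Real.exp (-u) • z‖ = Real.exp (Real.log ‖z‖ - u) := by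
    rw [norm_smul, Real.norm_of_nonneg (Real.exp_pos _).le, sub_eq_add_neg, Real.exp_add,
      Real.exp_log hz', mul_comm]
  rw [coneDilation, coneKernel, h1, ← mul_assoc, ← mul_assoc, ← Real.exp_nat_mul, ← Real.exp_neg,
    ← Real.exp_add, ← Real.exp_add, Nat.cast_sub hd]
  congr 2
  push_cast; ring

end FourierPairing

/-! ### The multiplier of the kernel -/

/-- The Fourier multiplier `ξ ↦ ∫ φ(u) coneSymbol(e^u ξ) du`. -/
noncomputable def radialMultiplier {d : ℕ} (i : Fin d) (φ : ℝ → ℝ) (ξ : Rd d) : ℝ :=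
  logCorr (coneLog i) φ (Real.log ‖ξ‖)

section Multiplier

variable {d : ℕ} [NeZero d] {i : Fin d} {φ : ℝ → ℝ} {p q : ℝ}

lemma radialMultiplier_eq (hp0 : 0 < p) (hp1 : p < 1) (hq0 : q ≠ 0) (hq1 : q < 1)
    (hφ : IsTwoExpSymbol p q φ) {ξ : Rd d} (hξ : ξ ≠ 0) :
    Integrable (fun u => φ u * coneSymbol (Real.exp u • ξ)) ∧
      radialMultiplier i φ ξ = ∫ u, φ u * coneSymbol (Real.exp u • ξ) := by
  have hI := integrable_logCorr (isLogKernel_coneLog i) hp0 hp1 hq0 hq1 hφ (Real.log ‖ξ‖)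
  simp only [← coneLog_log_norm i hξ]
  constructor
  · simpa using hI.comp_add_right (Real.log ‖ξ‖)
  · rw [radialMultiplier, logCorr, ← integral_add_right_eq_self _ (Real.log ‖ξ‖)]
    simp

lemma measurable_radialMultiplier (hp0 : 0 < p) (hp1 : p < 1) (hq0 : q ≠ 0) (hq1 : q < 1)
    (hφ : IsTwoExpSymbol p q φ) : Measurable (radialMultiplier (d := d) i φ) :=
  (contDiff_logCorr (isLogKernel_coneLog i) hp0 hp1 hq0 hq1 hφ).continuous.measurable.comp
    (by fun_prop : Measurable fun ξ : Rd d => Real.log ‖ξ‖)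

/-- A crude bound: only local integrability at the origin is needed for the multiplier times a
Schwartz function to be integrable. -/
lemma exists_radialMultiplier_le (hp0 : 0 < p) (hp1 : p < 1) (hq0 : q ≠ 0) (hq1 : q < 1)
    (hφ : IsTwoExpSymbol p q φ) : ∃ C, 0 ≤ C ∧ ∀ ξ : Rd d, ξ ≠ 0 →
      |radialMultiplier i φ ξ| ≤ C * (1 + ‖ξ‖⁻¹) := by
  obtain ⟨C, hC⟩ := exists_logCorr_le (isLogKernel_coneLog i) hp0 hp1 hq0 hq1 hφ
  have hC0 : 0 ≤ C := nonneg_of_mul_nonneg_left ((abs_nonneg _).trans (hC 0)) (twoExp_pos _ _ _)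
  refine ⟨C, hC0, fun ξ hξ => (hC _).trans (mul_le_mul_of_nonneg_left ?_ hC0)⟩
  have hξ' := norm_pos_iff.2 hξ
  rcases le_total (-Real.log ‖ξ‖) 0 with h | h
  · rw [twoExp_of_nonpos h]
    have : Real.exp (p * -Real.log ‖ξ‖) ≤ 1 := Real.exp_le_one_iff.2 (by nlinarith)
    have : 0 < ‖ξ‖⁻¹ := inv_pos.2 hξ'
    linarith
  · rw [twoExp_of_nonneg h]
    have h1 : max q 0 ≤ 1 := max_le hq1.le zero_le_one
    have : Real.exp (max q 0 * -Real.log ‖ξ‖) ≤ Real.exp (-Real.log ‖ξ‖) :=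
      Real.exp_le_exp.2 (mul_le_of_le_one_left h h1)
    rw [Real.exp_neg (Real.log ‖ξ‖), Real.exp_log hξ'] at this
    linarith

lemma integrable_inv_norm_mul (hd : 3 ≤ d) {H : Rd d → ℂ} (hH : Integrable H) {B : ℝ}
    (hB : ∀ ξ, ‖H ξ‖ ≤ B) : Integrable fun ξ => (1 + ‖ξ‖⁻¹) * ‖H ξ‖ := by
  have hB0 : 0 ≤ B := (norm_nonneg _).trans (hB 0)
  have hm : AEStronglyMeasurable fun ξ => (1 + ‖ξ‖⁻¹) * ‖H ξ‖ :=
    (by fun_prop : Measurable fun ξ : Rd d => 1 + ‖ξ‖⁻¹).aestronglyMeasurable.mul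
      hH.aestronglyMeasurable.norm
  rw [← integrableOn_univ, ← union_compl_self (Metric.ball (0 : Rd d) 1)]
  refine IntegrableOn.union ?_ ?_
  · have h1 := (integrableOn_envelope_ball (d := d) (a := 0) (b := 0) (by norm_num) le_rfl
      1).const_mul (2 * B)
    refine Integrable.mono' h1 hm.restrict ?_
    filter_upwards [ae_restrict_mem measurableSet_ball, ae_restrict_of_ae ae_ne_zero] with ξ h h0
    have hξ' := norm_pos_iff.2 h0
    have h2 : 1 ≤ ‖ξ‖⁻¹ := (one_le_inv₀ hξ').2 (mem_ball_zero_iff.1 h).le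
    have h3 : ‖ξ‖⁻¹ ≤ ‖ξ‖⁻¹ ^ (d - 1) := le_self_pow₀ h2 (by omega)
    have h4 : twoExp 0 0 (Real.log ‖ξ‖) = 1 := by simp [twoExp]
    rw [Real.norm_of_nonneg (by positivity), envelope, h4, mul_one]
    calc _ ≤ (2 * ‖ξ‖⁻¹ ^ (d - 1)) * B :=
          mul_le_mul (by linarith) (hB ξ) (norm_nonneg _) (by positivity)
      _ = _ := by ring
  · refine Integrable.mono' (hH.norm.const_mul 2).integrableOn hm.restrict ?_
    filter_upwards [ae_restrict_mem measurableSet_ball.compl] with ξ h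
    have h1 : 1 ≤ ‖ξ‖ := by simpa using h
    have h2 : ‖ξ‖⁻¹ ≤ 1 := inv_le_one_of_one_le₀ h1
    rw [Real.norm_of_nonneg (by positivity)]
    gcongr
    linarith

lemma integrable_radialMultiplier_mul (hd : 3 ≤ d) (hp0 : 0 < p) (hp1 : p < 1) (hq0 : q ≠ 0)
    (hq1 : q < 1) (hφ : IsTwoExpSymbol p q φ) {H : Rd d → ℂ} (hH : Integrable H) {B : ℝ}
    (hB : ∀ ξ, ‖H ξ‖ ≤ B) : Integrable fun ξ => (radialMultiplier i φ ξ : ℂ) * H ξ := by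
  obtain ⟨C, hC0, hC⟩ := exists_radialMultiplier_le (d := d) (i := i) hp0 hp1 hq0 hq1 hφ
  refine ((integrable_inv_norm_mul hd hH hB).const_mul C).mono'
    ((measurable_radialMultiplier hp0 hp1 hq0 hq1 hφ).complex_ofReal.aestronglyMeasurable.mul
      hH.aestronglyMeasurable) ?_
  filter_upwards [ae_ne_zero] with ξ hξ
  rw [norm_mul, Complex.norm_real, Real.norm_eq_abs, ← mul_assoc]
  exact mul_le_mul_of_nonneg_right (hC ξ hξ) (norm_nonneg _)

end Multiplier

/-! ### Convolution with the kernel on the Fourier side -/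

section KernelConvolution

variable {d : ℕ} [NeZero d] {i : Fin d} {s δ a b C : ℝ} {g : Rd d → ℝ}

lemma eq_integral_coneDilation (hrad : ∀ x y : Rd d, ‖x‖ = ‖y‖ → g x = g y) (hδ0 : 0 < δ)
    (hh : IsTwoScaleProfile s δ (logProfile i g)) {z : Rd d} (hz : z ≠ 0) :
    Integrable (fun u => coneDensity (logProfile i g) u * coneDilation u z) ∧
      g z = ∫ u, coneDensity (logProfile i g) u * coneDilation u z := by
  obtain ⟨h1, h2⟩ := hh.eq_integral hδ0 (Real.log ‖z‖)
  simp only [coneDilation_eq _ hz, mul_left_comm _ (Real.exp (-((d : ℝ) - 1) * Real.log ‖z‖))]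
  refine ⟨h1.const_mul _, ?_⟩
  rw [integral_const_mul, ← h2, ← eq_logProfile hrad i hz]

/-- On the Fourier side, convolution with the kernel is multiplication by `radialMultiplier`. -/
lemma integral_kernel_mul_eq_fourierInv (hd : 3 ≤ d)
    (hrad : ∀ x y : Rd d, ‖x‖ = ‖y‖ → g x = g y) (hs0 : 0 < s) (hs1 : s < 1) (hδ0 : 0 < δ)
    (hδ1 : δ ≠ 1) (hh : IsTwoScaleProfile s δ (logProfile i g))
    (hg : IsRadialKernelBound a b C g) (ha : -1 < a) (hb : b ≤ 0) (v : SchwartzMap (Rd d) ℂ)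
    (hv : HasCompactSupport v) (x : Rd d) :
    ∫ z, (g z : ℂ) * v (x - z) =
      𝓕⁻ (fun ξ => (radialMultiplier i (coneDensity (logProfile i g)) ξ : ℂ) * 𝓕 (⇑v) ξ) x := by
  set φ := coneDensity (logProfile i g) with hφdef
  have hφ : IsTwoExpSymbol (1 - s) (1 - δ) φ := hh.isTwoExpSymbol_coneDensity
  have hφ0 : ∀ u, 0 ≤ φ u := hh.coneDensity_nonneg
  have hφm : Measurable φ := hφ.1.continuous.measurable
  have p0 : 0 < 1 - s := by linarith
  have p1 : 1 - s < 1 := by linarith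
  have q0 : 1 - δ ≠ 0 := fun h => hδ1 (by linarith)
  have q1 : 1 - δ < 1 := by linarith
  have hF : Integrable (𝓕 (⇑v)) := (𝓕 v).integrable
  obtain ⟨B, hB⟩ : ∃ B, ∀ ξ, ‖𝓕 (⇑v) ξ‖ ≤ B := by
    obtain ⟨B, hB⟩ := (𝓕 v).decay 0 0
    refine ⟨B, fun ξ => ?_⟩
    have h := hB.2 ξ
    simp only [pow_zero, one_mul, norm_iteratedFDeriv_zero] at h
    exact h
  have hvx : HasCompactSupport fun z => v (x - z) := hv.comp_const_sub x
  have hvc : Continuous fun z => v (x - z) := v.continuous.comp (by fun_prop)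
  have hgv : Integrable fun z => g z • v (x - z) := hg.integrable_smul ha hb hvc hvx
  -- Density and cones are nonnegative, so integrating the modulus in u returns g(z)|v(x - z)|,
  -- already known to be integrable.
  have hI1 : Integrable (fun P : Rd d × ℝ =>
      ((φ P.2 * coneDilation P.2 P.1 : ℝ) : ℂ) * v (x - P.1)) (volume.prod volume) := by
    refine (integrable_prod_iff ?_).2 ⟨?_, ?_⟩
    · exact (((hφm.comp measurable_snd).mul measurable_coneDilation).complex_ofReal.mul
        (hvc.measurable.comp measurable_fst)).aestronglyMeasurable
    · filter_upwards [ae_ne_zero] with z hz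
      exact (eq_integral_coneDilation hrad hδ0 hh hz).1.ofReal.mul_const _
    · refine hgv.norm.congr ?_
      filter_upwards [ae_ne_zero] with z hz
      have h := (eq_integral_coneDilation hrad hδ0 hh hz).2
      have hgz : 0 ≤ g z := h ▸ integral_nonneg fun u => mul_nonneg (hφ0 u) (coneDilation_nonneg _ _)
      simp only [norm_mul, Complex.norm_real, Real.norm_eq_abs, norm_smul,
        abs_of_nonneg (hφ0 _), abs_of_nonneg (coneDilation_nonneg _ _), abs_of_nonneg hgz]
      rw [integral_mul_const, ← h]
  -- The same on the Fourier side: `coneSymbol` is nonnegative, so integrating the modulus in u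
  -- returns the multiplier times the modulus of the transform of v.
  have hI2 : Integrable (fun P : Rd d × ℝ => Real.fourierChar (inner ℝ P.1 x) •
      (((φ P.2 * coneSymbol (Real.exp P.2 • P.1) : ℝ) : ℂ) * 𝓕 (⇑v) P.1))
      (volume.prod volume) := by
    refine (integrable_prod_iff ?_).2 ⟨?_, ?_⟩
    · have m1 : Measurable fun P : Rd d × ℝ => coneSymbol (Real.exp P.2 • P.1) :=
        continuous_coneSymbol.measurable.comp (by fun_prop)
      have m2 : Continuous fun P : Rd d × ℝ => Real.fourierChar (inner ℝ P.1 x) :=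
        Real.continuous_fourierChar.comp (by fun_prop)
      have m3 : Measurable (𝓕 (⇑v)) := (𝓕 v).continuous.measurable
      exact m2.aestronglyMeasurable.smul (((hφm.comp measurable_snd).mul m1).complex_ofReal.mul
        (m3.comp measurable_fst)).aestronglyMeasurable
    · filter_upwards [ae_ne_zero] with ξ hξ
      exact ((radialMultiplier_eq (i := i) p0 p1 q0 q1 hφ hξ).1.ofReal.mul_const _).smul _
    · refine (integrable_radialMultiplier_mul (i := i) hd p0 p1 q0 q1 hφ hF hB).norm.congr ?_
      filter_upwards [ae_ne_zero] with ξ hξ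
      have h := (radialMultiplier_eq (i := i) p0 p1 q0 q1 hφ hξ).2
      have h0 : 0 ≤ radialMultiplier i φ ξ :=
        h ▸ integral_nonneg fun u => mul_nonneg (hφ0 u) (coneSymbol_nonneg _)
      simp only [Circle.norm_smul, norm_mul, Complex.norm_real, Real.norm_eq_abs,
        abs_of_nonneg (hφ0 _), abs_of_nonneg (coneSymbol_nonneg _), abs_of_nonneg h0]
      rw [integral_mul_const, ← h]
  have hv2 : ∀ w, v w = 𝓕⁻ (𝓕 (⇑v)) w := fun w => by
    rw [v.continuous.fourierInv_fourier_eq v.integrable hF]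
  -- Since g need not be integrable at infinity, the transform is taken cone by cone, each cone
  -- being in L¹, with a Fubini exchange before and after.
  calc ∫ z, (g z : ℂ) * v (x - z)
      = ∫ z, ∫ u, ((φ u * coneDilation u z : ℝ) : ℂ) * v (x - z) := by
        refine integral_congr_ae ?_
        filter_upwards [ae_ne_zero] with z hz
        rw [integral_mul_const, integral_complex_ofReal, ← (eq_integral_coneDilation hrad hδ0 hh hz).2]
    _ = ∫ u, ∫ z, ((φ u * coneDilation u z : ℝ) : ℂ) * v (x - z) := integral_integral_swap hI1
    _ = ∫ u, ∫ ξ, Real.fourierChar (inner ℝ ξ x) •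
        (((φ u * coneSymbol (Real.exp u • ξ) : ℝ) : ℂ) * 𝓕 (⇑v) ξ) := by
        congr 1 with u
        have h := integral_mul_fourierInv_sub 
          ((integrable_coneDilation (d := d) u).ofReal (𝕜 := ℂ)) hF x
        have h' : ∫ z, (coneDilation u z : ℂ) * v (x - z) =
            𝓕⁻ (fun ξ => (coneSymbol (Real.exp u • ξ) : ℂ) * 𝓕 (⇑v) ξ) x := by
          simp only [hv2]
          refine h.trans ?_
          refine congrArg (fun f : Rd d → ℂ => 𝓕⁻ f x) (funext fun ξ => ?_)
          exact congrArg (· * 𝓕 (⇑v) ξ) (fourier_coneDilation u ξ)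
        simp only [Complex.ofReal_mul, mul_assoc, integral_const_mul, h', Real.fourierInv_eq,
          Circle.smul_def, smul_eq_mul, mul_left_comm _ (φ u : ℂ)]
    _ = ∫ ξ, ∫ u, Real.fourierChar (inner ℝ ξ x) •
        (((φ u * coneSymbol (Real.exp u • ξ) : ℝ) : ℂ) * 𝓕 (⇑v) ξ) :=
        (integral_integral_swap hI2).symm
    _ = _ := by
        rw [Real.fourierInv_eq]
        refine integral_congr_ae ?_
        filter_upwards [ae_ne_zero] with ξ hξ
        simp only [Circle.smul_def]
        rw [integral_smul, integral_mul_const, integral_complex_ofReal,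
          ← (radialMultiplier_eq (i := i) p0 p1 q0 q1 hφ hξ).2]

end KernelConvolution

/-! ### Pairing the dyadic potentials with the fractional gradient -/

section DyadicPairing

variable {d : ℕ} {p q : ℝ} {Q : ℝ → ℝ}

lemma fourier_fderiv_apply (f : SchwartzMap (Rd d) ℂ) (m ξ : Rd d) :
    𝓕 (fun x => fderiv ℝ f x m) ξ = 2 * Real.pi * Complex.I * (inner ℝ ξ m * 𝓕 (⇑f) ξ) := by
  have hm : (inner ℝ · m : Rd d → ℝ).HasTemperateGrowth :=
    ((innerSL ℝ).flip m).hasTemperateGrowth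
  have h := DFunLike.congr_fun (SchwartzMap.fourier_lineDerivOp_eq f m) ξ
  rw [smul_apply, SchwartzMap.smulLeftCLM_apply_apply hm, smul_eq_mul,
    Complex.real_smul] at h
  exact h

/-- The inverse Fourier transform of the `j`-th dyadic piece of `Q(log |ξ|) / (4π²|ξ|²)`. -/
noncomputable def complexPotential (hQ : IsReciprocalSymbol p q Q) (j : ℤ) :
    SchwartzMap (Rd d) ℂ :=
  (kernelSize d p q ((2 : ℝ) ^ j) : ℂ) •
    SchwartzMap.compCLMOfContinuousLinearEquiv ℂ
      (ContinuousLinearEquiv.smulLeft (Units.mk0 ((2 : ℝ) ^ j)⁻¹ (by positivity)))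
      (𝓕 (dyadicSchwartz (d := d) hQ (Real.log ((2 : ℝ) ^ j))))

lemma complexPotential_apply (hQ : IsReciprocalSymbol p q Q) (j : ℤ) (x : Rd d) :
    complexPotential hQ j x = (kernelSize d p q ((2 : ℝ) ^ j) : ℂ) *
      𝓕 (⇑(dyadicSchwartz (d := d) hQ (Real.log ((2 : ℝ) ^ j)))) (((2 : ℝ) ^ j)⁻¹ • x) := rfl

lemma dyadicPotential_eq_re (hQ : IsReciprocalSymbol p q Q) (j : ℤ) (x : Rd d) :
    dyadicPotential hQ j x = (complexPotential hQ j x).re := by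
  rw [complexPotential_apply, Complex.re_ofReal_mul]; rfl

lemma fderiv_dyadicPotential (hQ : IsReciprocalSymbol p q Q) (j : ℤ) (x w : Rd d) :
    fderiv ℝ (dyadicPotential hQ j) x w = (fderiv ℝ (complexPotential hQ j) x w).re := by
  have h := Complex.reCLM.hasFDerivAt.comp x ((complexPotential (d := d) hQ j).hasFDerivAt x)
  have e : dyadicPotential (d := d) hQ j = Complex.reCLM ∘ complexPotential hQ j :=
    funext fun x => dyadicPotential_eq_re hQ j x
  rw [e, h.fderiv]; rfl

lemma dyadicCut_neg (x : Rd d) : dyadicCut (-x) = dyadicCut x := by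
  simp only [dyadicCut, smul_neg, ContDiffBump.neg]

/-- Two forward transforms give a reflection, harmless because the symbol is even. The product of
`kernelSize` and λ^d is λ²/`twoExp p q (log λ)`, which undoes the normalization of the rescaled
symbol. -/
lemma fourier_complexPotential (hd : 2 ≤ d) (hQ : IsReciprocalSymbol p q Q) (j : ℤ) {ξ : Rd d}
    (hξ : ξ ≠ 0) : 𝓕 (⇑(complexPotential hQ j)) ξ =
      (dyadicCut ((2 : ℝ) ^ j • ξ) * (4 * Real.pi ^ 2 * ‖ξ‖ ^ 2)⁻¹ * Q (Real.log ‖ξ‖) : ℝ) := by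
  set lam := (2 : ℝ) ^ j with hlamdef
  have hlam : 0 < lam := by positivity
  have hξ' := norm_pos_iff.2 hξ
  set S := dyadicSchwartz (d := d) hQ (Real.log lam)
  have h1 : 𝓕 (⇑(complexPotential hQ j)) ξ =
      (kernelSize d p q lam * lam ^ d : ℝ) * 𝓕 (𝓕 (⇑S)) (lam • ξ) := by
    rw [Real.fourier_eq, Real.fourier_eq]
    have e : ∀ y : Rd d, Real.fourierChar (-inner ℝ y ξ) • complexPotential hQ j y =
        (fun w : Rd d => (kernelSize d p q lam : ℂ) *
          (Real.fourierChar (-inner ℝ w (lam • ξ)) • 𝓕 (⇑S) w)) (lam⁻¹ • y) := by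
      intro y
      simp only [complexPotential_apply]
      rw [mul_smul_comm, inner_smul_left, inner_smul_right]
      simp only [conj_trivial, ← mul_assoc]
      rw [inv_mul_cancel₀ hlam.ne', one_mul]
    simp only [e]
    rw [Measure.integral_comp_smul volume (fun w : Rd d => (kernelSize d p q lam : ℂ) *
          (Real.fourierChar (-inner ℝ w (lam • ξ)) • 𝓕 (⇑S) w)),
      integral_const_mul, finrank_euclideanSpace_fin, inv_pow, inv_inv,
      abs_of_pos (by positivity), Complex.real_smul, Complex.ofReal_mul]
    ring
  have h2 : 𝓕 (𝓕 (⇑S)) (lam • ξ) = S (-(lam • ξ)) := by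
    have := Real.fourierInv_eq_fourier_neg (𝓕 (⇑S)) (-(lam • ξ))
    rw [neg_neg] at this
    rw [← this, S.continuous.fourierInv_fourier_eq S.integrable (𝓕 S).integrable]
  rw [h1, h2, dyadicSchwartz_apply, ← Complex.ofReal_mul, dyadicSymbol, dyadicBase, dyadicCut_neg]
  congr 1
  by_cases h0 : dyadicCut (lam • ξ) = 0
  · simp [h0]
  have hlo : 1 / 2 ≤ ‖lam • ξ‖ := by
    by_contra h; exact h0 (dyadicCut_eq_zero_of_le (not_le.1 h).le)
  have hhi : ‖lam • ξ‖ ≤ 2 := by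
    by_contra h; exact h0 (dyadicCut_eq_zero_of_ge (not_le.1 h).le)
  have hn : ‖lam • ξ‖ = lam * ‖ξ‖ := by rw [norm_smul, Real.norm_of_nonneg hlam.le]
  -- On the support of the cutoff `cutLog` is the true logarithm, and log|λξ| - log λ = log|ξ|.
  rw [cutLog_eq (by rw [norm_neg]; linarith) (by rwa [norm_neg]), norm_neg, hn,
    Real.log_mul hlam.ne' hξ'.ne', add_sub_cancel_left, kernelSize]
  obtain ⟨m, rfl⟩ : ∃ m, d = m + 2 := ⟨d - 2, by omega⟩
  have hT := (twoExp_pos p q (Real.log lam)).ne'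
  rw [Nat.add_sub_cancel, inv_pow]
  field_simp
  ring

/-- The multiplier `Γ` describing convolution with `g` on the Fourier side. -/
structure IsConvolutionMultiplier (g Γ : Rd d → ℝ) : Prop where
  integrable : ∀ v : SchwartzMap (Rd d) ℂ, Integrable fun ξ => (Γ ξ : ℂ) * 𝓕 (⇑v) ξ
  integral_eq : ∀ v : SchwartzMap (Rd d) ℂ, HasCompactSupport v → ∀ x,
    ∫ z, (g z : ℂ) * v (x - z) = 𝓕⁻ (fun ξ => (Γ ξ : ℂ) * 𝓕 (⇑v) ξ) x

/-- A test function as a complex Schwartz function. -/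
noncomputable def IsTestFunction.toSchwartz {u : Rd d → ℝ} (hu : IsTestFunction u) :
    SchwartzMap (Rd d) ℂ :=
  HasCompactSupport.toSchwartzMap (f := fun x : Rd d => (u x : ℂ))
    (hu.2.comp_left (g := ((↑) : ℝ → ℂ)) Complex.ofReal_zero)
    (Complex.ofRealCLM.contDiff.comp hu.1)

lemma IsTestFunction.toSchwartz_apply {u : Rd d → ℝ} (hu : IsTestFunction u) (x : Rd d) :
    hu.toSchwartz x = (u x : ℂ) := rfl

lemma IsTestFunction.hasCompactSupport_toSchwartz {u : Rd d → ℝ} (hu : IsTestFunction u) :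
    HasCompactSupport hu.toSchwartz :=
  hu.2.comp_left (g := ((↑) : ℝ → ℂ)) Complex.ofReal_zero

lemma IsTestFunction.fderiv_toSchwartz {u : Rd d → ℝ} (hu : IsTestFunction u) (x w : Rd d) :
    fderiv ℝ hu.toSchwartz x w = (fderiv ℝ u x w : ℝ) := by
  have h := Complex.ofRealCLM.hasFDerivAt.comp x
    (hu.1.differentiable (by simp) x).hasFDerivAt
  have e : ⇑hu.toSchwartz = Complex.ofRealCLM ∘ u := rfl
  rw [e, h.fderiv]; rfl

open LineDeriv in
lemma IsConvolutionMultiplier.integral_fderiv_eq {g Γ : Rd d → ℝ}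
    (hΓ : IsConvolutionMultiplier g Γ) {u : Rd d → ℝ} (hu : IsTestFunction u) (m x : Rd d) :
    Integrable (fun ξ => (Γ ξ : ℂ) * 𝓕 (fun y => fderiv ℝ hu.toSchwartz y m) ξ) ∧
    ((∫ z, g z * fderiv ℝ u (x - z) m : ℝ) : ℂ) =
      𝓕⁻ (fun ξ => (Γ ξ : ℂ) * 𝓕 (fun y => fderiv ℝ hu.toSchwartz y m) ξ) x := by
  refine ⟨hΓ.integrable (∂_{m} hu.toSchwartz), ?_⟩
  have hc : HasCompactSupport ⇑(∂_{m} hu.toSchwartz : SchwartzMap (Rd d) ℂ) :=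
    hu.hasCompactSupport_toSchwartz.mono'
      ((subset_tsupport _).trans (SchwartzMap.tsupport_lineDerivOp_subset m _))
  refine Eq.trans ?_ (hΓ.integral_eq (∂_{m} hu.toSchwartz) hc x)
  rw [← integral_complex_ofReal]
  congr 1 with z
  rw [Complex.ofReal_mul]
  congr 1
  exact (hu.fderiv_toSchwartz (x - z) m).symm

lemma fderiv_apply_eq_sum (T : Rd d →L[ℝ] ℝ) (w : Rd d) :
    T w = ∑ k, T (EuclideanSpace.single k 1) * w k := by
  rw [← inner_dualVector, PiLp.inner_apply]
  refine Finset.sum_congr rfl fun k _ => ?_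
  rw [dualVector_apply]; simp [mul_comm]

open LineDeriv in
/-- Pairing the gradient of a dyadic potential with `g * ∇u` gives the dyadic piece of `u`. -/
lemma integral_fderiv_dyadicPotential [NeZero d] (hd : 2 ≤ d) (hQ : IsReciprocalSymbol p q Q)
    {g Γ : Rd d → ℝ} (hΓ : IsConvolutionMultiplier g Γ)
    (hQΓ : ∀ ξ, ξ ≠ 0 → Q (Real.log ‖ξ‖) * Γ ξ = 1) {u : Rd d → ℝ} (hu : IsTestFunction u)
    {G : Rd d → Rd d}
    (hG : ∀ x k, G x k = ∫ z, g z * fderiv ℝ u (x - z) (EuclideanSpace.single k 1))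
    (j : ℤ) (x : Rd d) :
    ∫ y, fderiv ℝ (dyadicPotential hQ j) y (G (x - y)) =
      -(𝓕⁻ (fun ξ => (dyadicCut ((2 : ℝ) ^ j • ξ) : ℂ) * 𝓕 (⇑hu.toSchwartz) ξ) x).re := by
  set N := complexPotential (d := d) hQ j
  set e : Fin d → Rd d := fun k => EuclideanSpace.single k 1
  set H : Fin d → Rd d → ℂ := fun k ξ => (Γ ξ : ℂ) * 𝓕 (fun y => fderiv ℝ hu.toSchwartz y (e k)) ξ
  have hH : ∀ k, Integrable (H k) := fun k => (hΓ.integral_fderiv_eq hu (e k) 0).1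
  have hGH : ∀ k w, (G w k : ℂ) = 𝓕⁻ (H k) w := fun k w => by
    rw [hG]; exact (hΓ.integral_fderiv_eq hu (e k) w).2
  have hn : ∀ k, Integrable fun y => fderiv ℝ N y (e k) := fun k => (∂_{e k} N).integrable
  have hcont : ∀ k, Continuous (𝓕⁻ (H k)) := fun k => by
    exact VectorFourier.fourierIntegral_continuous Real.continuous_fourierChar
      (L := -innerₗ (Rd d)) (by simp only [LinearMap.neg_apply, innerₗ_apply_apply]; fun_prop) (hH k)
  have hbd : ∀ k w, ‖𝓕⁻ (H k) w‖ ≤ ∫ ξ, ‖H k ξ‖ := fun k w =>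
    VectorFourier.norm_fourierIntegral_le_integral_norm _ _ _ _ _
  have hI1 : ∀ k, Integrable fun y => fderiv ℝ N y (e k) * 𝓕⁻ (H k) (x - y) := fun k =>
    (hn k).mul_bdd (c := ∫ ξ, ‖H k ξ‖) ((hcont k).comp (by fun_prop)).aestronglyMeasurable
      (Filter.Eventually.of_forall fun y => hbd k _)
  have hI2 : ∀ k, Integrable fun ξ => 𝓕 (fun y => fderiv ℝ N y (e k)) ξ * H k ξ := fun k =>
    (hH k).bdd_mul (c := ∫ y, ‖fderiv ℝ N y (e k)‖)
      (𝓕 (∂_{e k} N)).continuous.aestronglyMeasurable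
      (Filter.Eventually.of_forall fun ξ =>
        VectorFourier.norm_fourierIntegral_le_integral_norm _ _ _ _ _)
  have e1 : ∀ y, fderiv ℝ (dyadicPotential hQ j) y (G (x - y)) =
      (∑ k, fderiv ℝ N y (e k) * 𝓕⁻ (H k) (x - y)).re := by
    intro y
    rw [fderiv_apply_eq_sum, Complex.re_sum]
    refine Finset.sum_congr rfl fun k _ => ?_
    rw [fderiv_dyadicPotential, ← hGH, Complex.re_mul_ofReal]
  have e2 : ∫ y, ∑ k, fderiv ℝ N y (e k) * 𝓕⁻ (H k) (x - y) =
      -𝓕⁻ (fun ξ => (dyadicCut ((2 : ℝ) ^ j • ξ) : ℂ) * 𝓕 (⇑hu.toSchwartz) ξ) x := by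
    rw [integral_finsetSum _ fun k _ => hI1 k]
    have hp : ∀ k, ∫ y, fderiv ℝ N y (e k) * 𝓕⁻ (H k) (x - y) = ∫ ξ, Real.fourierChar
        (inner ℝ ξ x) • (𝓕 (fun y => fderiv ℝ N y (e k)) ξ * H k ξ) := fun k => by
      rw [integral_mul_fourierInv_sub (hn k) (hH k), Real.fourierInv_eq]
    simp only [hp]
    rw [Real.fourierInv_eq, ← integral_finsetSum _ fun k _ => integrable_fourierChar_smul (hI2 k) x, ← integral_neg]
    refine integral_congr_ae ?_
    filter_upwards [ae_ne_zero] with ξ hξ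
    rw [← Finset.smul_sum, ← smul_neg]
    congr 1
    have hξ' := norm_ne_zero_iff.2 hξ
    -- Two derivatives contribute (2πiξ_k)² = -4π²ξ_k². Summing over k gives -4π²|ξ|², cancelled by
    -- the factor 1/(4π²|ξ|²) of the potential, and Q Γ = 1 leaves minus the cutoff.
    have hk : ∀ k, 𝓕 (fun y => fderiv ℝ N y (e k)) ξ * H k ξ =
        ((ξ k) ^ 2 : ℝ) * (-(4 * Real.pi ^ 2) * Γ ξ * 𝓕 (⇑N) ξ * 𝓕 (⇑hu.toSchwartz) ξ) := by
      intro k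
      have hin : inner ℝ ξ (e k) = ξ k := by simp [e, EuclideanSpace.inner_single_right]
      simp only [H]
      rw [fourier_fderiv_apply, fourier_fderiv_apply, hin]
      push_cast
      linear_combination (4 * (Real.pi : ℂ) ^ 2 * (ξ k : ℂ) ^ 2 * Γ ξ * 𝓕 (⇑N) ξ *
        𝓕 (⇑hu.toSchwartz) ξ) * Complex.I_sq
    simp only [hk]
    rw [← Finset.sum_mul, ← Complex.ofReal_sum, ← EuclideanSpace.real_norm_sq_eq,
      fourier_complexPotential hd hQ j hξ]
    have h1 := hQΓ ξ hξ
    have h2 : ‖ξ‖ ^ 2 * (-(4 * Real.pi ^ 2) * Γ ξ * (dyadicCut ((2 : ℝ) ^ j • ξ) *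
        (4 * Real.pi ^ 2 * ‖ξ‖ ^ 2)⁻¹ * Q (Real.log ‖ξ‖))) = -dyadicCut ((2 : ℝ) ^ j • ξ) := by
      have : ‖ξ‖ ^ 2 * (4 * Real.pi ^ 2) * (4 * Real.pi ^ 2 * ‖ξ‖ ^ 2)⁻¹ = 1 := by
        field_simp
      linear_combination (-dyadicCut ((2 : ℝ) ^ j • ξ) * (Γ ξ * Q (Real.log ‖ξ‖))) * this -
        dyadicCut ((2 : ℝ) ^ j • ξ) * h1
    have h3 := congrArg (fun t : ℝ => (t : ℂ) * 𝓕 (⇑hu.toSchwartz) ξ) h2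
    push_cast at h3 ⊢
    linear_combination h3
  simp only [e1]
  rw [← Complex.neg_re, ← e2]
  exact Complex.reCLM.integral_comp_comm (integrable_finsetSum _ fun k _ => hI1 k)

end DyadicPairing

/-! ### Dyadic partition of unity -/

/-- Dominated convergence along the filter of finite index sets, with one integrable majorant for
all partial sums of norms. -/
lemma hasSum_integral_of_sum_norm_le {ι α E : Type*} [Countable ι] [MeasurableSpace α]
    {μ : Measure α} [NormedAddCommGroup E] [NormedSpace ℝ E] {F : ι → α → E} {f : α → E}
    {D : α → ℝ} (hm : ∀ j, AEStronglyMeasurable (F j) μ) (hD : Integrable D μ)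
    (hle : ∀ᵐ y ∂μ, ∀ s : Finset ι, ∑ j ∈ s, ‖F j y‖ ≤ D y)
    (hlim : ∀ᵐ y ∂μ, HasSum (fun j => F j y) (f y)) :
    HasSum (fun j => ∫ y, F j y ∂μ) (∫ y, f y ∂μ) := by
  have hint : ∀ j, Integrable (F j) μ := fun j => hD.mono' (hm j) <| by
    filter_upwards [hle] with y hy
    simpa using hy {j}
  have e : ∀ s : Finset ι, ∑ j ∈ s, ∫ y, F j y ∂μ = ∫ y, ∑ j ∈ s, F j y ∂μ := fun s =>
    (integral_finsetSum _ fun j _ => hint j).symm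
  unfold HasSum
  simp only [e]
  refine tendsto_integral_filter_of_dominated_convergence D
    (Filter.Eventually.of_forall fun s => (integrable_finsetSum s fun j _ => hint j).1)
    (Filter.Eventually.of_forall fun s => ?_) hD hlim
  filter_upwards [hle] with y hy using (norm_sum_le _ _).trans (hy s)

section PartitionOfUnity

variable {d : ℕ}

lemma dyadicCut_nonneg (x : Rd d) : 0 ≤ dyadicCut x := by
  rcases le_total ‖x‖ 1 with h | h
  · rw [dyadicCut, unitBump_eq_one h]
    exact sub_nonneg.2 (unitBump d).le_one
  · rw [dyadicCut, unitBump_eq_zero (x := (2 : ℝ) • x), sub_zero]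
    · exact (unitBump d).nonneg
    · rw [norm_smul]; norm_num; linarith

/-- The sum telescopes on each half of ℤ: the nonnegative indices give β 0, the negative ones 1 - β
0. -/
lemma hasSum_int_sub {β : ℤ → ℝ} (hβ : ∀ j, 0 ≤ β j - β (j + 1)) {N : ℕ}
    (hpos : ∀ n : ℕ, N ≤ n → β n = 0) (hneg : ∀ n : ℕ, N ≤ n → β (-n) = 1) :
    HasSum (fun j : ℤ => β j - β (j + 1)) 1 := by
  have h1 : HasSum (fun n : ℕ => β n - β (n + 1)) (β 0) := by
    rw [hasSum_iff_tendsto_nat_of_nonneg fun n => hβ n]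
    refine tendsto_nhds_of_eventually_eq ?_
    filter_upwards [Filter.eventually_ge_atTop N] with n hn
    have e := Finset.sum_range_sub' (fun n : ℕ => β n) n
    push_cast at e
    rw [e, hpos n hn, sub_zero]
  have h2 : HasSum (fun n : ℕ => β (-(n + 1)) - β (-(n + 1) + 1)) (1 - β 0) := by
    rw [hasSum_iff_tendsto_nat_of_nonneg fun n => hβ _]
    refine tendsto_nhds_of_eventually_eq ?_
    filter_upwards [Filter.eventually_ge_atTop N] with n hn
    have e := Finset.sum_range_sub (fun n : ℕ => β (-n)) n
    push_cast at e
    simp only [neg_add_rev, neg_add_cancel_comm] at e ⊢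
    rw [e, hneg n hn, neg_zero]
  have h := HasSum.of_nat_of_neg_add_one (f := fun j : ℤ => β j - β (j + 1)) h1 h2
  rwa [add_sub_cancel] at h

lemma hasSum_dyadicCut {ξ : Rd d} (hξ : ξ ≠ 0) :
    HasSum (fun j : ℤ => dyadicCut ((2 : ℝ) ^ j • ξ)) 1 := by
  have hξ' := norm_pos_iff.2 hξ
  have hb : ∀ j : ℤ, dyadicCut ((2 : ℝ) ^ j • ξ) =
      unitBump d ((2 : ℝ) ^ j • ξ) - unitBump d ((2 : ℝ) ^ (j + 1) • ξ) := fun j => by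
    rw [dyadicCut, smul_smul, zpow_add_one₀ two_ne_zero, mul_comm]
  obtain ⟨N, hN⟩ := pow_unbounded_of_one_lt (max (2 / ‖ξ‖) ‖ξ‖) (one_lt_two (α := ℝ))
  simp only [hb]
  refine hasSum_int_sub (β := fun j : ℤ => unitBump d ((2 : ℝ) ^ j • ξ)) (N := N)
    (fun j => hb j ▸ dyadicCut_nonneg _) (fun n hn => unitBump_eq_zero ?_)
    (fun n hn => unitBump_eq_one ?_)
  · have h1 : 2 / ‖ξ‖ < 2 ^ N := (le_max_left _ _).trans_lt hN
    rw [norm_smul, zpow_natCast, norm_pow, Real.norm_ofNat]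
    rw [div_lt_iff₀ hξ'] at h1
    exact h1.le.trans (mul_le_mul_of_nonneg_right (pow_le_pow_right₀ one_le_two hn) hξ'.le)
  · rw [norm_smul, zpow_neg, zpow_natCast, norm_inv, norm_pow, Real.norm_ofNat,
      inv_mul_le_iff₀ (by positivity), mul_one]
    exact ((le_max_right _ _).trans hN.le).trans (pow_le_pow_right₀ one_le_two hn)

lemma hasSum_fourierInv_dyadicCut [NeZero d] {F : Rd d → ℂ} (hF : Integrable F) (x : Rd d) :
    HasSum (fun j : ℤ => 𝓕⁻ (fun ξ => (dyadicCut ((2 : ℝ) ^ j • ξ) : ℂ) * F ξ) x) (𝓕⁻ F x) := by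
  simp only [Real.fourierInv_eq]
  refine hasSum_integral_of_sum_norm_le (D := fun ξ => ‖F ξ‖) (fun j => ?_) hF.norm ?_ ?_
  · have m1 : Continuous fun ξ : Rd d => (dyadicCut ((2 : ℝ) ^ j • ξ) : ℂ) :=
      Complex.continuous_ofReal.comp (contDiff_dyadicCut.continuous.comp (by fun_prop))
    have m2 : Continuous fun ξ : Rd d => Real.fourierChar (inner ℝ ξ x) :=
      Real.continuous_fourierChar.comp (by fun_prop)
    exact m2.aestronglyMeasurable.smul (m1.aestronglyMeasurable.mul hF.1)
  · filter_upwards [ae_ne_zero] with ξ hξ s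
    simp only [Circle.norm_smul, norm_mul, Complex.norm_real, Real.norm_of_nonneg
      (dyadicCut_nonneg _)]
    rw [← Finset.sum_mul]
    exact mul_le_of_le_one_left (norm_nonneg _)
      (sum_le_hasSum s (fun j _ => dyadicCut_nonneg _) (hasSum_dyadicCut hξ))
  · filter_upwards [ae_ne_zero] with ξ hξ
    have h := ((Complex.hasSum_ofReal.2 (hasSum_dyadicCut hξ)).mul_right (F ξ)).const_smul
      (Real.fourierChar (inner ℝ ξ x) : ℂ)
    simpa [Circle.smul_def] using h

end PartitionOfUnity

/-! ### The representation formula -/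

section Representation

variable {d : ℕ} [NeZero d] {p q a b C : ℝ} {Q : ℝ → ℝ} {g Γ : Rd d → ℝ}

lemma kernelSize_mul_inv (hd : 2 ≤ d) (y : Rd d) :
    kernelSize d p q ‖y‖ * ‖y‖⁻¹ = envelope (-p) (-q) (d - 1) y := by
  have h : (twoExp p q (Real.log ‖y‖))⁻¹ = twoExp (-p) (-q) (Real.log ‖y‖) := by
    rcases le_total (Real.log ‖y‖) 0 with h | h
    · rw [twoExp_of_nonpos h, twoExp_of_nonpos h, neg_mul, Real.exp_neg]
    · rw [twoExp_of_nonneg h, twoExp_of_nonneg h, neg_mul, Real.exp_neg]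
  obtain ⟨m, rfl⟩ : ∃ m, d = m + 2 := ⟨d - 2, by omega⟩
  rw [kernelSize, h, envelope, show m + 2 - 1 = m + 1 by omega, Nat.add_sub_cancel, pow_succ]
  ring

/-- Locally the singularity has order d - 1 + p < d. At infinity both factors decay like
|y|^{-(d-1)}, and 2(d - 1) > d because d ≥ 3. This is the absolute convergence of V * 𝒢u. -/
lemma integrable_envelope_mul_norm (hd : 3 ≤ d) (hp : p < 1) (hq : 0 ≤ q) {G : Rd d → Rd d}
    (hG : Continuous G) {K : ℝ} (hK : ∀ w, ‖G w‖ ≤ K)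
    (hK' : ∀ w, w ≠ 0 → ‖G w‖ ≤ K * ‖w‖⁻¹ ^ (d - 1)) (x : Rd d) :
    Integrable fun y => envelope (-p) (-q) (d - 1) y * ‖G (x - y)‖ := by
  have hK0 : 0 ≤ K := (norm_nonneg _).trans (hK 0)
  have hm : AEStronglyMeasurable fun y => envelope (-p) (-q) (d - 1) y * ‖G (x - y)‖ :=
    (measurable_envelope _).aestronglyMeasurable.mul
      (hG.comp (by fun_prop : Continuous fun y : Rd d => x - y)).norm.aestronglyMeasurable
  set r := 2 * ‖x‖ + 1
  have hr : 1 ≤ r := by simp only [r]; linarith [norm_nonneg x]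
  rw [← integrableOn_univ, ← union_compl_self (Metric.ball (0 : Rd d) r)]
  refine IntegrableOn.union ?_ ?_
  · refine Integrable.mono' ((integrableOn_envelope_ball (d := d) (a := -p) (b := -q)
      (by linarith) (by linarith) r).mul_const K) hm.restrict
      (Filter.Eventually.of_forall fun y => ?_)
    rw [Real.norm_of_nonneg (mul_nonneg (envelope_nonneg _ _) (norm_nonneg _))]
    exact mul_le_mul_of_nonneg_left (hK _) (envelope_nonneg _ _)
  · have h1 : IntegrableOn (fun y : Rd d => ‖y‖⁻¹ ^ (2 * (d - 1))) (Metric.ball 0 r)ᶜ :=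
      (integrableOn_inv_norm_pow_compl (by omega)).mono_set
        (compl_subset_compl.2 (Metric.ball_subset_ball hr))
    refine Integrable.mono' (h1.const_mul (K * 2 ^ (d - 1))) hm.restrict ?_
    filter_upwards [ae_restrict_mem measurableSet_ball.compl] with y hy
    have hy1 : r ≤ ‖y‖ := by simpa using hy
    have hy0 : 0 < ‖y‖ := by linarith
    have h2 : ‖y‖ / 2 ≤ ‖x - y‖ := by
      have := norm_sub_norm_le y x
      rw [norm_sub_rev] at this
      simp only [r] at hy1; linarith
    have h3 : ‖x - y‖⁻¹ ≤ 2 * ‖y‖⁻¹ := by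
      rw [show 2 * ‖y‖⁻¹ = (‖y‖ / 2)⁻¹ by rw [inv_div]; rfl]
      exact inv_anti₀ (by linarith) h2
    have h4 : x - y ≠ 0 := norm_pos_iff.1 (by linarith)
    have h5 : envelope (-p) (-q) (d - 1) y ≤ ‖y‖⁻¹ ^ (d - 1) := by
      rw [envelope, twoExp_log_of_one_le (hr.trans hy1)]
      exact mul_le_of_le_one_right (by positivity)
        (Real.rpow_le_one_of_one_le_of_nonpos (hr.trans hy1) (by linarith))
    rw [Real.norm_of_nonneg (mul_nonneg (envelope_nonneg _ _) (norm_nonneg _))]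
    calc _ ≤ ‖y‖⁻¹ ^ (d - 1) * (K * (2 * ‖y‖⁻¹) ^ (d - 1)) := by
          refine mul_le_mul h5 ((hK' _ h4).trans ?_) (norm_nonneg _) (by positivity)
          gcongr
      _ = _ := by rw [mul_pow, two_mul, pow_add]; ring

/-- The series of the -∇N_j, paired with 𝒢u, converges to V·𝒢u under an integrable majorant, so its
integrals sum to V * 𝒢u. Those same integrals are the dyadic pieces of u, which sum to u by Fourier
inversion. -/
lemma representationFormula_representingField (hd : 3 ≤ d) (hQ : IsReciprocalSymbol p q Q)
    (hp0 : 0 ≤ p) (hp : p < 1) (hq0 : 0 ≤ q) (hq : q ≤ 1) (hg : IsRadialKernelBound a b C g)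
    (hC : 0 ≤ C) (ha : -1 < a) (hb : b < 0) (hΓ : IsConvolutionMultiplier g Γ)
    (hQΓ : ∀ ξ, ξ ≠ 0 → Q (Real.log ‖ξ‖) * Γ ξ = 1) :
    RepresentationFormula g (representingField hQ) := by
  intro u hu
  set G := fractionalGradient g u
  have hGe : ∀ x, G x = ∫ z, g z • gradient u (x - z) := hg.fractionalGradient_eq ha hb hu
  have hGk : ∀ x k, G x k = ∫ z, g z * fderiv ℝ u (x - z) (EuclideanSpace.single k 1) := by
    intro x k
    have hI : Integrable fun z => g z • gradient u (x - z) := hg.integrable_smul ha hb.le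
      (hu.continuous_gradient.comp (by fun_prop)) (hu.hasCompactSupport_gradient.comp_const_sub x)
    have h := (EuclideanSpace.proj (𝕜 := ℝ) k).integral_comp_comm hI
    rw [hGe]
    refine h.symm.trans ?_
    congr 1 with z
    rw [PiLp.proj_apply, PiLp.smul_apply, gradient_eq_dualVector, dualVector_apply,
      smul_eq_mul]
  -- Each component of G is the real part of the inverse Fourier transform of an integrable
  -- function, hence continuous.
  have hGc : Continuous G := by
    have hk : ∀ k, Continuous fun x => G x k := by
      intro k
      obtain ⟨h1, -⟩ := hΓ.integral_fderiv_eq hu (EuclideanSpace.single k 1) 0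
      have h2 := VectorFourier.fourierIntegral_continuous Real.continuous_fourierChar
        (L := -innerₗ (Rd d))
        (by simp only [LinearMap.neg_apply, innerₗ_apply_apply]; fun_prop) h1
      refine (Complex.continuous_re.comp h2).congr fun x => ?_
      rw [hGk, ← Complex.ofReal_re (∫ z, _), (hΓ.integral_fderiv_eq hu _ x).2]
      rfl
    have e : G = fun x => ∑ k, G x k • (EuclideanSpace.basisFun (Fin d) ℝ) k :=
      funext fun x => ((EuclideanSpace.basisFun (Fin d) ℝ).sum_repr (G x)).symm
    rw [e]
    exact continuous_finsetSum _ fun k _ => (hk k).smul continuous_const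
  obtain ⟨K, hK0, hK⟩ := hg.exists_norm_integral_le hC ha hb.le hu.continuous_gradient
    hu.hasCompactSupport_gradient
  simp only [← hGe] at hK
  have hfam := isDyadicFamily_dyadicPotential hd hQ hp0 hp.le hq0 hq
  have hU := locallyBddAbove_kernelSize hd hp0 hq0
  have hU0 : ∀ ρ > 0, 0 ≤ kernelSize d p q ρ := fun ρ hρ => (kernelSize_pos d p q hρ).le
  obtain ⟨M, hM0, hM⟩ := hfam.fderiv.summable_norm
  simp only [kernelSize_mul_inv (show 2 ≤ d by omega)] at hM
  have hD : ∀ x, Integrable fun y => M * (envelope (-p) (-q) (d - 1) y * ‖G (x - y)‖) := fun x =>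
    (integrable_envelope_mul_norm hd hp hq0 hGc (fun w => (hK w).1) (fun w => (hK w).2) x).const_mul M
  have hVm : AEStronglyMeasurable (representingField (d := d) hQ) :=
    aestronglyMeasurable_of_continuousOn
      (representingField_spec hd hQ hp0 hp.le hq0 hq).1.continuousOn
  have hle : ∀ x, ∀ᵐ y : Rd d, ∀ s : Finset ℤ,
      ∑ j ∈ s, ‖-fderiv ℝ (dyadicPotential hQ j) y (G (x - y))‖ ≤
        M * (envelope (-p) (-q) (d - 1) y * ‖G (x - y)‖) := by
    intro x
    filter_upwards [ae_ne_zero] with y hy s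
    obtain ⟨h1, h2⟩ := hM y hy
    calc _ ≤ ∑ j ∈ s, ‖fderiv ℝ (dyadicPotential hQ j) y‖ * ‖G (x - y)‖ :=
          Finset.sum_le_sum fun j _ => by
            rw [norm_neg]; exact ContinuousLinearMap.le_opNorm _ _
      _ ≤ (M * envelope (-p) (-q) (d - 1) y) * ‖G (x - y)‖ := by
          rw [← Finset.sum_mul]
          exact mul_le_mul_of_nonneg_right
            ((h1.sum_le_tsum s fun j _ => norm_nonneg _).trans h2) (norm_nonneg _)
      _ = _ := by ring
  have hlim : ∀ x, ∀ᵐ y : Rd d,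
      HasSum (fun j => -fderiv ℝ (dyadicPotential hQ j) y (G (x - y)))
        (innerSL ℝ (representingField hQ y) (G (x - y))) := by
    intro x
    filter_upwards [ae_ne_zero] with y hy
    have h1 : Summable fun j => fderiv ℝ (dyadicPotential hQ j) y := (hM y hy).1.of_norm
    have h2 := h1.hasSum.mapL (ContinuousLinearMap.apply ℝ ℝ (G (x - y)))
    have h3 : innerSL ℝ (representingField hQ y) (G (x - y)) =
        -(∑' j, fderiv ℝ (dyadicPotential hQ j) y) (G (x - y)) := by
      rw [innerSL_apply_apply, representingField, (hfam.hasFDerivAt_tsum hU hU0 hy).fderiv,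
        inner_neg_left, inner_dualVector]
    rw [h3]
    exact h2.neg
  have hVI : ∀ x, Integrable fun y => innerSL ℝ (representingField hQ y) (G (x - y)) := by
    intro x
    refine (hD x).mono' ?_ ?_
    · exact hVm.inner (𝕜 := ℝ) (hGc.comp (by fun_prop :
        Continuous fun y : Rd d => x - y)).aestronglyMeasurable
    · filter_upwards [hle x, hlim x] with y h1 h2
      exact le_of_tendsto h2.norm (Filter.Eventually.of_forall fun s =>
        (norm_sum_le _ _).trans (h1 s))
  refine ⟨hVI, fun x => ?_⟩
  have hsum := hasSum_integral_of_sum_norm_le (fun j => ?_) (hD x) (hle x) (hlim x)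
  · simp only [integral_neg, integral_fderiv_dyadicPotential (show 2 ≤ d by omega) hQ hΓ hQΓ hu hGk,
      neg_neg] at hsum
    have hF : Integrable (𝓕 (⇑hu.toSchwartz)) := (𝓕 hu.toSchwartz).integrable
    have h2 := Complex.hasSum_re (hasSum_fourierInv_dyadicCut hF x)
    rw [hu.toSchwartz.continuous.fourierInv_fourier_eq hu.toSchwartz.integrable hF,
      hu.toSchwartz_apply, Complex.ofReal_re] at h2
    exact h2.unique hsum
  · have h1 : Continuous fun y => fderiv ℝ (dyadicPotential (d := d) hQ j) y :=
      (contDiff_dyadicPotential hQ j).continuous_fderiv (by simp)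
    exact (h1.clm_apply (hGc.comp (by fun_prop))).neg.aestronglyMeasurable

end Representation

/-! ### Assembly of the three kernel types -/

section Assembly

variable {d : ℕ}

lemma norm_exp_smul_single (i : Fin d) (y : ℝ) :
    ‖Real.exp y • (EuclideanSpace.single i (1 : ℝ) : Rd d)‖ = Real.exp y := by
  rw [norm_smul, PiLp.norm_single, Real.norm_of_nonneg (Real.exp_pos _).le]; simp

lemma exp_mul_div_rpow (A σ y : ℝ) :
    Real.exp (((d : ℝ) - 1) * y) * (A / Real.exp y ^ ((d : ℝ) - 1 + σ)) =
      A * Real.exp (-σ * y) := by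
  rw [← Real.exp_mul, div_eq_mul_inv, ← Real.exp_neg, mul_left_comm, ← Real.exp_add]
  congr 2; ring

lemma isTwoScaleProfile_logProfile {g : Rd d → ℝ} (hg : PositivityAssumption g) (i : Fin d)
    {s δ r R A B : ℝ} (hr : 0 < r) (hR : 0 < R) (hA : 0 < A) (hB : δ < 1 → 0 < B)
    (hleft : ∀ x : Rd d, x ≠ 0 → ‖x‖ ≤ r → g x = A / ‖x‖ ^ ((d : ℝ) - 1 + s))
    (hright : ∀ x : Rd d, R ≤ ‖x‖ → g x = B / ‖x‖ ^ ((d : ℝ) - 1 + δ)) :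
    IsTwoScaleProfile s δ (logProfile i g) where
  contDiff := contDiff_logProfile hg.smooth i
  left := by
    refine ⟨A, hA, Real.log r, fun u hu => ?_⟩
    rw [logProfile, hleft, norm_exp_smul_single, exp_mul_div_rpow]
    · rw [← norm_pos_iff, norm_exp_smul_single]; exact Real.exp_pos u
    · rw [norm_exp_smul_single]; exact (Real.le_log_iff_exp_le hr).1 hu
  right := by
    refine ⟨B, Real.log R, fun u hu => ?_, hB⟩
    rw [logProfile, hright, norm_exp_smul_single, exp_mul_div_rpow]
    rw [norm_exp_smul_single]; exact (Real.log_le_iff_le_exp hR).1 hu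
  convex := logProfile_convex hg i

lemma isConvolutionMultiplier_radialMultiplier [NeZero d] (hd : 3 ≤ d) {g : Rd d → ℝ}
    (hrad : ∀ x y : Rd d, ‖x‖ = ‖y‖ → g x = g y) {i : Fin d} {s δ a b C : ℝ} (hs0 : 0 < s)
    (hs1 : s < 1) (hδ0 : 0 < δ) (hδ1 : δ ≠ 1) (hh : IsTwoScaleProfile s δ (logProfile i g))
    (hg : IsRadialKernelBound a b C g) (ha : -1 < a) (hb : b ≤ 0) :
    IsConvolutionMultiplier g (radialMultiplier i (coneDensity (logProfile i g))) where
  integrable v := by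
    obtain ⟨B, hB⟩ := (𝓕 v).decay 0 0
    refine integrable_radialMultiplier_mul hd (p := 1 - s) (q := 1 - δ) (B := B) (by linarith)
      (by linarith) (fun h => hδ1 (by linarith)) (by linarith) hh.isTwoExpSymbol_coneDensity
      (𝓕 v).integrable fun ξ => ?_
    have h := hB.2 ξ
    simp only [pow_zero, one_mul, norm_iteratedFDeriv_zero] at h
    exact h
  integral_eq v hv x :=
    integral_kernel_mul_eq_fourierInv hd hrad hs0 hs1 hδ0 hδ1 hh hg ha hb v hv x

/-- All three types are instances of a power tail of exponent d - 1 + δ with δ ≠ 1. For δ > 1 the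
multiplier stays bounded at low frequency and τ = 1; for δ < 1 it blows up like |ξ|^{-(1-δ)} and τ =
δ. -/
theorem exists_representation (hd : 3 ≤ d) {g : Rd d → ℝ} (hg : PositivityAssumption g)
    {s δ τ r R A B : ℝ} (hs0 : 0 < s) (hs1 : s < 1) (hδ0 : 0 < δ) (hδ1 : δ ≠ 1)
    (hτ0 : 0 ≤ τ) (hτ : max (1 - δ) 0 = 1 - τ) (hr : 0 < r) (hR : 0 < R) (hA : 0 < A)
    (hB : δ < 1 → 0 < B)
    (hleft : ∀ x : Rd d, x ≠ 0 → ‖x‖ ≤ r → g x = A / ‖x‖ ^ ((d : ℝ) - 1 + s))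
    (hright : ∀ x : Rd d, R ≤ ‖x‖ → g x = B / ‖x‖ ^ ((d : ℝ) - 1 + δ)) :
    GradientCondition g ∧
      ∃ V : Rd d → Rd d, ContDiffOn ℝ ∞ V {0}ᶜ ∧ RepresentationFormula g V ∧
        DerivativeBounds s τ V := by
  have : NeZero d := ⟨by omega⟩
  set i : Fin d := ⟨0, by omega⟩
  have hτ1 : τ ≤ 1 := by linarith [le_max_right (1 - δ) 0]
  have hh := isTwoScaleProfile_logProfile hg i hr hR hA hB hleft hright
  obtain ⟨C, hC, hgB⟩ := exists_isRadialKernelBound (by omega) hg i hh.isTwoExpSymbol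
  obtain ⟨hpos, hQ⟩ := hh.isReciprocalSymbol hs0 hs1 hδ0 hδ1 (isLogKernel_coneLog i)
  rw [hτ] at hQ
  refine ⟨hgB.gradientCondition (by linarith) (by linarith), representingField hQ,
    (representingField_spec hd hQ (by linarith) (by linarith) (by linarith) (by linarith)).1, ?_,
    derivativeBounds_representingField hd hs0.le hs1.le hτ0 hτ1 hQ⟩
  exact representationFormula_representingField hd hQ (by linarith) (by linarith) (by linarith)
    (by linarith) hgB hC (by linarith) (by linarith)
    (isConvolutionMultiplier_radialMultiplier hd hg.radial hs0 hs1 hδ0 hδ1 hh hgB (by linarith)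
      (by linarith)) fun ξ _ => inv_mul_cancel₀ (hpos _).ne'

end Assembly

theorem mainTheorem1 (d : ℕ) (hd : 3 ≤ d) (g : Rd d → ℝ) (hg : PositivityAssumption g)
    (s r R : ℝ) (hs0 : 0 < s) (hs1 : s < 1) (hr : 0 < r) (hrR : r < R) :
    (IsLocalizedKernel s r R g →
      GradientCondition g ∧
        ∃ V : Rd d → Rd d, ContDiffOn ℝ ∞ V {0}ᶜ ∧ RepresentationFormula g V ∧
          DerivativeBounds s 1 V) ∧
    (∀ α a b : ℝ, (d : ℝ) < α → 0 < a → 0 < b → IsIntegrableTailKernel s α a b r R g →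
      GradientCondition g ∧
        ∃ V : Rd d → Rd d, ContDiffOn ℝ ∞ V {0}ᶜ ∧ RepresentationFormula g V ∧
          DerivativeBounds s 1 V) ∧
    (∀ t a b : ℝ, 0 < t → t < 1 → 0 < a → 0 < b → IsTwoScaleKernel s t a b r R g →
      GradientCondition g ∧
        ∃ V : Rd d → Rd d, ContDiffOn ℝ ∞ V {0}ᶜ ∧ RepresentationFormula g V ∧
          DerivativeBounds s t V) := by
  have hR : 0 < R := hr.trans hrR
  refine ⟨fun hK => ?_, fun α a b hα ha hb hK => ?_, fun t a b ht0 ht1 ha hb hK => ?_⟩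
  -- A vanishing tail is a power tail with coefficient 0; any δ > 1 would do.
  · exact exists_representation hd hg (δ := 2) (B := 0) hs0 hs1 (by norm_num) (by norm_num)
      zero_le_one (by norm_num) hr hR one_pos (fun h => by norm_num at h) hK.1
      fun x hx => by rw [hK.2 x hx, zero_div]
  -- The choice solves d - 1 + δ = α, and α > d means δ > 1.
  · refine exists_representation hd hg (δ := α - d + 1) (B := b) hs0 hs1 (by linarith)
      (by linarith : 1 < α - d + 1).ne' zero_le_one ?_ hr hR ha (fun _ => hb) hK.1 fun x hx => ?_
    · rw [sub_self, max_eq_right (by linarith)]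
    · rw [hK.2 x hx, show (d : ℝ) - 1 + (α - d + 1) = α by ring]
  · exact exists_representation hd hg (δ := t) (B := b) hs0 hs1 ht0 ht1.ne ht0.le
      (max_eq_left (by linarith)) hr hR ha (fun _ => hb) hK.1 hK.2
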